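/- **Setting.** Let $n\in\mathbb N$, $\alpha\in(0,1)$. For an open set $O\subset\mathbb R^n$, $buc^{k+\alpha}(O)$ denotes the little Hölder space, i.e. the closure of $\mathrm{BUC}^{k+\beta}(O)$, $\beta\in(\alpha,1)$, in $\mathrm{BUC}^{k+\alpha}(O)$; the spaces $buc^{k+\alpha}(\Gamma)$ on a compact hypersurface $\Gamma$ of class $buc^{k+\alpha}$ are obtained by localization. Let $\mathcal M^{2+\alpha}$ be the set of (non-empty) compact orientable embedded hypersurfaces of $\mathbb R^n$ of class $buc^{2+\alpha}$, let $\Gamma_0\in\mathcal M^{2+\alpha}$, and let $\nu_0$ be a continuous unit normal field on $\Gamma_0$. *Regularized field.* Let $R>0$ be a tubular radius of $\Gamma_0$, i.e. such that $(y,r)\mapsto y+r\nu_0(y)$ is a diffeomorphism from $\Gamma_0\times(-R,R)$ onto $\{x: \operatorname{dist}(x,\Gamma_0)<R\}$. Let $\eta:\mathbb R\to[0,1]$ be smooth, $\eta=1$ on $[-R/2,R/2]$, $\eta=0$ off $(-3R/4,3R/4)$, and let $\psi\ge 0$ be a smooth compactly supported function on $\mathbb R^n$ with $\int\psi=1$,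 $\psi_\delta(x)=\delta^{-n}\psi(x/\delta)$. Put $\widetilde\nu(y+r\nu_0(y))=\eta(r)\nu_0(y)$ for $y\in\Gamma_0$, $|r|<R$, put $\widetilde\nu=0$ elsewhere, and set $\nu^\delta=\psi_\delta*\widetilde\nu$. Let $\varphi^\delta(y,r)$ be the value at time $r$ of the solution of $\dot x=\nu^\delta(x)$, $x(0)=y$. For $\rho\in buc^{2+\alpha}(\Gamma_0)$ let $\Gamma_\rho=\{\varphi^\delta(y,\rho(y)) : y\in\Gamma_0\}$. Near $\Gamma_0$, the set $\mathcal M^{2+\alpha}$ is given its manifold structure by the coordinates $\rho\mapsto\Gamma_\rho$, centered at $\Gamma_0=\Gamma_{\rho=0}$. *Tangent space.* A curve $s\mapsto\Gamma_s\in\mathcal M^{2+\alpha}$ (for $s$ near $0$) through $\Gamma_0$ is differentiable at $\Gamma_0$ with coordinate derivative $h$ if, for $s$ near $0$, $\Gamma_s=\Gamma_{\rho(s)}$ with $\rho(s)\in buc^{2+\alpha}(\Gamma_0)$, $\rho(0)=0$, and $\dot\rho(0)=h$ exists in $buc^{2+\alpha}(\Gamma_0)$. A field $V:\Gamma_0\to\mathbb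 R^n$ is a velocity field of a curve $(\Gamma_s)$ if there are, for $s$ near $0$, $C^2$-diffeomorphisms $\varphi_s$ of $\mathbb R^n$ with $\varphi_0=\mathrm{id}$, $\varphi_s(\Gamma_0)=\Gamma_s$ and $\frac{d}{ds}\big|_{s=0}\varphi_s(y)=V(y)$ for $y\in\Gamma_0$. The tangent space $T_{\Gamma_0}\mathcal M^{2+\alpha}$ is the set of the classes $[V]$, modulo vector fields along $\Gamma_0$ that are tangential to $\Gamma_0$, of the velocity fields $V$ of all curves in $\mathcal M^{2+\alpha}$ through $\Gamma_0$ that are differentiable at $\Gamma_0$. **Proposition.** A tubular radius of $\Gamma_0$ exists. For every choice of a tubular radius $R$ and of $\eta,\psi$ as above there is $\delta_0>0$ such that for all $\delta\in(0,\delta_0)$: 1. the flow $\varphi^\delta$ exists globally, with $\partial_r\varphi^\delta(y,r)=\nu^\delta(\varphi^\delta(y,r))$ (so $\dot\varphi^\delta=\nu^\delta$ on $\Gamma_0$ at $r=0$), and for some $r_0>0$ the map $(y,r)\mapsto\varphi^\delta(y,r)$ is injective on $\Gamma_0\times(-r_0,r_0)$ with open image in $\mathbb R^n$; 2. every curve in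 $\mathcal M^{2+\alpha}$ through $\Gamma_0$ that is differentiable at $\Gamma_0$ with coordinate derivative $h$ has a velocity field, and each of its velocity fields differs from $h\,\nu^\delta|_{\Gamma_0}$ by a tangential field; 3. the linear map $h\mapsto[h\,\nu^\delta|_{\Gamma_0}]$ is injective on $buc^{2+\alpha}(\Gamma_0)$ and its range is exactly $T_{\Gamma_0}\mathcal M^{2+\alpha}$, so that $$T_{\Gamma_0}\mathcal M^{2+\alpha}\;\hat=\;buc^{2+\alpha}(\Gamma_0)\quad\text{via}\quad h\mapsto h\,\dot\varphi^\delta=h\,\nu^\delta .$$ -/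

import Mathlib

open Set Filter Topology Metric MeasureTheory
open scoped ENNReal ContDiff

/-! ### Little Hölder spaces on open subsets of a Euclidean space -/

/-- The Hölder seminorm `[g]_α` on `O`, with values in `[0, ∞]`. -/
noncomputable def holderSeminorm {E F : Type*} [NormedAddCommGroup E] [NormedAddCommGroup F]
    (α : ℝ) (O : Set E) (g : E → F) : ℝ≥0∞ :=
  ⨆ x ∈ O, ⨆ y ∈ O, edist (g x) (g y) / edist x y ^ α

/-- The norm `‖f‖_{k+α,∞}` on the open set `O`, with values in `[0, ∞]`. -/
noncomputable def holderNorm {E : Type*} [NormedAddCommGroup E] [NormedSpace ℝ E]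
    (k : ℕ) (α : ℝ) (O : Set E) (f : E → ℝ) : ℝ≥0∞ :=
  (⨆ j : Fin (k + 1), ⨆ x ∈ O, ‖iteratedFDeriv ℝ j f x‖ₑ) +
    holderSeminorm α O (iteratedFDeriv ℝ k f)

/-- `f ∈ BUC^{k+α}(O)`, for `O` open: all derivatives up to order `k` are bounded and uniformly
continuous on `O`, and those of order `k` are uniformly `α`-Hölder continuous. -/
def MemBUC {E : Type*} [NormedAddCommGroup E] [NormedSpace ℝ E]
    (k : ℕ) (α : ℝ) (O : Set E) (f : E → ℝ) : Prop :=
  ContDiffOn ℝ k f O ∧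
    (∀ j : ℕ, j ≤ k → UniformContinuousOn (iteratedFDeriv ℝ j f) O) ∧
    holderNorm k α O f < ⊤

/-- `f ∈ buc^{k+α}(O)`, for `O` open: `f` lies in the closure of `BUC^{k+β}(O)`, `β > α`, in the
norm of `BUC^{k+α}(O)`. -/
def MemLittleHolder {E : Type*} [NormedAddCommGroup E] [NormedSpace ℝ E]
    (k : ℕ) (α : ℝ) (O : Set E) (f : E → ℝ) : Prop :=
  MemBUC k α O f ∧
    ∀ β : ℝ, α < β → β < 1 → ∀ ε : ℝ≥0∞, 0 < ε →
      ∃ g : E → ℝ, MemBUC k β O g ∧ holderNorm k α O (f - g) < ε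

section closure

variable {E : Type*} [NormedAddCommGroup E] [NormedSpace ℝ E]

theorem holderNorm_zero (k : ℕ) (α : ℝ) (O : Set E) : holderNorm k α O (0 : E → ℝ) = 0 := by
  have h0 : ∀ j : ℕ, iteratedFDeriv ℝ j (0 : E → ℝ) = 0 := fun j => iteratedFDeriv_fun_zero
  have h1 : ∀ (j : ℕ) (x : E), ‖iteratedFDeriv ℝ j (0 : E → ℝ) x‖ₑ = 0 := by
    intro j x
    rw [h0 j]
    exact enorm_zero (E := E [×j]→L[ℝ] ℝ)
  simp only [holderNorm, holderSeminorm, h0 k, h1]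
  simp

theorem holderSeminorm_add_le {E F : Type*} [NormedAddCommGroup E] [NormedAddCommGroup F] (α : ℝ) (O : Set E)
    (a b c : E → F) (h : ∀ x ∈ O, c x = a x + b x) :
    holderSeminorm α O c ≤ holderSeminorm α O a + holderSeminorm α O b := by
  refine iSup₂_le fun x hx => iSup₂_le fun y hy => ?_
  rw [h x hx, h y hy]
  calc edist (a x + b x) (a y + b y) / edist x y ^ α
      ≤ (edist (a x) (a y) + edist (b x) (b y)) / edist x y ^ α := by
        gcongr
        exact edist_add_add_le _ _ _ _
    _ = edist (a x) (a y) / edist x y ^ α + edist (b x) (b y) / edist x y ^ α :=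
        ENNReal.add_div
    _ ≤ _ := add_le_add
        (le_iSup₂_of_le x hx (le_iSup₂_of_le (f := fun y (_ : y ∈ O) =>
          edist (a x) (a y) / edist x y ^ α) y hy le_rfl))
        (le_iSup₂_of_le x hx (le_iSup₂_of_le (f := fun y (_ : y ∈ O) =>
          edist (b x) (b y) / edist x y ^ α) y hy le_rfl))

theorem iteratedFDeriv_add_on {k : ℕ} {O : Set E} (hO : IsOpen O) {f g : E → ℝ}
    (hf : ContDiffOn ℝ k f O) (hg : ContDiffOn ℝ k g O) {j : ℕ} (hj : j ≤ k) :
    ∀ x ∈ O, iteratedFDeriv ℝ j (f + g) x = iteratedFDeriv ℝ j f x + iteratedFDeriv ℝ j g x := by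
  intro x hx
  have hjk : ((j : ℕ) : WithTop ℕ∞) ≤ k := by exact_mod_cast hj
  exact iteratedFDeriv_add_apply ((hf.contDiffAt (hO.mem_nhds hx)).of_le hjk)
    ((hg.contDiffAt (hO.mem_nhds hx)).of_le hjk)

theorem iteratedFDeriv_smul_on {k : ℕ} {O : Set E} (hO : IsOpen O) (c : ℝ) {f : E → ℝ}
    (hf : ContDiffOn ℝ k f O) {j : ℕ} (hj : j ≤ k) :
    ∀ x ∈ O, iteratedFDeriv ℝ j (c • f) x = c • iteratedFDeriv ℝ j f x := by
  intro x hx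
  have hjk : ((j : ℕ) : WithTop ℕ∞) ≤ k := by exact_mod_cast hj
  exact iteratedFDeriv_const_smul_apply ((hf.contDiffAt (hO.mem_nhds hx)).of_le hjk)

theorem holderNorm_add_le {k : ℕ} {α : ℝ} {O : Set E} (hO : IsOpen O) {f g : E → ℝ}
    (hf : ContDiffOn ℝ k f O) (hg : ContDiffOn ℝ k g O) :
    holderNorm k α O (f + g) ≤ holderNorm k α O f + holderNorm k α O g := by
  have h1 : (⨆ j : Fin (k + 1), ⨆ x ∈ O, ‖iteratedFDeriv ℝ j (f + g) x‖ₑ) ≤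
      (⨆ j : Fin (k + 1), ⨆ x ∈ O, ‖iteratedFDeriv ℝ j f x‖ₑ) +
      (⨆ j : Fin (k + 1), ⨆ x ∈ O, ‖iteratedFDeriv ℝ j g x‖ₑ) := by
    refine iSup_le fun j => iSup₂_le fun x hx => ?_
    rw [iteratedFDeriv_add_on hO hf hg (Nat.lt_succ_iff.mp j.2) x hx]
    refine (enorm_add_le (iteratedFDeriv ℝ j f x) (iteratedFDeriv ℝ j g x)).trans
      (add_le_add ?_ ?_)
    · exact le_iSup_of_le j (le_iSup₂_of_le (f := fun x (_ : x ∈ O) =>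
        ‖iteratedFDeriv ℝ j f x‖ₑ) x hx le_rfl)
    · exact le_iSup_of_le j (le_iSup₂_of_le (f := fun x (_ : x ∈ O) =>
        ‖iteratedFDeriv ℝ j g x‖ₑ) x hx le_rfl)
  have h2 := holderSeminorm_add_le α O (iteratedFDeriv ℝ k f) (iteratedFDeriv ℝ k g)
    (iteratedFDeriv ℝ k (f + g)) (iteratedFDeriv_add_on hO hf hg le_rfl)
  calc _ ≤ _ := add_le_add h1 h2
    _ = _ := by unfold holderNorm; ring

theorem holderNorm_smul_le {k : ℕ} {α : ℝ} {O : Set E} (hO : IsOpen O) (c : ℝ) {f : E → ℝ}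
    (hf : ContDiffOn ℝ k f O) :
    holderNorm k α O (c • f) ≤ ‖c‖ₑ * holderNorm k α O f := by
  unfold holderNorm
  rw [mul_add]
  refine add_le_add ?_ ?_
  · refine iSup_le fun j => iSup₂_le fun x hx => ?_
    rw [iteratedFDeriv_smul_on hO c hf (Nat.lt_succ_iff.mp j.2) x hx, enorm_smul]
    gcongr
    exact le_iSup_of_le j (le_iSup₂_of_le (f := fun x (_ : x ∈ O) =>
        ‖iteratedFDeriv ℝ j f x‖ₑ) x hx le_rfl)
  · refine iSup₂_le fun x hx => iSup₂_le fun y hy => ?_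
    rw [iteratedFDeriv_smul_on hO c hf le_rfl x hx, iteratedFDeriv_smul_on hO c hf le_rfl y hy,
      edist_eq_enorm_sub, ← smul_sub, enorm_smul, ← edist_eq_enorm_sub, mul_div_assoc]
    refine mul_le_mul' le_rfl ?_
    exact le_iSup₂_of_le x hx (le_iSup₂_of_le (f := fun y (_ : y ∈ O) =>
      edist (iteratedFDeriv ℝ k f x) (iteratedFDeriv ℝ k f y) / edist x y ^ α) y hy le_rfl)

theorem MemBUC.zero (k : ℕ) (α : ℝ) (O : Set E) : MemBUC k α O (0 : E → ℝ) := by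
  refine ⟨contDiffOn_const, fun j _ => ?_, by simp [holderNorm_zero]⟩
  have h0 : iteratedFDeriv ℝ j (0 : E → ℝ) = fun _ => 0 := iteratedFDeriv_fun_zero
  rw [h0]
  exact uniformContinuous_const.uniformContinuousOn

theorem MemBUC.add {k : ℕ} {α : ℝ} {O : Set E} (hO : IsOpen O) {f g : E → ℝ}
    (hf : MemBUC k α O f) (hg : MemBUC k α O g) : MemBUC k α O (f + g) := by
  refine ⟨hf.1.add hg.1, fun j hj => ?_, ?_⟩
  · rw [uniformContinuousOn_iff_restrict]
    have h : O.domRestrict (iteratedFDeriv ℝ j (f + g)) =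
        O.domRestrict (iteratedFDeriv ℝ j f) + O.domRestrict (iteratedFDeriv ℝ j g) := by
      funext x
      exact iteratedFDeriv_add_on hO hf.1 hg.1 hj x x.2
    rw [h]
    exact (uniformContinuousOn_iff_restrict.1 (hf.2.1 j hj)).add
      (uniformContinuousOn_iff_restrict.1 (hg.2.1 j hj))
  · exact (holderNorm_add_le hO hf.1 hg.1).trans_lt (ENNReal.add_lt_top.2 ⟨hf.2.2, hg.2.2⟩)

theorem MemBUC.smul {k : ℕ} {α : ℝ} {O : Set E} (hO : IsOpen O) (c : ℝ) {f : E → ℝ}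
    (hf : MemBUC k α O f) : MemBUC k α O (c • f) := by
  refine ⟨hf.1.const_smul c, fun j hj => ?_, ?_⟩
  · rw [uniformContinuousOn_iff_restrict]
    have h : O.domRestrict (iteratedFDeriv ℝ j (c • f)) =
        c • O.domRestrict (iteratedFDeriv ℝ j f) := by
      funext x
      exact iteratedFDeriv_smul_on hO c hf.1 hj x x.2
    rw [h]
    exact (uniformContinuousOn_iff_restrict.1 (hf.2.1 j hj)).const_smul c
  · exact (holderNorm_smul_le hO c hf.1).trans_lt (ENNReal.mul_lt_top enorm_lt_top hf.2.2)

theorem MemLittleHolder.zero (k : ℕ) (α : ℝ) (O : Set E) :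
    MemLittleHolder k α O (0 : E → ℝ) :=
  ⟨MemBUC.zero k α O, fun β _ _ ε hε => ⟨0, MemBUC.zero k β O, by simpa [holderNorm_zero] using hε⟩⟩

theorem MemLittleHolder.add {k : ℕ} {α : ℝ} {O : Set E} (hO : IsOpen O) {f g : E → ℝ}
    (hf : MemLittleHolder k α O f) (hg : MemLittleHolder k α O g) :
    MemLittleHolder k α O (f + g) := by
  refine ⟨hf.1.add hO hg.1, fun β h1 h2 ε hε => ?_⟩
  obtain ⟨u, hu, hu'⟩ := hf.2 β h1 h2 (ε / 2) (ENNReal.half_pos hε.ne')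
  obtain ⟨v, hv, hv'⟩ := hg.2 β h1 h2 (ε / 2) (ENNReal.half_pos hε.ne')
  refine ⟨u + v, hu.add hO hv, ?_⟩
  rw [add_sub_add_comm]
  calc _ ≤ _ := holderNorm_add_le hO (hf.1.1.sub hu.1) (hg.1.1.sub hv.1)
    _ < ε / 2 + ε / 2 := ENNReal.add_lt_add hu' hv'
    _ = ε := ENNReal.add_halves ε

theorem MemLittleHolder.smul {k : ℕ} {α : ℝ} {O : Set E} (hO : IsOpen O) (c : ℝ) {f : E → ℝ}
    (hf : MemLittleHolder k α O f) : MemLittleHolder k α O (c • f) := by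
  by_cases hc : c = 0
  · subst hc
    simpa using MemLittleHolder.zero k α O
  refine ⟨hf.1.smul hO c, fun β h1 h2 ε hε => ?_⟩
  have hc0 : ‖c‖ₑ ≠ 0 := by simpa using hc
  obtain ⟨u, hu, hu'⟩ := hf.2 β h1 h2 (ε / ‖c‖ₑ) (ENNReal.div_pos hε.ne' enorm_ne_top)
  refine ⟨c • u, hu.smul hO c, ?_⟩
  rw [← smul_sub]
  refine (holderNorm_smul_le hO c (hf.1.1.sub hu.1)).trans_lt ?_
  rw [mul_comm]
  exact (ENNReal.lt_div_iff_mul_lt (Or.inl hc0) (Or.inl enorm_ne_top)).1 hu'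

theorem MemLittleHolder.mono {k : ℕ} {α : ℝ} {O U : Set E} (hUO : U ⊆ O) {f : E → ℝ}
    (hf : MemLittleHolder k α O f) : MemLittleHolder k α U f := by
  have hn : ∀ (γ : ℝ) (u : E → ℝ), holderNorm k γ U u ≤ holderNorm k γ O u := by
    intro γ u
    refine add_le_add ?_ ?_
    · exact iSup_mono fun j => biSup_mono fun x hx => hUO hx
    · exact (biSup_mono fun x hx => hUO hx).trans
        (iSup₂_mono fun x _ => biSup_mono fun y hy => hUO hy)
  have hm : ∀ (γ : ℝ) (u : E → ℝ), MemBUC k γ O u → MemBUC k γ U u := fun γ u hu =>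
    ⟨hu.1.mono hUO, fun j hj => (hu.2.1 j hj).mono hUO, (hn γ u).trans_lt hu.2.2⟩
  refine ⟨hm _ _ hf.1, fun β h1 h2 ε hε => ?_⟩
  obtain ⟨g, hg, hg'⟩ := hf.2 β h1 h2 ε hε
  exact ⟨g, hm _ _ hg, (hn _ _).trans_lt hg'⟩

end closure

/-! ### Little Hölder spaces on compact hypersurfaces -/

/-- `f : Γ → ℝ` belongs to `buc^{k+α}(Γ)`: locally, it is the restriction of a `buc^{k+α}` function
of the ambient variables. For a hypersurface of class `buc^{k+α}` this says that `f` is of class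
`buc^{k+α}` in local charts. -/
noncomputable def littleHolder {E : Type*} [NormedAddCommGroup E] [NormedSpace ℝ E]
    (k : ℕ) (α : ℝ) (Γ : Set E) : Submodule ℝ (Γ → ℝ) where
  carrier := {f | ∀ y ∈ Γ, ∃ r : ℝ, 0 < r ∧ ∃ F : E → ℝ,
    MemLittleHolder k α (ball y r) F ∧ ∀ x : Γ, (x : E) ∈ ball y r → f x = F x}
  zero_mem' := fun y _ => ⟨1, one_pos, 0, MemLittleHolder.zero k α _, fun _ _ => rfl⟩
  add_mem' := by
    intro f g hf hg y hy
    obtain ⟨r, hr, F, hF, hfF⟩ := hf y hy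
    obtain ⟨s, hs, G, hG, hgG⟩ := hg y hy
    refine ⟨min r s, lt_min hr hs, F + G, ?_, fun x hx => ?_⟩
    · exact (hF.mono (ball_subset_ball (min_le_left r s))).add isOpen_ball
        (hG.mono (ball_subset_ball (min_le_right r s)))
    · have h1 := hfF x (ball_subset_ball (min_le_left r s) hx)
      have h2 := hgG x (ball_subset_ball (min_le_right r s) hx)
      simp [h1, h2]
  smul_mem' := by
    intro c f hf y hy
    obtain ⟨r, hr, F, hF, hfF⟩ := hf y hy
    refine ⟨r, hr, c • F, hF.smul isOpen_ball c, fun x hx => ?_⟩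
    simp [hfF x hx]

/-- The norm of `f` in `buc^{k+α}(Γ ∩ B(y, r))`: the infimum of the norms of the `buc^{k+α}`
functions on the ball `B(y, r)` that extend `f` (it is `∞` if there are none). -/
noncomputable def localHolderNorm {E : Type*} [NormedAddCommGroup E] [NormedSpace ℝ E]
    (k : ℕ) (α : ℝ) (Γ : Set E) (y : E) (r : ℝ) (f : Γ → ℝ) : ℝ≥0∞ :=
  ⨅ (F : E → ℝ) (_ : MemLittleHolder k α (ball y r) F)
    (_ : ∀ x : Γ, (x : E) ∈ ball y r → f x = F x), holderNorm k α (ball y r) F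

/-- The curve `s ↦ ρ s` in `buc^{k+α}(Γ)` has derivative `h` at `s = 0` with respect to the topology
of `buc^{k+α}(Γ)`: the difference quotients converge to `h` in the local `buc^{k+α}` norms (for
compact `Γ`, finitely many of these norms determine the topology). -/
def HasHolderDerivAtZero {E : Type*} [NormedAddCommGroup E] [NormedSpace ℝ E]
    (k : ℕ) (α : ℝ) (Γ : Set E) (ρ : ℝ → littleHolder k α Γ) (h : littleHolder k α Γ) : Prop :=
  ∀ y ∈ Γ, ∃ r : ℝ, 0 < r ∧
    Tendsto (fun s : ℝ => localHolderNorm k α Γ y r (s⁻¹ • (ρ s - ρ 0) - h : littleHolder k α Γ))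
      (𝓝[≠] 0) (𝓝 0)

/-! ### Hypersurfaces -/

/-- The tangent space `T_y Γ` of a subset `Γ` of a Euclidean space, as a linear subspace. -/
noncomputable def tangentSpaceAt {n : ℕ} (Γ : Set (EuclideanSpace ℝ (Fin n))) (y : EuclideanSpace ℝ (Fin n)) :
    Submodule ℝ (EuclideanSpace ℝ (Fin n)) :=
  Submodule.span ℝ (tangentConeAt ℝ Γ y)

/-- `ν` is a continuous field of unit normal vectors along `Γ` (an orientation of `Γ`). -/
def IsUnitNormalField {n : ℕ} (Γ : Set (EuclideanSpace ℝ (Fin n)))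
    (ν : EuclideanSpace ℝ (Fin n) → EuclideanSpace ℝ (Fin n)) : Prop :=
  ContinuousOn ν Γ ∧ ∀ y ∈ Γ, ‖ν y‖ = 1 ∧ ∀ v ∈ tangentSpaceAt Γ y, inner ℝ (ν y) v = 0

/-- The set `M^{k+α}` of the compact orientable embedded hypersurfaces of `ℝⁿ` of class
`buc^{k+α}`: around each of its points, `Γ` is a regular level set of a `buc^{k+α}` function. -/
def hypersurfaces (n k : ℕ) (α : ℝ) : Set (Set (EuclideanSpace ℝ (Fin n))) :=
  {Γ | IsCompact Γ ∧ Γ.Nonempty ∧ (∃ ν, IsUnitNormalField Γ ν) ∧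
    ∀ y ∈ Γ, ∃ r : ℝ, 0 < r ∧ ∃ F : EuclideanSpace ℝ (Fin n) → ℝ,
      MemLittleHolder k α (ball y r) F ∧ (∀ x ∈ ball y r, fderiv ℝ F x ≠ 0) ∧
      Γ ∩ ball y r = {x ∈ ball y r | F x = 0}}

/-! ### The regularized normal field and its flow -/

/-- `R` is a tubular radius of the oriented hypersurface `Γ`: the map `(y, r) ↦ y + r ν(y)` is a
diffeomorphism from `Γ × (-R, R)` onto `{x | dist(x, Γ) < R}`, whose inverse is `x ↦ (p x, t x)`. -/
def IsTubularRadius {n : ℕ} (Γ : Set (EuclideanSpace ℝ (Fin n)))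
    (ν : EuclideanSpace ℝ (Fin n) → EuclideanSpace ℝ (Fin n)) (R : ℝ) : Prop :=
  0 < R ∧ ∃ (p : EuclideanSpace ℝ (Fin n) → EuclideanSpace ℝ (Fin n))
      (t : EuclideanSpace ℝ (Fin n) → ℝ),
    ContDiffOn ℝ 1 p (thickening R Γ) ∧ ContDiffOn ℝ 1 t (thickening R Γ) ∧
    (∀ x ∈ thickening R Γ, p x ∈ Γ ∧ |t x| < R ∧ x = p x + t x • ν (p x)) ∧
    (∀ y ∈ Γ, ∀ r : ℝ, |r| < R →
      y + r • ν y ∈ thickening R Γ ∧ p (y + r • ν y) = y ∧ t (y + r • ν y) = r)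

/-- `η` is a smooth cut-off function on the line for the radius `R`. -/
def IsCutoff (R : ℝ) (η : ℝ → ℝ) : Prop :=
  ContDiff ℝ ∞ η ∧ (∀ r, 0 ≤ η r ∧ η r ≤ 1) ∧ (∀ r, |r| ≤ R / 2 → η r = 1) ∧
    (∀ r, 3 * R / 4 ≤ |r| → η r = 0)

/-- `ψ` is a smooth, compactly supported mollifier. -/
def IsMollifier {n : ℕ} (ψ : EuclideanSpace ℝ (Fin n) → ℝ) : Prop :=
  ContDiff ℝ ∞ ψ ∧ HasCompactSupport ψ ∧ (∀ x, 0 ≤ ψ x) ∧ ∫ x, ψ x = 1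

open Classical in
/-- The extension `ν̃` of the normal field to `ℝⁿ`: `ν̃(y + r ν(y)) = η(r) ν(y)` for `y ∈ Γ` and
`|r| < R`, and `ν̃ = 0` off the tubular neighborhood. -/
noncomputable def extendedNormal {n : ℕ} (Γ : Set (EuclideanSpace ℝ (Fin n)))
    (ν : EuclideanSpace ℝ (Fin n) → EuclideanSpace ℝ (Fin n)) (R : ℝ) (η : ℝ → ℝ)
    (x : EuclideanSpace ℝ (Fin n)) : EuclideanSpace ℝ (Fin n) :=
  if h : ∃ q : EuclideanSpace ℝ (Fin n) × ℝ, q.1 ∈ Γ ∧ |q.2| < R ∧ x = q.1 + q.2 • ν q.1 then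
    η h.choose.2 • ν h.choose.1
  else 0

/-- The regularized transversal field `ν^δ = ψ_δ * ν̃`, where `ψ_δ(x) = δ⁻ⁿ ψ(x / δ)`. -/
noncomputable def regularizedNormal {n : ℕ} (Γ : Set (EuclideanSpace ℝ (Fin n)))
    (ν : EuclideanSpace ℝ (Fin n) → EuclideanSpace ℝ (Fin n)) (R : ℝ) (η : ℝ → ℝ)
    (ψ : EuclideanSpace ℝ (Fin n) → ℝ) (δ : ℝ) (x : EuclideanSpace ℝ (Fin n)) :
    EuclideanSpace ℝ (Fin n) :=
  ∫ z, ((δ ^ n)⁻¹ * ψ (δ⁻¹ • (x - z))) • extendedNormal Γ ν R η z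

open Classical in
/-- The flow of the autonomous field `v`: `r ↦ flowMap v r y` is the solution on the whole line of
`x' = v(x)`, `x(0) = y` (with a dummy value if there is none). -/
noncomputable def flowMap {E : Type*} [NormedAddCommGroup E] [NormedSpace ℝ E]
    (v : E → E) (r : ℝ) (y : E) : E :=
  if h : ∃ c : ℝ → E, c 0 = y ∧ ∀ t, HasDerivAt c (v (c t)) t then h.choose r else y

/-! ### The tangent space -/

/-- The hypersurface `Γ_ρ = {φ(y, ρ(y)) | y ∈ Γ}` with coordinate `ρ`, where `φ` is the flow
of `v`. -/
def flowGraph {E : Type*} [NormedAddCommGroup E] [NormedSpace ℝ E]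
    (Γ : Set E) (v : E → E) (ρ : Γ → ℝ) : Set E :=
  range fun y : Γ => flowMap v (ρ y) y

/-- `γ` is (near `s = 0`) a curve in `M^{k+α}` through `Γ = γ 0` that is given in the coordinates
`ρ ↦ Γ_ρ` by the curve `s ↦ ρ s` in `buc^{k+α}(Γ)`, which passes through the center `0` of these
coordinates and has derivative `h` at `s = 0`. -/
def IsCurveWithCoordinate {n : ℕ} (k : ℕ) (α : ℝ) (Γ : Set (EuclideanSpace ℝ (Fin n)))
    (v : EuclideanSpace ℝ (Fin n) → EuclideanSpace ℝ (Fin n))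
    (γ : ℝ → Set (EuclideanSpace ℝ (Fin n))) (ρ : ℝ → littleHolder k α Γ)
    (h : littleHolder k α Γ) : Prop :=
  γ 0 = Γ ∧ (∀ᶠ s in 𝓝 (0 : ℝ), γ s ∈ hypersurfaces n k α) ∧ ρ 0 = 0 ∧
    (∀ᶠ s in 𝓝 (0 : ℝ), γ s = flowGraph Γ v (ρ s)) ∧ HasHolderDerivAtZero k α Γ ρ h

/-- `V` is a velocity field along `Γ` at `s = 0` of the curve `γ` of hypersurfaces: there are
diffeomorphisms `Φ_s` of `ℝⁿ` with `Φ_0 = id`, `Φ_s(Γ) = γ s`, and `d/ds Φ_s = V` on `Γ`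
at `s = 0`. -/
def IsVelocityField {n : ℕ} (Γ : Set (EuclideanSpace ℝ (Fin n)))
    (γ : ℝ → Set (EuclideanSpace ℝ (Fin n))) (V : Γ → EuclideanSpace ℝ (Fin n)) : Prop :=
  ∃ Φ : ℝ → EuclideanSpace ℝ (Fin n) → EuclideanSpace ℝ (Fin n),
    Φ 0 = id ∧
    (∀ᶠ s in 𝓝 (0 : ℝ), ContDiff ℝ 2 (Φ s) ∧
      (∃ Ψ : EuclideanSpace ℝ (Fin n) → EuclideanSpace ℝ (Fin n),
        ContDiff ℝ 2 Ψ ∧ Function.LeftInverse Ψ (Φ s) ∧ Function.RightInverse Ψ (Φ s)) ∧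
      Φ s '' Γ = γ s) ∧
    ∀ y : Γ, HasDerivAt (fun s : ℝ => Φ s y) (V y) 0

/-- The vector fields along `Γ` that are tangential to `Γ`. -/
noncomputable def tangentialFields {n : ℕ} (Γ : Set (EuclideanSpace ℝ (Fin n))) :
    Submodule ℝ (Γ → EuclideanSpace ℝ (Fin n)) :=
  Submodule.pi univ fun y : Γ => tangentSpaceAt Γ y

/-- The tangent space `T_Γ M^{k+α}`: the tangent vectors of the curves in `M^{k+α}` through `Γ`
that are differentiable at `Γ` in the coordinates `ρ ↦ Γ_ρ`. The tangent vector of a curve of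
hypersurfaces is the class of its velocity fields modulo the fields tangential to `Γ`. -/
def hypersurfaceTangentSpace {n : ℕ} (k : ℕ) (α : ℝ) (Γ : Set (EuclideanSpace ℝ (Fin n)))
    (v : EuclideanSpace ℝ (Fin n) → EuclideanSpace ℝ (Fin n)) :
    Set ((Γ → EuclideanSpace ℝ (Fin n)) ⧸ tangentialFields Γ) :=
  {ξ | ∃ γ ρ h, IsCurveWithCoordinate k α Γ v γ ρ h ∧
    ∃ V, IsVelocityField Γ γ V ∧ ξ = (tangentialFields Γ).mkQ V}

/-- The linear map that sends `h ∈ buc^{k+α}(Γ)` to the class of the field `h v` along `Γ` modulo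
tangential fields. -/
noncomputable def transversalMap {n : ℕ} (k : ℕ) (α : ℝ) (Γ : Set (EuclideanSpace ℝ (Fin n)))
    (v : EuclideanSpace ℝ (Fin n) → EuclideanSpace ℝ (Fin n)) :
    littleHolder k α Γ →ₗ[ℝ] (Γ → EuclideanSpace ℝ (Fin n)) ⧸ tangentialFields Γ :=
  (tangentialFields Γ).mkQ ∘ₗ
    { toFun := fun h y => (h : Γ → ℝ) y • v y
      map_add' := fun f g => by ext1 y; simp [add_smul]
      map_smul' := fun c f => by ext1 y; simp [mul_smul] }

/-! The field `v = ν^δ` is smooth with compact support, hence bounded and Lipschitz, so its flow is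
global. Mollification moves the uniformly continuous field `ν̃` by at most `1/2` for small `δ`, so
`⟨ν, v⟩ > 0` on `Γ` (`exists_inner_regularizedNormal_pos`). Everything else rests on this
transversality and on the regularity of the flow near time zero (`contDiffAt_flowMap`), which comes
from the implicit function theorem for the integral equation in `C([0, 1], E)`.

Both families of curves, `y + r ν(y)` and the flow lines of `v`, are handled by one device. If `F`
defines `Γ` near `y` and the curve through `y` leaves in a direction `w` with `F'(y) w ≠ 0`, then
`(x, r) ↦ (X(x, r), F(x))` is a local diffeomorphism, and `Γ × ℝ` is the part where the second
component vanishes (`hasLocalCoordinates_of_transversal`). Compactness makes the local inverses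
uniform (`exists_global_coordinates`). For the normal lines this gives a tubular radius, because a
nearest point of `Γ` sees `x` in the normal direction; for the flow it gives injectivity and the
open image.

A curve with coordinate `ρ(s)` has a velocity field because `ρ(s)` extends to compactly supported
`C²` functions `F_s` with `C¹` norm `O(s)`: then `x ↦ φ(x, F_s(x))` differs from the identity by a
contraction, so it is a diffeomorphism (`exists_flowMap_diffeo`), and its derivative at `s = 0` is
`h v` on `Γ`. For an arbitrary velocity field `V`, write `Φ_s(y) = φ(q_s, ρ_s(q_s))` with `q_s ∈ Γ`.
The displacements `φ(x, ρ_s(x)) - x` at `q_s` and at `y` differ by `O(|s| ‖q_s - y‖) = o(s)`, so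
`(q_s - y)/s → V(y) - h(y) v(y)`, which is therefore tangential
(`IsCurveWithCoordinate.sub_mem_tangentSpaceAt`).

For the range, every `h` must occur as a coordinate derivative. The curve `ρ(s) = s h` serves,
provided that the sets `Γ_{s h}` are again of class `buc^{2+α}`. This uses a pointwise description
of the class: the Hölder quotients of the second derivative tend to zero at each point. That
property passes to compositions and inverses by the chain rule (`IsLittleHolderAtTwo.comp`,
`IsLittleHolderAtTwo.inverse`), and mollification turns it back into approximability by smoother
functions (`memLittleHolder_of_compactSupport`). Injectivity follows by pairing with `ν`. -/

/-! ### Superposition operators on spaces of continuous functions -/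

section superposition

universe u

variable {K : Type*} [TopologicalSpace K] [CompactSpace K]
  {E F : Type u} [NormedAddCommGroup E] [NormedSpace ℝ E] [NormedAddCommGroup F] [NormedSpace ℝ F]

/-- Pointwise application of a continuous family of operators to a continuous family of vectors. -/
noncomputable def pointwiseApply :
    C(K, E →L[ℝ] F) →L[ℝ] C(K, E) →L[ℝ] C(K, F) :=
  LinearMap.mkContinuous₂
    (LinearMap.mk₂ ℝ (fun (A : C(K, E →L[ℝ] F)) (c : C(K, E)) =>
        (⟨fun t => A t (c t), A.continuous.clm_apply c.continuous⟩ : C(K, F)))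
      (fun A B c => by ext t; simp) (fun r A c => by ext t; simp)
      (fun A c d => by ext t; simp) (fun r A c => by ext t; simp)) 1
    (fun A c => by
      rw [one_mul]
      refine (ContinuousMap.norm_le _ (by positivity)).2 fun t => ?_
      exact ((A t).le_opNorm (c t)).trans
        (mul_le_mul (A.norm_coe_le_norm t) (c.norm_coe_le_norm t) (norm_nonneg _) (norm_nonneg A)))

/-- The remainder is estimated for each `t` separately by the mean value inequality on the segment
from `c t` to `c t + u t`. The bound is uniform in `t` because postcomposition with `f'` is
continuous for the sup norm and each point of the segment is a value of a curve `c + θ u`. -/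
theorem hasFDerivAt_superposition {f : E → F} {f' : E → E →L[ℝ] F} (hf : Continuous f)
    (hf' : Continuous f') (h : ∀ x, HasFDerivAt f (f' x) x) (c : C(K, E)) :
    HasFDerivAt (fun c : C(K, E) => (⟨f, hf⟩ : C(E, F)).comp c)
      (pointwiseApply ((⟨f', hf'⟩ : C(E, E →L[ℝ] F)).comp c)) c := by
  rw [hasFDerivAt_iff_isLittleO_nhds_zero, Asymptotics.isLittleO_iff]
  intro ε hε
  have hcont : Continuous fun c : C(K, E) => (⟨f', hf'⟩ : C(E, E →L[ℝ] F)).comp c :=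
    ContinuousMap.continuous_postcomp _
  obtain ⟨δ, hδ, H⟩ := Metric.mem_nhds_iff.1
    (hcont.continuousAt (x := c) 
      (ball_mem_nhds ((⟨f', hf'⟩ : C(E, E →L[ℝ] F)).comp c) hε))
  filter_upwards [ball_mem_nhds (0 : C(K, E)) hδ] with u hu
  rw [mem_ball_zero_iff] at hu
  refine (ContinuousMap.norm_le _ (by positivity)).2 fun t => ?_
  have key : ∀ z ∈ segment ℝ (c t) (c t + u t), ‖f' z - f' (c t)‖ ≤ ε := by
    intro z hz
    rw [segment_eq_image'] at hz
    obtain ⟨θ, hθ, rfl⟩ := hz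
    have h1 : dist (c + θ • u) c < δ := by
      rw [dist_eq_norm, add_sub_cancel_left, norm_smul, Real.norm_of_nonneg hθ.1]
      exact (mul_le_of_le_one_left (norm_nonneg _) hθ.2).trans_lt hu
    have h2 := H (mem_ball.2 h1)
    rw [mem_preimage, mem_ball] at h2
    have h3 := (ContinuousMap.dist_apply_le_dist t).trans h2.le
    simpa [dist_eq_norm] using h3
  have := (convex_segment (c t) (c t + u t)).norm_image_sub_le_of_norm_hasFDerivWithin_le'
    (fun z _ => (h z).hasFDerivWithinAt) key (left_mem_segment ℝ _ _) (right_mem_segment ℝ _ _)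
  simp only [add_sub_cancel_left] at this
  calc ‖_‖ = ‖f (c t + u t) - f (c t) - f' (c t) (u t)‖ := rfl
    _ ≤ ε * ‖u t‖ := this
    _ ≤ ε * ‖u‖ := by gcongr; exact u.norm_coe_le_norm t

/-- The derivative is again a superposition operator, with `fderiv ℝ f` in place of `f`, followed by
the bounded map `pointwiseApply`; hence the induction, in which the target `F` becomes `E →L[ℝ] F`.
The common universe of `E` and `F` keeps this target admissible. -/
theorem contDiff_superposition {m : ℕ} {f : E → F} (hf : ContDiff ℝ m f) :
    ContDiff ℝ m (fun c : C(K, E) => (⟨f, hf.continuous⟩ : C(E, F)).comp c) := by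
  induction m generalizing F with
  | zero => exact contDiff_zero.2 (ContinuousMap.continuous_postcomp _)
  | succ m ih =>
    have h := contDiff_succ_iff_fderiv.1 (by exact_mod_cast hf : ContDiff ℝ ((m : ℕ∞ω) + 1) f)
    have key : ContDiff ℝ ((m : ℕ∞ω) + 1)
        (fun c : C(K, E) => (⟨f, hf.continuous⟩ : C(E, F)).comp c) := by
      rw [contDiff_succ_iff_hasFDerivAt]
      refine ⟨fun c => pointwiseApply ((⟨fderiv ℝ f, h.2.2.continuous⟩ : C(E, E →L[ℝ] F)).comp c),
        ?_, fun c => hasFDerivAt_superposition hf.continuous h.2.2.continuous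
          (fun x => (h.1 x).hasFDerivAt) c⟩
      exact pointwiseApply.contDiff.comp (ih h.2.2)
    exact_mod_cast key

/-- The primitive vanishing at the left end point, as an operator on `C([0, 1], E)`. -/
noncomputable def primitiveOperator [CompleteSpace E] :
    C(Icc (0 : ℝ) 1, E) →L[ℝ] C(Icc (0 : ℝ) 1, E) :=
  LinearMap.mkContinuous
    { toFun := fun c => ⟨fun t => ∫ s in (0 : ℝ)..t, IccExtend zero_le_one c s, by
        have h : Continuous fun t : ℝ => ∫ s in (0 : ℝ)..t, IccExtend zero_le_one c s :=
          intervalIntegral.continuous_primitive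
            (fun a b => (c.continuous.Icc_extend' (h := zero_le_one)).intervalIntegrable a b) 0
        exact h.comp continuous_subtype_val⟩
      map_add' := fun c d => by
        ext t
        exact intervalIntegral.integral_add
          ((c.continuous.Icc_extend' (h := zero_le_one)).intervalIntegrable _ _)
          ((d.continuous.Icc_extend' (h := zero_le_one)).intervalIntegrable _ _)
      map_smul' := fun r c => by
        ext t
        exact intervalIntegral.integral_smul r _ } 1
    (fun c => by
      rw [one_mul]
      refine (ContinuousMap.norm_le _ (by positivity)).2 fun t => ?_
      refine (intervalIntegral.norm_integral_le_of_norm_le_const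
        (C := ‖c‖) fun s _ => c.norm_coe_le_norm _).trans ?_
      rw [sub_zero, abs_of_nonneg t.2.1]
      exact mul_le_of_le_one_right (norm_nonneg _) t.2.2)

end superposition

/-! ### Flows of bounded Lipschitz fields -/

section flow

variable {E : Type} [NormedAddCommGroup E] [NormedSpace ℝ E] [CompleteSpace E]
  {v : E → E} {K : NNReal} {M : ℝ}

/-- Since `v` is bounded by `M`, solutions on `[-N, N]` cannot leave the ball of radius `M N`, so
Picard–Lindelöf applies on every such interval; uniqueness glues the pieces. -/
theorem exists_global_solution (hK : LipschitzWith K v) (hM : ∀ x, ‖v x‖ ≤ M) (y : E) :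
    ∃ c : ℝ → E, c 0 = y ∧ ∀ t, HasDerivAt c (v (c t)) t := by
  obtain ⟨M, rfl⟩ : ∃ B : NNReal, (B : ℝ) = M := ⟨⟨M, (norm_nonneg _).trans (hM y)⟩, rfl⟩
  have loc : ∀ N : ℕ, ∃ c : ℝ → E, c 0 = y ∧
      ∀ t ∈ Ioo (-(N : ℝ)) N, HasDerivAt c (v (c t)) t := by
    intro N
    have hP : IsPicardLindelof (fun _ => v) (tmin := -(N : ℝ)) (tmax := N) ⟨0, by simp⟩ y
        (M * N) 0 M K := by
      refine IsPicardLindelof.of_time_independent (fun x _ => hM x) hK.lipschitzOnWith ?_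
      simp
    obtain ⟨c, h0, hc⟩ := hP.exists_eq_forall_mem_Icc_hasDerivWithinAt₀
    exact ⟨c, h0, fun t ht => (hc t (Ioo_subset_Icc_self ht)).hasDerivAt (Icc_mem_nhds ht.1 ht.2)⟩
  choose c h0 hc using loc
  have agree : ∀ N L : ℕ, 0 < N → N ≤ L → EqOn (c N) (c L) (Ioo (-(N : ℝ)) N) := by
    intro N L hN hNL
    have hN' : (0 : ℝ) < N := by exact_mod_cast hN
    have hNL' : (N : ℝ) ≤ L := by exact_mod_cast hNL
    exact ODE_solution_unique_of_mem_Ioo (v := fun _ => v) (s := fun _ => univ) (K := K)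
      (t₀ := 0) (fun _ _ => hK.lipschitzOnWith) ⟨by linarith, hN'⟩
      (fun t ht => ⟨hc N t ht, mem_univ _⟩)
      (fun t ht => ⟨hc L t ⟨by linarith [ht.1], by linarith [ht.2]⟩, mem_univ _⟩)
      (by rw [h0, h0])
  -- The index is chosen so that `t` lies in the open interval of its solution. It jumps with `t`,
  -- but near a given `t` all the indices used are at most `⌊|t|⌋₊ + 2`, so a single solution
  -- represents the glued curve there.
  refine ⟨fun t => c (⌊|t|⌋₊ + 1) t, by simp [h0], fun t => ?_⟩
  have hlt : ∀ s : ℝ, |s| < ((⌊|s|⌋₊ + 1 : ℕ) : ℝ) := fun s => by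
    push_cast; exact Nat.lt_floor_add_one _
  set N := ⌊|t|⌋₊ + 2 with hN
  have htN : |t| + 1 < N := by
    have := hlt t
    push_cast [hN] at this ⊢
    linarith
  have heq : (fun s => c (⌊|s|⌋₊ + 1) s) =ᶠ[𝓝 t] c N := by
    have : ∀ᶠ s in 𝓝 t, |s| < |t| + 1 :=
      continuous_abs.continuousAt.eventually_lt continuousAt_const (by linarith)
    filter_upwards [this] with s hs
    refine agree _ _ (Nat.succ_pos _) ?_ (abs_lt.1 (hlt s))
    have h1 : (⌊|s|⌋₊ : ℝ) < N := (Nat.floor_le (abs_nonneg s)).trans_lt (hs.trans htN)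
    exact_mod_cast h1
  have h2 := (hc N t (abs_lt.1 (by linarith))).congr_of_eventuallyEq heq
  rwa [← heq.eq_of_nhds] at h2

theorem flowMap_spec (hK : LipschitzWith K v) (hM : ∀ x, ‖v x‖ ≤ M) (y : E) :
    flowMap v 0 y = y ∧ ∀ r, HasDerivAt (fun t => flowMap v t y) (v (flowMap v r y)) r := by
  have h := exists_global_solution hK hM y
  have e : (fun t => flowMap v t y) = h.choose := by
    funext t
    simp only [flowMap]
    rw [dif_pos h]
  constructor
  · rw [show flowMap v 0 y = h.choose 0 from congrFun e 0]; exact h.choose_spec.1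
  · intro r
    rw [show flowMap v r y = h.choose r from congrFun e r, e]
    exact h.choose_spec.2 r

theorem flowMap_zero_time (hK : LipschitzWith K v) (hM : ∀ x, ‖v x‖ ≤ M) (y : E) :
    flowMap v 0 y = y := (flowMap_spec hK hM y).1

theorem hasDerivAt_flowMap (hK : LipschitzWith K v) (hM : ∀ x, ‖v x‖ ≤ M) (y : E) (r : ℝ) :
    HasDerivAt (fun t => flowMap v t y) (v (flowMap v r y)) r := (flowMap_spec hK hM y).2 r

theorem norm_flowMap_sub_flowMap_le (hK : LipschitzWith K v) (hM : ∀ x, ‖v x‖ ≤ M) (y : E)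
    (r s : ℝ) : ‖flowMap v r y - flowMap v s y‖ ≤ M * |r - s| := by
  have := convex_univ.norm_image_sub_le_of_norm_hasDerivWithin_le (s := univ)
    (f := fun t => flowMap v t y) (f' := fun t => v (flowMap v t y)) (C := M)
    (fun t _ => (hasDerivAt_flowMap hK hM y t).hasDerivWithinAt) (fun t _ => hM _)
    (mem_univ s) (mem_univ r)
  simpa using this

theorem norm_flowMap_sub_le (hK : LipschitzWith K v) (hM : ∀ x, ‖v x‖ ≤ M) (y : E)
    (r : ℝ) : ‖flowMap v r y - y‖ ≤ M * |r| := by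
  simpa [flowMap_zero_time hK hM] using norm_flowMap_sub_flowMap_le hK hM y r 0

/-- Grönwall's inequality; negative times are reduced to positive ones by reversing the field. -/
theorem dist_flowMap_le (hK : LipschitzWith K v) (hM : ∀ x, ‖v x‖ ≤ M) (x y : E) (r : ℝ) :
    dist (flowMap v r x) (flowMap v r y) ≤ dist x y * Real.exp (K * |r|) := by
  rcases le_total 0 r with hr | hr
  · have := dist_le_of_trajectories_ODE (v := fun _ => v) (a := 0) (b := r) (δ := dist x y)
      (f := fun t => flowMap v t x) (g := fun t => flowMap v t y) (fun _ => hK)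
      (HasDerivAt.continuousOn fun t _ => hasDerivAt_flowMap hK hM x t)
      (fun t _ => (hasDerivAt_flowMap hK hM x t).hasDerivWithinAt)
      (HasDerivAt.continuousOn fun t _ => hasDerivAt_flowMap hK hM y t)
      (fun t _ => (hasDerivAt_flowMap hK hM y t).hasDerivWithinAt)
      (by simp [flowMap_zero_time hK hM]) r (right_mem_Icc.2 hr)
    simpa [abs_of_nonneg hr] using this
  · have hK' : LipschitzWith K fun z => -v z := hK.neg
    have hd : ∀ z t, HasDerivAt (fun t => flowMap v (-t) z) (-v (flowMap v (-t) z)) t := by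
      intro z t
      have := (hasDerivAt_flowMap hK hM z (-t)).scomp t (hasDerivAt_neg t)
      rwa [neg_one_smul] at this
    have := dist_le_of_trajectories_ODE (v := fun _ z => -v z) (a := 0) (b := -r) (δ := dist x y)
      (f := fun t => flowMap v (-t) x) (g := fun t => flowMap v (-t) y) (fun _ => hK')
      (HasDerivAt.continuousOn fun t _ => hd x t)
      (fun t _ => (hd x t).hasDerivWithinAt)
      (HasDerivAt.continuousOn fun t _ => hd y t)
      (fun t _ => (hd y t).hasDerivWithinAt)
      (by simp [flowMap_zero_time hK hM]) (-r) (right_mem_Icc.2 (by linarith))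
    simpa [abs_of_nonpos hr] using this

/-- The displacement `flowMap v r x - x` is jointly Lipschitz, with a constant in the space
variable that is proportional to the time. -/
theorem norm_displacement_sub_le (hK : LipschitzWith K v) (hM : ∀ x, ‖v x‖ ≤ M) (x y : E)
    {r s : ℝ} (hr : |r| ≤ 1) :
    ‖(flowMap v r x - x) - (flowMap v s y - y)‖ ≤
      K * Real.exp K * |r| * ‖x - y‖ + M * |r - s| := by
  have h1 : ‖(flowMap v r x - x) - (flowMap v r y - y)‖ ≤ K * Real.exp K * |r| * ‖x - y‖ := by
    have hb : ∀ t ∈ Icc (-1 : ℝ) 1,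
        ‖v (flowMap v t x) - v (flowMap v t y)‖ ≤ K * Real.exp K * ‖x - y‖ := by
      intro t ht
      have ht' : |t| ≤ 1 := abs_le.2 ht
      rw [← dist_eq_norm, ← dist_eq_norm]
      calc dist (v (flowMap v t x)) (v (flowMap v t y))
          ≤ K * dist (flowMap v t x) (flowMap v t y) := hK.dist_le_mul _ _
        _ ≤ K * (dist x y * Real.exp (K * |t|)) := by gcongr; exact dist_flowMap_le hK hM x y t
        _ ≤ K * (dist x y * Real.exp K) := by
            gcongr; exact mul_le_of_le_one_right K.2 ht'
        _ = _ := by ring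
    have := (convex_Icc (-1 : ℝ) 1).norm_image_sub_le_of_norm_hasDerivWithin_le
      (f := fun t => (flowMap v t x - x) - (flowMap v t y - y))
      (f' := fun t => v (flowMap v t x) - v (flowMap v t y))
      (fun t _ => (((hasDerivAt_flowMap hK hM x t).sub_const x).sub
        ((hasDerivAt_flowMap hK hM y t).sub_const y)).hasDerivWithinAt) hb
      (x := 0) (y := r) (by simp) (abs_le.1 hr)
    simp only [flowMap_zero_time hK hM, sub_self, sub_zero, Real.norm_eq_abs] at this
    calc _ ≤ _ := this
      _ = _ := by ring
  have h2 := norm_flowMap_sub_flowMap_le hK hM y r s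
  calc ‖(flowMap v r x - x) - (flowMap v s y - y)‖
      = ‖((flowMap v r x - x) - (flowMap v r y - y)) + (flowMap v r y - flowMap v s y)‖ := by
        congr 1; abel
    _ ≤ _ := (norm_add_le _ _).trans (add_le_add h1 h2)

/-- The curve `t ↦ flowMap v (r * t) x` solves the same rescaled equation. The rescaling turns the
time `r` into a parameter of an equation on the fixed interval `[0, 1]`, as the implicit function
theorem requires. -/
theorem flowMap_eq_of_scaled_solution (hK : LipschitzWith K v) (hM : ∀ x, ‖v x‖ ≤ M)
    {c : ℝ → E} {r : ℝ} {x : E} (h0 : c 0 = x) (hc : ContinuousOn c (Icc 0 1))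
    (hd : ∀ t ∈ Ico (0 : ℝ) 1, HasDerivWithinAt c (r • v (c t)) (Ici t) t) :
    c 1 = flowMap v r x := by
  have hL : LipschitzWith (‖r‖₊ * K) fun z => r • v z := (lipschitzWith_smul r).comp hK
  have hd' : ∀ t, HasDerivAt (fun t => flowMap v (r * t) x) (r • v (flowMap v (r * t) x)) t := by
    intro t
    have h2 : HasDerivAt (fun t => r * t) r t := by simpa using (hasDerivAt_id t).const_mul r
    exact (hasDerivAt_flowMap hK hM x (r * t)).scomp t h2
  have := ODE_solution_unique (v := fun _ z => r • v z) (a := 0) (b := 1) (fun _ => hL) hc hd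
    (g := fun t => flowMap v (r * t) x)
    (HasDerivAt.continuousOn fun t _ => hd' t) (fun t _ => (hd' t).hasDerivWithinAt)
    (by simp [h0, flowMap_zero_time hK hM]) (right_mem_Icc.2 zero_le_one)
  simpa using this

/-- The flow of a field of class `C^m` is jointly of class `C^m` near time zero. -/
theorem contDiffAt_flowMap {m : ℕ} (hm : m ≠ 0) (hv : ContDiff ℝ m v) (hK : LipschitzWith K v)
    (hM : ∀ x, ‖v x‖ ≤ M) (x₀ : E) :
    ContDiffAt ℝ m (fun q : E × ℝ => flowMap v q.2 q.1) (x₀, 0) := by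
  let I := Icc (0 : ℝ) 1
  let N : C(I, E) → C(I, E) := fun c => (⟨v, hv.continuous⟩ : C(E, E)).comp c
  have hN : ContDiff ℝ m N := contDiff_superposition hv
  let κ : E →L[ℝ] C(I, E) := ContinuousLinearMap.const ℝ I
  have hκ : ∀ x t, κ x t = x := fun _ _ => rfl
  -- The zeros of `G` are the solutions of the integral equation `c(t) = x + r ∫₀ᵗ v(c)`.
  let G : (E × ℝ) × C(I, E) → C(I, E) := fun p => p.2 - κ p.1.1 - p.1.2 • primitiveOperator (N p.2)
  have hG : ContDiff ℝ m G := by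
    refine (contDiff_snd.sub (κ.contDiff.comp (contDiff_fst.comp contDiff_fst))).sub ?_
    exact (contDiff_snd.comp contDiff_fst).smul
      (primitiveOperator.contDiff.comp (hN.comp contDiff_snd))
  let u : (E × ℝ) × C(I, E) := ((x₀, 0), κ x₀)
  have hm' : (m : ℕ∞ω) ≠ 0 := by exact_mod_cast hm
  -- At `r = 0` the nonlinear term is multiplied by zero, so the partial derivative in `c` is the
  -- identity.
  have hinr : fderiv ℝ G u ∘L .inr ℝ (E × ℝ) C(I, E) = .id ℝ _ := by
    have h1 : HasFDerivAt G (fderiv ℝ G u) u := (hG.differentiable hm' u).hasFDerivAt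
    have h2 : HasFDerivAt (fun c : C(I, E) => ((x₀, (0 : ℝ)), c)) (.inr ℝ (E × ℝ) C(I, E)) (κ x₀) :=
      hasFDerivAt_prodMk_right _ _
    have h3 := HasFDerivAt.comp (κ x₀) h1 h2
    have h4 : (G ∘ fun c : C(I, E) => ((x₀, (0 : ℝ)), c)) = fun c => c - κ x₀ := by
      funext c; simp [G]
    rw [h4] at h3
    exact h3.unique ((hasFDerivAt_id _).sub_const _)
  have hinv : (fderiv ℝ G u ∘L .inr ℝ (E × ℝ) C(I, E)).IsInvertible := by
    rw [hinr]; exact ⟨.refl ℝ _, rfl⟩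
  have hGu : ContDiffAt ℝ m G u := hG.contDiffAt
  have hG0 : G u = 0 := by simp [G, u]
  set φ := hGu.implicitFunction hm' hinv with hφ
  have hφc : ContDiffAt ℝ m φ (x₀, 0) := hGu.contDiffAt_implicitFunction hm' hinv
  have hφe : ∀ᶠ q in 𝓝 (x₀, (0 : ℝ)), G (q, φ q) = 0 := by
    have := hGu.eventually_apply_implicitFunction hm' hinv
    rwa [hG0] at this
  have h1I : (1 : ℝ) ∈ I := right_mem_Icc.2 zero_le_one
  have hev : ContDiffAt ℝ m (fun q => φ q ⟨1, h1I⟩) (x₀, 0) :=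
    (ContinuousMap.evalCLM (M := E) ℝ (⟨1, h1I⟩ : I)).contDiff.contDiffAt.comp (x₀, (0 : ℝ)) hφc
  refine hev.congr_of_eventuallyEq ?_
  filter_upwards [hφe] with q hq
  have hsol : ∀ t : I, φ q t = q.1 + q.2 • ∫ s in (0 : ℝ)..t, IccExtend zero_le_one (N (φ q)) s := by
    intro t
    have := DFunLike.congr_fun hq t
    simp only [G, ContinuousMap.sub_apply, ContinuousMap.smul_apply, hκ,
      ContinuousMap.zero_apply] at this
    rw [← sub_eq_zero, ← this]; abel
  have hcN : Continuous (IccExtend zero_le_one (N (φ q)) : ℝ → E) :=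
    (N (φ q)).continuous.Icc_extend'
  let c : ℝ → E := fun t => q.1 + q.2 • ∫ s in (0 : ℝ)..t, IccExtend zero_le_one (N (φ q)) s
  have hcd : ∀ t, HasDerivAt c (q.2 • IccExtend zero_le_one (N (φ q)) t) t := fun t =>
    ((intervalIntegral.integral_hasDerivAt_right (hcN.intervalIntegrable _ _)
      (hcN.stronglyMeasurableAtFilter _ _) hcN.continuousAt).const_smul q.2).const_add q.1
  have := flowMap_eq_of_scaled_solution hK hM (c := c) (r := q.2) (x := q.1) (by simp [c])
    (HasDerivAt.continuousOn fun t _ => hcd t) (fun t ht => by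
      have ht' : t ∈ I := Ico_subset_Icc_self ht
      have h5 := (hcd t).hasDerivWithinAt (s := Ici t)
      rw [IccExtend_of_mem _ _ ht'] at h5
      have h6 : (N (φ q)) ⟨t, ht'⟩ = v (c t) := by
        change v (φ q ⟨t, ht'⟩) = _
        rw [hsol ⟨t, ht'⟩]
      rwa [h6] at h5)
  rw [← this]
  exact (hsol ⟨1, h1I⟩).symm

end flow

/-! ### Functions whose Hölder quotients vanish locally -/

section littleHolderAt

set_option linter.unusedSectionVars false

variable {E F G : Type*} [NormedAddCommGroup E] [NormedSpace ℝ E] [NormedAddCommGroup F]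
  [NormedSpace ℝ F] [NormedAddCommGroup G] [NormedSpace ℝ G] {α : ℝ}

/-- The `α`-Hölder quotients of `g` tend to zero near `y`. -/
def IsLittleHolderAt (α : ℝ) (g : E → F) (y : E) : Prop :=
  (fun p : E × E => g p.1 - g p.2) =o[𝓝 (y, y)] fun p => ‖p.1 - p.2‖ ^ α

/-- `f` is of class `C¹` at `y` and the Hölder quotients of its derivative vanish locally. -/
def IsLittleHolderAtOne (α : ℝ) (f : E → F) (y : E) : Prop :=
  ContDiffAt ℝ 1 f y ∧ IsLittleHolderAt α (fderiv ℝ f) y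

/-- `f` is of class `C²` at `y` and the Hölder quotients of its second derivative vanish locally. -/
def IsLittleHolderAtTwo (α : ℝ) (f : E → F) (y : E) : Prop :=
  ContDiffAt ℝ 2 f y ∧ IsLittleHolderAt α (fderiv ℝ (fderiv ℝ f)) y

/-- A `C¹` map is Lipschitz near the point, and `‖x - y‖ = ‖x - y‖ ^ (1 - α) * ‖x - y‖ ^ α` with a
first factor that tends to zero. -/
theorem ContDiffAt.isLittleHolderAt (hα₀ : 0 < α) (hα₁ : α < 1) {g : E → F} {y : E}
    (hg : ContDiffAt ℝ 1 g y) : IsLittleHolderAt α g y := by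
  refine (hg.hasStrictFDerivAt one_ne_zero).isBigO_sub.trans_isLittleO ?_
  have h1 : Tendsto (fun p : E × E => ‖p.1 - p.2‖ ^ (1 - α)) (𝓝 (y, y)) (𝓝 0) := by
    have : Continuous fun p : E × E => ‖p.1 - p.2‖ ^ (1 - α) :=
      (continuous_fst.sub continuous_snd).norm.rpow_const fun _ => Or.inr (by linarith)
    have h := this.tendsto (y, y)
    simpa [Real.zero_rpow (by linarith : (1 : ℝ) - α ≠ 0)] using h
  have h2 : (fun p : E × E => ‖p.1 - p.2‖) =o[𝓝 (y, y)] fun p => ‖p.1 - p.2‖ ^ α := by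
    have h3 := ((Asymptotics.isLittleO_one_iff ℝ).2 h1).mul_isBigO
      (Asymptotics.isBigO_refl (fun p : E × E => ‖p.1 - p.2‖ ^ α) (𝓝 (y, y)))
    refine (h3.congr_left fun p => ?_).congr_right fun p => one_mul _
    rcases (norm_nonneg (p.1 - p.2)).eq_or_lt with h | h
    · rw [← h, Real.zero_rpow hα₀.ne', mul_zero]
    · rw [← Real.rpow_add h]; simp
  exact h2.of_norm_left

theorem IsLittleHolderAt.congr_of_eventuallyEq {g h : E → F} {y : E}
    (hg : IsLittleHolderAt α g y) (e : h =ᶠ[𝓝 y] g) : IsLittleHolderAt α h y := by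
  refine hg.congr' ?_ EventuallyEq.rfl
  rw [nhds_prod_eq]
  filter_upwards [e.prod_mk e] with p hp
  rw [hp.1, hp.2]

theorem IsLittleHolderAt.clm_comp (L : F →L[ℝ] G) {g : E → F} {y : E}
    (hg : IsLittleHolderAt α g y) : IsLittleHolderAt α (fun x => L (g x)) y := by
  have h := (L.isBigO_comp (fun p : E × E => g p.1 - g p.2) (𝓝 (y, y))).trans_isLittleO hg
  simp only [map_sub] at h
  exact h

theorem IsLittleHolderAt.prodMk {g : E → F} {h : E → G} {y : E}
    (hg : IsLittleHolderAt α g y) (hh : IsLittleHolderAt α h y) :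
    IsLittleHolderAt α (fun x => (g x, h x)) y :=
  Asymptotics.IsLittleO.prod_left hg hh

/-- Split `B(g₁, h₁) - B(g₂, h₂) = B(g₁ - g₂, h₁) + B(g₂, h₁ - h₂)`; continuity at `y` bounds the
undifferenced factors. -/
theorem IsLittleHolderAt.bilinear {H : Type*} [NormedAddCommGroup H] [NormedSpace ℝ H]
    (B : F →L[ℝ] G →L[ℝ] H) {g : E → F} {h : E → G} {y : E}
    (hg : IsLittleHolderAt α g y) (hh : IsLittleHolderAt α h y)
    (cg : ContinuousAt g y) (ch : ContinuousAt h y) :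
    IsLittleHolderAt α (fun x => B (g x) (h x)) y := by
  have t1 : Tendsto (fun p : E × E => g p.2) (𝓝 (y, y)) (𝓝 (g y)) :=
    cg.tendsto.comp continuous_snd.continuousAt
  have t2 : Tendsto (fun p : E × E => h p.1) (𝓝 (y, y)) (𝓝 (h y)) :=
    ch.tendsto.comp continuous_fst.continuousAt
  have b1 : (fun p : E × E => ‖h p.1‖) =O[𝓝 (y, y)] fun _ => (1 : ℝ) := (t2.norm).isBigO_one ℝ
  have b2 : (fun p : E × E => ‖g p.2‖) =O[𝓝 (y, y)] fun _ => (1 : ℝ) := (t1.norm).isBigO_one ℝ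
  have e1 : (fun p : E × E => B (g p.1 - g p.2) (h p.1)) =o[𝓝 (y, y)]
      fun p => ‖p.1 - p.2‖ ^ α := by
    refine Asymptotics.IsBigO.trans_isLittleO (g := fun p : E × E => ‖g p.1 - g p.2‖ * ‖h p.1‖)
      (Asymptotics.IsBigO.of_bound ‖B‖ (Eventually.of_forall fun p => ?_)) ?_
    · rw [norm_mul, norm_norm, norm_norm, ← mul_assoc]; exact B.le_opNorm₂ _ _
    · simpa using hg.norm_left.mul_isBigO b1
  have e2 : (fun p : E × E => B (g p.2) (h p.1 - h p.2)) =o[𝓝 (y, y)]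
      fun p => ‖p.1 - p.2‖ ^ α := by
    refine Asymptotics.IsBigO.trans_isLittleO (g := fun p : E × E => ‖g p.2‖ * ‖h p.1 - h p.2‖)
      (Asymptotics.IsBigO.of_bound ‖B‖ (Eventually.of_forall fun p => ?_)) ?_
    · rw [norm_mul, norm_norm, norm_norm, ← mul_assoc]; exact B.le_opNorm₂ _ _
    · simpa using b2.mul_isLittleO hh.norm_left
  refine (e1.add e2).congr_left fun p => ?_
  simp

theorem IsLittleHolderAt.comp (hα₀ : 0 < α) {g : F → G} {f : E → F} {y : E}
    (hg : IsLittleHolderAt α g (f y)) (hf : ContDiffAt ℝ 1 f y) :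
    IsLittleHolderAt α (g ∘ f) y := by
  have t : Tendsto (fun p : E × E => (f p.1, f p.2)) (𝓝 (y, y)) (𝓝 (f y, f y)) :=
    (hf.continuousAt.tendsto.comp (continuous_fst.tendsto (y, y))).prodMk_nhds
      (hf.continuousAt.tendsto.comp (continuous_snd.tendsto (y, y)))
  refine (hg.comp_tendsto t).trans_isBigO ?_
  exact (hf.hasStrictFDerivAt one_ne_zero).isBigO_sub.norm_norm.rpow hα₀.le
    (Eventually.of_forall fun p => norm_nonneg _)

theorem isLittleHolderAtTwo_iff {f : E → F} {y : E} :
    IsLittleHolderAtTwo α f y ↔ ContDiffAt ℝ 2 f y ∧ IsLittleHolderAtOne α (fderiv ℝ f) y :=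
  ⟨fun h => ⟨h.1, h.1.fderiv_right (by norm_num), h.2⟩, fun h => ⟨h.1, h.2.2⟩⟩

theorem ContDiffAt.isLittleHolderAtOne (hα₀ : 0 < α) (hα₁ : α < 1) {g : E → F} {y : E}
    (hg : ContDiffAt ℝ 2 g y) : IsLittleHolderAtOne α g y :=
  ⟨hg.of_le (by norm_num), (hg.fderiv_right (m := 1) (by norm_num)).isLittleHolderAt hα₀ hα₁⟩

theorem ContDiffAt.isLittleHolderAtTwo (hα₀ : 0 < α) (hα₁ : α < 1) {g : E → F} {y : E}
    (hg : ContDiffAt ℝ 3 g y) : IsLittleHolderAtTwo α g y :=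
  isLittleHolderAtTwo_iff.2 ⟨hg.of_le (by norm_num),
    (hg.fderiv_right (m := 2) (by norm_num)).isLittleHolderAtOne hα₀ hα₁⟩

theorem IsLittleHolderAtOne.congr_of_eventuallyEq {g h : E → F} {y : E}
    (hg : IsLittleHolderAtOne α g y) (e : h =ᶠ[𝓝 y] g) : IsLittleHolderAtOne α h y :=
  ⟨hg.1.congr_of_eventuallyEq e, hg.2.congr_of_eventuallyEq e.fderiv⟩

theorem IsLittleHolderAtTwo.congr_of_eventuallyEq {g h : E → F} {y : E}
    (hg : IsLittleHolderAtTwo α g y) (e : h =ᶠ[𝓝 y] g) : IsLittleHolderAtTwo α h y :=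
  ⟨hg.1.congr_of_eventuallyEq e, hg.2.congr_of_eventuallyEq e.fderiv.fderiv⟩

theorem eventually_fderiv_prodMk {f : E → F} {g : E → G} {y : E} (hf : ContDiffAt ℝ 1 f y)
    (hg : ContDiffAt ℝ 1 g y) :
    fderiv ℝ (fun x => (f x, g x)) =ᶠ[𝓝 y]
      fun x => (ContinuousLinearMap.prodₗᵢ ℝ (fderiv ℝ f x, fderiv ℝ g x) : E →L[ℝ] F × G) := by
  filter_upwards [hf.eventually (by simp), hg.eventually (by simp)] with x h1 h2
  exact (h1.differentiableAt one_ne_zero).fderiv_prodMk (h2.differentiableAt one_ne_zero)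

theorem IsLittleHolderAtOne.prodMk {f : E → F} {g : E → G} {y : E}
    (hf : IsLittleHolderAtOne α f y) (hg : IsLittleHolderAtOne α g y) :
    IsLittleHolderAtOne α (fun x => (f x, g x)) y := by
  refine ⟨hf.1.prodMk hg.1, IsLittleHolderAt.congr_of_eventuallyEq ?_
    (eventually_fderiv_prodMk hf.1 hg.1)⟩
  exact (hf.2.prodMk hg.2).clm_comp
    (ContinuousLinearMap.prodₗᵢ (E := E) (F := F) (G := G) (𝕜 := ℝ) ℝ).toContinuousLinearEquiv.toContinuousLinearMap

theorem eventually_fderiv_comp {g : F → G} {f : E → F} {y : E} (hg : ContDiffAt ℝ 1 g (f y))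
    (hf : ContDiffAt ℝ 1 f y) :
    fderiv ℝ (g ∘ f) =ᶠ[𝓝 y]
      fun x => ContinuousLinearMap.compL ℝ E F G (fderiv ℝ g (f x)) (fderiv ℝ f x) := by
  filter_upwards [hf.continuousAt.eventually (hg.eventually (by simp)),
    hf.eventually (by simp)] with x h1 h2
  exact fderiv_comp x (h1.differentiableAt one_ne_zero) (h2.differentiableAt one_ne_zero)

theorem IsLittleHolderAtOne.comp (hα₀ : 0 < α) {g : F → G} {f : E → F} {y : E}
    (hg : IsLittleHolderAtOne α g (f y)) (hf : IsLittleHolderAtOne α f y) :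
    IsLittleHolderAtOne α (g ∘ f) y := by
  refine ⟨hg.1.comp y hf.1, IsLittleHolderAt.congr_of_eventuallyEq ?_
    (eventually_fderiv_comp hg.1 hf.1)⟩
  have c1 : ContinuousAt (fderiv ℝ g) (f y) := hg.1.continuousAt_fderiv one_ne_zero
  exact (hg.2.comp hα₀ hf.1).bilinear _ hf.2 (c1.comp hf.1.continuousAt)
    (hf.1.continuousAt_fderiv one_ne_zero)

theorem IsLittleHolderAtTwo.contDiffAt_one {f : E → F} {y : E} (hf : IsLittleHolderAtTwo α f y) :
    ContDiffAt ℝ 1 f y := hf.1.of_le (by norm_num)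

theorem IsLittleHolderAtTwo.one (hα₀ : 0 < α) (hα₁ : α < 1) {f : E → F} {y : E}
    (hf : IsLittleHolderAtTwo α f y) : IsLittleHolderAtOne α f y :=
  hf.1.isLittleHolderAtOne hα₀ hα₁

theorem IsLittleHolderAtTwo.prodMk (hα₀ : 0 < α) (hα₁ : α < 1) {f : E → F} {g : E → G} {y : E}
    (hf : IsLittleHolderAtTwo α f y) (hg : IsLittleHolderAtTwo α g y) :
    IsLittleHolderAtTwo α (fun x => (f x, g x)) y := by
  refine isLittleHolderAtTwo_iff.2 ⟨hf.1.prodMk hg.1, IsLittleHolderAtOne.congr_of_eventuallyEq ?_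
    (eventually_fderiv_prodMk hf.contDiffAt_one hg.contDiffAt_one)⟩
  exact ((ContinuousLinearMap.prodₗᵢ (E := E) (F := F) (G := G) (𝕜 := ℝ)
    ℝ).toContinuousLinearEquiv.contDiff.contDiffAt.isLittleHolderAtOne hα₀ hα₁).comp hα₀
    ((isLittleHolderAtTwo_iff.1 hf).2.prodMk (isLittleHolderAtTwo_iff.1 hg).2)

/-- By the chain rule the derivative of `g ∘ f` is a smooth bilinear expression in `g' ∘ f` and
`f'`, both of the first order class, so the first order composition rule finishes the proof. -/
theorem IsLittleHolderAtTwo.comp (hα₀ : 0 < α) (hα₁ : α < 1) {g : F → G} {f : E → F} {y : E}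
    (hg : IsLittleHolderAtTwo α g (f y)) (hf : IsLittleHolderAtTwo α f y) :
    IsLittleHolderAtTwo α (g ∘ f) y := by
  refine isLittleHolderAtTwo_iff.2 ⟨hg.1.comp y hf.1, IsLittleHolderAtOne.congr_of_eventuallyEq ?_
    (eventually_fderiv_comp hg.contDiffAt_one hf.contDiffAt_one)⟩
  have hB : ContDiff ℝ 2 fun q : (F →L[ℝ] G) × (E →L[ℝ] F) => q.1.comp q.2 :=
    isBoundedBilinearMap_comp.contDiff
  exact (hB.contDiffAt.isLittleHolderAtOne hα₀ hα₁).comp hα₀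
    (((isLittleHolderAtTwo_iff.1 hg).2.comp hα₀ (hf.one hα₀ hα₁)).prodMk
      (isLittleHolderAtTwo_iff.1 hf).2)

theorem IsLittleHolderAtTwo.mul (hα₀ : 0 < α) (hα₁ : α < 1) {f g : E → ℝ} {y : E}
    (hf : IsLittleHolderAtTwo α f y) (hg : IsLittleHolderAtTwo α g y) :
    IsLittleHolderAtTwo α (fun x => f x * g x) y := by
  have h : ContDiff ℝ 3 fun q : ℝ × ℝ => q.1 * q.2 := contDiff_mul
  exact (h.contDiffAt.isLittleHolderAtTwo hα₀ hα₁).comp hα₀ hα₁ (hf.prodMk hα₀ hα₁ hg)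

theorem IsLittleHolderAtTwo.add (hα₀ : 0 < α) (hα₁ : α < 1) {f g : E → F} {y : E}
    (hf : IsLittleHolderAtTwo α f y) (hg : IsLittleHolderAtTwo α g y) :
    IsLittleHolderAtTwo α (fun x => f x + g x) y := by
  have h : ContDiff ℝ 3 fun q : F × F => q.1 + q.2 := contDiff_add
  exact (h.contDiffAt.isLittleHolderAtTwo hα₀ hα₁).comp hα₀ hα₁ (hf.prodMk hα₀ hα₁ hg)

theorem IsLittleHolderAtTwo.sum (hα₀ : 0 < α) (hα₁ : α < 1) {ι : Type*} (s : Finset ι)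
    {f : ι → E → F} {y : E} (hf : ∀ i ∈ s, IsLittleHolderAtTwo α (f i) y) :
    IsLittleHolderAtTwo α (fun x => ∑ i ∈ s, f i x) y := by
  classical
  induction s using Finset.induction_on with
  | empty => simpa using (contDiffAt_const (c := (0 : F))).isLittleHolderAtTwo hα₀ hα₁
  | insert a s ha ih =>
    simp only [Finset.sum_insert ha]
    exact (hf a (Finset.mem_insert_self _ _)).add hα₀ hα₁
      (ih fun i hi => hf i (Finset.mem_insert_of_mem hi))

/-- The class of maps with vanishing Hölder quotients of the second derivative is stable under
inversion. -/
theorem IsLittleHolderAtTwo.inverse [CompleteSpace E] (hα₀ : 0 < α) (hα₁ : α < 1) {Φ Ψ : E → E}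
    (hΦ : ∀ x, IsLittleHolderAtTwo α Φ x) (hΨ : ContDiff ℝ 2 Ψ)
    (hl : Function.LeftInverse Ψ Φ) (hr : Function.RightInverse Ψ Φ) (x : E) :
    IsLittleHolderAtTwo α Ψ x := by
  have dΨ : ∀ z, HasFDerivAt Ψ (fderiv ℝ Ψ z) z := fun z =>
    (hΨ.differentiable (by norm_num) z).hasFDerivAt
  have dΦ : ∀ z, HasFDerivAt Φ (fderiv ℝ Φ z) z := fun z =>
    ((hΦ z).1.differentiableAt (by norm_num)).hasFDerivAt
  have c1 : ∀ z, (fderiv ℝ Φ (Ψ z)).comp (fderiv ℝ Ψ z) = .id ℝ E := fun z => by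
    have h := (dΦ (Ψ z)).comp z (dΨ z)
    rw [hr.id] at h
    exact h.unique (hasFDerivAt_id z)
  have c2 : ∀ z, (fderiv ℝ Ψ z).comp (fderiv ℝ Φ (Ψ z)) = .id ℝ E := fun z => by
    have h := HasFDerivAt.comp (Ψ z) (g := Ψ) (f := Φ) (g' := fderiv ℝ Ψ z)
      (by rw [hr z]; exact dΨ z) (dΦ (Ψ z))
    rw [hl.id] at h
    exact h.unique (hasFDerivAt_id _)
  let e : E → E ≃L[ℝ] E := fun z => ContinuousLinearEquiv.equivOfInverse (fderiv ℝ Φ (Ψ z))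
    (fderiv ℝ Ψ z) (fun u => DFunLike.congr_fun (c2 z) u) (fun u => DFunLike.congr_fun (c1 z) u)
  -- This formula expresses `Ψ'` through `Φ'`, operator inversion and `Ψ` itself. Only the assumed
  -- `C²` regularity of `Ψ` enters on the right, and inversion is smooth at invertible operators.
  have hinv : fderiv ℝ Ψ = ContinuousLinearMap.inverse ∘ (fderiv ℝ Φ ∘ Ψ) := by
    funext z
    exact (ContinuousLinearMap.inverse_equiv (e z)).symm
  refine isLittleHolderAtTwo_iff.2 ⟨hΨ.contDiffAt, ?_⟩
  rw [hinv]
  refine IsLittleHolderAtOne.comp hα₀ ?_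
    ((isLittleHolderAtTwo_iff.1 (hΦ (Ψ x))).2.comp hα₀ (hΨ.contDiffAt.isLittleHolderAtOne hα₀ hα₁))
  exact (contDiffAt_map_inverse (n := 2) (e x)).isLittleHolderAtOne hα₀ hα₁

end littleHolderAt

/-! ### The Hölder norm of order two in terms of iterated Fréchet derivatives -/

section holderNormTwo

set_option linter.unusedSectionVars false

variable {E : Type*} [NormedAddCommGroup E] [NormedSpace ℝ E] {α : ℝ}

theorem edist_iteratedFDeriv_two (f : E → ℝ) (x y : E) :
    edist (iteratedFDeriv ℝ 2 f x) (iteratedFDeriv ℝ 2 f y) =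
      edist (fderiv ℝ (fderiv ℝ f) x) (fderiv ℝ (fderiv ℝ f) y) := by
  have h : ∀ z, iteratedFDeriv ℝ 2 f z =
      (continuousMultilinearCurryRightEquiv' ℝ 1 E ℝ).symm
        ((continuousMultilinearCurryRightEquiv' ℝ 0 E (E →L[ℝ] ℝ)).symm
          ((continuousMultilinearCurryFin0 ℝ E (E →L[ℝ] E →L[ℝ] ℝ)).symm
            (fderiv ℝ (fderiv ℝ f) z))) := by
    intro z
    rw [iteratedFDeriv_succ_eq_comp_right, Function.comp_apply, iteratedFDeriv_succ_eq_comp_right,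
      Function.comp_apply, iteratedFDeriv_zero_eq_comp, Function.comp_apply]
  rw [h x, h y, LinearIsometryEquiv.edist_map, LinearIsometryEquiv.edist_map,
    LinearIsometryEquiv.edist_map]

theorem norm_iteratedFDeriv_two (f : E → ℝ) (x : E) :
    ‖iteratedFDeriv ℝ 2 f x‖ = ‖fderiv ℝ (fderiv ℝ f) x‖ := by
  rw [← norm_iteratedFDeriv_fderiv, norm_iteratedFDeriv_one]

theorem holderNorm_two_le {O : Set E} {f : E → ℝ} {A : ℝ} (hA : 0 ≤ A) (hα₀ : 0 < α)
    (h0 : ∀ x ∈ O, ‖f x‖ ≤ A) (h1 : ∀ x ∈ O, ‖fderiv ℝ f x‖ ≤ A)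
    (h2 : ∀ x ∈ O, ‖fderiv ℝ (fderiv ℝ f) x‖ ≤ A)
    (h3 : ∀ x ∈ O, ∀ y ∈ O, ‖fderiv ℝ (fderiv ℝ f) x - fderiv ℝ (fderiv ℝ f) y‖ ≤
      A * ‖x - y‖ ^ α) :
    holderNorm 2 α O f ≤ ENNReal.ofReal (2 * A) := by
  rw [two_mul, ENNReal.ofReal_add hA hA]
  refine add_le_add ?_ ?_
  · refine iSup_le fun j => iSup₂_le fun x hx => ?_
    rw [← ofReal_norm]
    refine ENNReal.ofReal_le_ofReal ?_
    obtain ⟨j, hj⟩ := j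
    interval_cases j
    · simpa using h0 x hx
    · simpa [norm_iteratedFDeriv_one] using h1 x hx
    · simpa only [norm_iteratedFDeriv_two] using h2 x hx
  · refine iSup₂_le fun x hx => iSup₂_le fun y hy => ?_
    rw [edist_iteratedFDeriv_two]
    refine ENNReal.div_le_of_le_mul ?_
    rw [edist_dist, edist_dist, dist_eq_norm, dist_eq_norm,
      ENNReal.ofReal_rpow_of_nonneg (norm_nonneg _) hα₀.le, ← ENNReal.ofReal_mul hA]
    exact ENNReal.ofReal_le_ofReal (h3 x hx y hy)

theorem enorm_iteratedFDeriv_le_holderNorm {k : ℕ} {O : Set E} {f : E → ℝ} {j : ℕ} (hj : j ≤ k)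
    {x : E} (hx : x ∈ O) : ‖iteratedFDeriv ℝ j f x‖ₑ ≤ holderNorm k α O f :=
  le_add_right (le_iSup_of_le (⟨j, Nat.lt_succ_of_le hj⟩ : Fin (k + 1))
    (le_iSup₂_of_le (f := fun x (_ : x ∈ O) => ‖iteratedFDeriv ℝ j f x‖ₑ) x hx le_rfl))

theorem norm_le_of_holderNorm_le {k : ℕ} {O : Set E} {f : E → ℝ} {A : ℝ} (hA : 0 ≤ A)
    (h : holderNorm k α O f ≤ ENNReal.ofReal A) {x : E} (hx : x ∈ O) : ‖f x‖ ≤ A := by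
  have := (enorm_iteratedFDeriv_le_holderNorm (α := α) (f := f) (Nat.zero_le k) hx).trans h
  rw [← ofReal_norm, ENNReal.ofReal_le_ofReal_iff hA] at this
  simpa using this

theorem norm_fderiv_le_of_holderNorm_le {k : ℕ} (hk : 1 ≤ k) {O : Set E} {f : E → ℝ} {A : ℝ}
    (hA : 0 ≤ A) (h : holderNorm k α O f ≤ ENNReal.ofReal A) {x : E} (hx : x ∈ O) :
    ‖fderiv ℝ f x‖ ≤ A := by
  have := (enorm_iteratedFDeriv_le_holderNorm (α := α) (f := f) hk hx).trans h
  rw [← ofReal_norm, ENNReal.ofReal_le_ofReal_iff hA] at this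
  simpa [norm_iteratedFDeriv_one] using this

theorem norm_fderiv_fderiv_sub_le_of_holderNorm_le {O : Set E} {f : E → ℝ} {A : ℝ} (hA : 0 ≤ A)
    (hα₀ : 0 < α) (h : holderNorm 2 α O f ≤ ENNReal.ofReal A) {x y : E} (hx : x ∈ O) (hy : y ∈ O) :
    ‖fderiv ℝ (fderiv ℝ f) x - fderiv ℝ (fderiv ℝ f) y‖ ≤ A * ‖x - y‖ ^ α := by
  rcases eq_or_ne x y with rfl | hxy
  · rw [sub_self, sub_self, norm_zero (E := E →L[ℝ] E →L[ℝ] ℝ)]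
    positivity
  have h1 : edist (iteratedFDeriv ℝ 2 f x) (iteratedFDeriv ℝ 2 f y) / edist x y ^ α ≤
      ENNReal.ofReal A :=
    le_trans (le_add_left (le_iSup₂_of_le x hx (le_iSup₂_of_le (f := fun y (_ : y ∈ O) =>
      edist (iteratedFDeriv ℝ 2 f x) (iteratedFDeriv ℝ 2 f y) / edist x y ^ α) y hy le_rfl))) h
  rw [edist_iteratedFDeriv_two, edist_dist, edist_dist, dist_eq_norm, dist_eq_norm,
    ENNReal.ofReal_rpow_of_nonneg (norm_nonneg _) hα₀.le] at h1
  have hp : 0 < ‖x - y‖ ^ α := Real.rpow_pos_of_pos (norm_pos_iff.2 (sub_ne_zero.2 hxy)) _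
  rw [← ENNReal.ofReal_div_of_pos hp, ENNReal.ofReal_le_ofReal_iff hA, div_le_iff₀ hp] at h1
  exact h1

/-- A function of class `buc^{2+α}` on an open set has locally vanishing Hölder quotients. -/
theorem MemLittleHolder.isLittleHolderAtTwo (hα₀ : 0 < α) (hα₁ : α < 1) {O : Set E} (hO : IsOpen O)
    {f : E → ℝ} (hf : MemLittleHolder 2 α O f) {y : E} (hy : y ∈ O) :
    IsLittleHolderAtTwo α f y := by
  refine ⟨hf.1.1.contDiffAt (hO.mem_nhds hy), ?_⟩
  obtain ⟨β, hαβ, hβ⟩ := exists_between hα₁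
  have hD : ∀ {u : E → ℝ}, ContDiffOn ℝ 2 u O → ∀ x ∈ O, DifferentiableAt ℝ u x ∧
      DifferentiableAt ℝ (fderiv ℝ u) x := fun {u} hu x hx => by
    have h := hu.contDiffAt (hO.mem_nhds hx)
    exact ⟨h.differentiableAt (by norm_num),
      (h.fderiv_right (m := 1) (by norm_num)).differentiableAt one_ne_zero⟩
  refine Asymptotics.isLittleO_iff.2 fun ε hε => ?_
  -- Split `f = (f - g) + g`. The first part contributes at most `ε / 2` to the Hölder quotient
  -- everywhere in `O`; the quotient of the second is bounded by `A ‖x - y‖ ^ (β - α)`, which is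
  -- small near the diagonal.
  obtain ⟨g, hg, hfg⟩ := hf.2 β hαβ hβ (ENNReal.ofReal (ε / 2)) (by simpa using half_pos hε)
  obtain ⟨A, hA⟩ : ∃ A : ℝ, 0 ≤ A ∧ holderNorm 2 β O g ≤ ENNReal.ofReal A :=
    ⟨_, ENNReal.toReal_nonneg, (ENNReal.ofReal_toReal hg.2.2.ne).ge⟩
  have hlim : Tendsto (fun p : E × E => A * ‖p.1 - p.2‖ ^ (β - α)) (𝓝 (y, y)) (𝓝 0) := by
    have : Continuous fun p : E × E => A * ‖p.1 - p.2‖ ^ (β - α) :=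
      continuous_const.mul
        ((continuous_fst.sub continuous_snd).norm.rpow_const fun _ => Or.inr (by linarith))
    simpa [Real.zero_rpow (sub_pos.2 hαβ).ne'] using this.tendsto (y, y)
  have hmem : ∀ᶠ p : E × E in 𝓝 (y, y), p.1 ∈ O ∧ p.2 ∈ O := by
    exact (hO.prod hO).mem_nhds ⟨hy, hy⟩
  filter_upwards [hmem, hlim.eventually (gt_mem_nhds (half_pos hε))] with p hp hlt
  have e : ∀ x ∈ O, fderiv ℝ (fderiv ℝ f) x =
      fderiv ℝ (fderiv ℝ (f - g)) x + fderiv ℝ (fderiv ℝ g) x := by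
    intro x hx
    have h1 : fderiv ℝ (f - g) =ᶠ[𝓝 x] fderiv ℝ f - fderiv ℝ g := by
      filter_upwards [hO.mem_nhds hx] with z hz
      exact fderiv_sub (hD hf.1.1 z hz).1 (hD hg.1 z hz).1
    rw [h1.fderiv_eq, fderiv_sub (hD hf.1.1 x hx).2 (hD hg.1 x hx).2, sub_add_cancel]
  have b1 := norm_fderiv_fderiv_sub_le_of_holderNorm_le (half_pos hε).le hα₀ hfg.le hp.1 hp.2
  have b2 := norm_fderiv_fderiv_sub_le_of_holderNorm_le hA.1 (hα₀.trans hαβ) hA.2 hp.1 hp.2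
  have b3 : A * ‖p.1 - p.2‖ ^ β ≤ ε / 2 * ‖p.1 - p.2‖ ^ α := by
    rcases (norm_nonneg (p.1 - p.2)).eq_or_lt with h | h
    · rw [← h, Real.zero_rpow hα₀.ne', Real.zero_rpow (hα₀.trans hαβ).ne']; simp
    · calc A * ‖p.1 - p.2‖ ^ β = A * ‖p.1 - p.2‖ ^ (β - α) * ‖p.1 - p.2‖ ^ α := by
            rw [mul_assoc, ← Real.rpow_add h, sub_add_cancel]
        _ ≤ _ := by gcongr
  rw [e _ hp.1, e _ hp.2, Real.norm_of_nonneg (by positivity), add_sub_add_comm]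
  refine (norm_add_le (E := E →L[ℝ] E →L[ℝ] ℝ) _ _).trans ((add_le_add b1 (b2.trans b3)).trans_eq ?_)
  ring

/-- A bounded function with controlled Hölder quotients at small distances has bounded Hölder
quotients. -/
theorem norm_sub_le_of_local_bound {F : Type*} [NormedAddCommGroup F] (hα₀ : 0 < α) {g : E → F}
    {S ε δ : ℝ} (hδ : 0 < δ) (hε : 0 ≤ ε) (hS : ∀ x, ‖g x‖ ≤ S)
    (h : ∀ x y, ‖x - y‖ < δ → ‖g x - g y‖ ≤ ε * ‖x - y‖ ^ α) (x y : E) :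
    ‖g x - g y‖ ≤ max ε (2 * S / δ ^ α) * ‖x - y‖ ^ α := by
  have hS0 : 0 ≤ S := (norm_nonneg _).trans (hS x)
  rcases lt_or_ge ‖x - y‖ δ with hlt | hge
  · exact (h x y hlt).trans (by gcongr; exact le_max_left _ _)
  · calc ‖g x - g y‖ ≤ 2 * S := (norm_sub_le _ _).trans (by linarith [hS x, hS y])
      _ = 2 * S / δ ^ α * δ ^ α := by
        rw [div_mul_cancel₀]; exact (Real.rpow_pos_of_pos hδ _).ne'
      _ ≤ _ := by
        gcongr
        exact le_max_right _ _

theorem exists_bound_of_compactSupport {F : Type*} [NormedAddCommGroup F] {g : E → F}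
    (hc : HasCompactSupport g) (hg : Continuous g) : ∃ C : ℝ, ∀ x, ‖g x‖ ≤ C :=
  hc.exists_bound_of_continuous hg

theorem exists_bound_fderiv_of_compactSupport {F : Type*} [NormedAddCommGroup F] [NormedSpace ℝ F]
    {g : E → F} (hc : HasCompactSupport g) (hg : ContDiff ℝ 1 g) :
    ∃ C : ℝ, ∀ x, ‖fderiv ℝ g x‖ ≤ C :=
  (hc.fderiv ℝ).exists_bound_of_continuous (hg.continuous_fderiv one_ne_zero)

theorem exists_bound_fderiv_fderiv {u : E → ℝ} (hc : HasCompactSupport u) (hu : ContDiff ℝ 2 u) :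
    ∃ A : ℝ, ∀ x, ‖fderiv ℝ (fderiv ℝ u) x‖ ≤ A :=
  exists_bound_fderiv_of_compactSupport (F := E →L[ℝ] ℝ) (hc.fderiv ℝ)
    (hu.fderiv_right (by norm_num))

/-- Compact support bounds the derivatives and makes them uniformly continuous. For the Hölder
seminorm only nearby points matter, since at distance at least `δ` boundedness of the second
derivative suffices. -/
theorem memBUC_two_of_compactSupport (hα₀ : 0 < α) {u : E → ℝ} (hu : ContDiff ℝ 2 u)
    (hc : HasCompactSupport u) (O : Set E) {ε δ : ℝ} (hδ : 0 < δ) (hε : 0 ≤ ε)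
    (h : ∀ x y, ‖x - y‖ < δ →
      ‖fderiv ℝ (fderiv ℝ u) x - fderiv ℝ (fderiv ℝ u) y‖ ≤ ε * ‖x - y‖ ^ α) :
    MemBUC 2 α O u := by
  have hu1 : ContDiff ℝ 1 (fderiv ℝ u) := hu.fderiv_right (by norm_num)
  obtain ⟨A0, h0⟩ := hc.exists_bound_of_continuous hu.continuous
  obtain ⟨A1, h1⟩ := exists_bound_of_compactSupport (F := E →L[ℝ] ℝ) (hc.fderiv ℝ) hu1.continuous
  obtain ⟨A2, h2⟩ := exists_bound_fderiv_fderiv hc hu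
  have h3 := norm_sub_le_of_local_bound (F := E →L[ℝ] E →L[ℝ] ℝ) hα₀ hδ hε h2 h
  obtain ⟨A3, hA3⟩ : ∃ A3, A3 = max ε (2 * A2 / δ ^ α) := ⟨_, rfl⟩
  rw [← hA3] at h3
  refine ⟨hu.contDiffOn, fun j hj => ?_, ?_⟩
  · have hj' : ((j : ℕ) : WithTop ℕ∞) ≤ (2 : ℕ) := by exact_mod_cast hj
    exact ((hc.iteratedFDeriv j).uniformContinuous_of_continuous
      (hu.continuous_iteratedFDeriv hj')).uniformContinuousOn
  · obtain ⟨A, hA⟩ : ∃ A, A = max (max A0 A1) (max A2 A3) := ⟨_, rfl⟩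
    have a0 : A0 ≤ A := hA ▸ (le_max_left _ _).trans (le_max_left _ _)
    have a1 : A1 ≤ A := hA ▸ (le_max_right _ _).trans (le_max_left _ _)
    have a2 : A2 ≤ A := hA ▸ (le_max_left _ _).trans (le_max_right _ _)
    have a3 : A3 ≤ A := hA ▸ (le_max_right _ _).trans (le_max_right _ _)
    refine (holderNorm_two_le (A := A) ((norm_nonneg _).trans ((h0 0).trans a0)) hα₀
      (fun x _ => (h0 x).trans a0) (fun x _ => (h1 x).trans a1) (fun x _ => (h2 x).trans a2)
      fun x _ y _ => (h3 x y).trans (by gcongr)).trans_lt ENNReal.ofReal_lt_top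

theorem holderNorm_congr {k : ℕ} {O : Set E} (hO : IsOpen O) {f g : E → ℝ} (h : EqOn f g O) :
    holderNorm k α O f = holderNorm k α O g := by
  have e : ∀ j : ℕ, ∀ x ∈ O, iteratedFDeriv ℝ j f x = iteratedFDeriv ℝ j g x := fun j x hx =>
    ((h.eventuallyEq_of_mem (hO.mem_nhds hx)).iteratedFDeriv ℝ j).eq_of_nhds
  unfold holderNorm holderSeminorm
  congr 1
  · refine iSup_congr fun j => iSup_congr fun x => iSup_congr fun hx => ?_
    rw [e j x hx]
  · refine iSup_congr fun x => iSup_congr fun hx => iSup_congr fun y => iSup_congr fun hy => ?_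
    rw [e k x hx, e k y hy]

theorem MemBUC.congr {k : ℕ} {O : Set E} (hO : IsOpen O) {f g : E → ℝ} (h : EqOn f g O)
    (hf : MemBUC k α O f) : MemBUC k α O g := by
  refine ⟨hf.1.congr fun x hx => (h hx).symm, fun j hj => (hf.2.1 j hj).congr fun x hx => ?_, ?_⟩
  · exact ((h.eventuallyEq_of_mem (hO.mem_nhds hx)).iteratedFDeriv ℝ j).eq_of_nhds
  · rw [← holderNorm_congr hO h]; exact hf.2.2

theorem MemLittleHolder.congr {k : ℕ} {O : Set E} (hO : IsOpen O) {f g : E → ℝ} (h : EqOn f g O)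
    (hf : MemLittleHolder k α O f) : MemLittleHolder k α O g := by
  refine ⟨hf.1.congr hO h, fun β h1 h2 ε hε => ?_⟩
  obtain ⟨u, hu, hu'⟩ := hf.2 β h1 h2 ε hε
  refine ⟨u, hu, ?_⟩
  rwa [← holderNorm_congr hO (f := f - u) fun x hx => by simp [h hx]]

end holderNormTwo

/-! ### Approximation by mollification -/

section mollification

set_option linter.unusedSectionVars false

variable {E : Type*} [NormedAddCommGroup E] [NormedSpace ℝ E] [FiniteDimensional ℝ E] {α : ℝ}

/-- A Lebesgue number for the cover of the support by balls of validity handles pairs with a point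
in the support; for all other pairs the difference is zero. -/
theorem uniform_of_isLittleHolderAt {F : Type*} [NormedAddCommGroup F] {g : E → F}
    (hc : HasCompactSupport g) (hg : ∀ x, IsLittleHolderAt α g x) {ε : ℝ} (hε : 0 < ε) :
    ∃ δ > 0, ∀ x y, ‖x - y‖ < δ → ‖g x - g y‖ ≤ ε * ‖x - y‖ ^ α := by
  have loc : ∀ z : E, ∃ r > 0, ∀ x ∈ ball z r, ∀ y ∈ ball z r,
      ‖g x - g y‖ ≤ ε * ‖x - y‖ ^ α := by
    intro z
    have h := Asymptotics.isLittleO_iff.1 (hg z) hε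
    rw [nhds_prod_eq] at h
    obtain ⟨r, hr, h⟩ := (nhds_basis_ball (x := z)).prod_self.eventually_iff.1 h
    refine ⟨r, hr, fun x hx y hy => ?_⟩
    have := h (show (x, y) ∈ ball z r ×ˢ ball z r from ⟨hx, hy⟩)
    rwa [Real.norm_of_nonneg (by positivity)] at this
  choose r hr h using loc
  obtain ⟨δ, hδ, H⟩ := lebesgue_number_lemma_of_metric (c := fun z => ball z (r z)) hc
    (fun _ => isOpen_ball) fun z _ => mem_iUnion.2 ⟨z, mem_ball_self (hr z)⟩
  refine ⟨δ, hδ, fun x y hxy => ?_⟩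
  by_cases hx : x ∈ tsupport g
  · obtain ⟨z, hz⟩ := H x hx
    exact h z x (hz (mem_ball_self hδ)) y (hz (by rwa [mem_ball, dist_comm, dist_eq_norm]))
  by_cases hy : y ∈ tsupport g
  · obtain ⟨z, hz⟩ := H y hy
    exact h z x (hz (by rwa [mem_ball, dist_eq_norm])) y (hz (mem_ball_self hδ))
  rw [image_eq_zero_of_notMem_tsupport hx, image_eq_zero_of_notMem_tsupport hy]
  simp only [sub_self, norm_zero]
  positivity

theorem uniform_of_isLittleHolderAt_fderiv {F : Type*} [NormedAddCommGroup F] [NormedSpace ℝ F]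
    {g : E → F} (hc : HasCompactSupport g) (hg : ∀ x, IsLittleHolderAt α (fderiv ℝ g) x)
    {ε : ℝ} (hε : 0 < ε) :
    ∃ δ > 0, ∀ x y, ‖x - y‖ < δ → ‖fderiv ℝ g x - fderiv ℝ g y‖ ≤ ε * ‖x - y‖ ^ α :=
  uniform_of_isLittleHolderAt (hc.fderiv ℝ) hg hε

theorem uniformContinuous_fderiv_of_compactSupport {F : Type*} [NormedAddCommGroup F]
    [NormedSpace ℝ F] {g : E → F} (hc : HasCompactSupport g) (hg : ContDiff ℝ 1 g) :
    UniformContinuous (fderiv ℝ g) :=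
  (hc.fderiv ℝ).uniformContinuous_of_continuous (hg.continuous_fderiv one_ne_zero)

theorem exists_lipschitzWith_fderiv_of_compactSupport {F : Type*} [NormedAddCommGroup F]
    [NormedSpace ℝ F] {g : E → F} (hc : HasCompactSupport g) (hg : ContDiff ℝ 2 g) :
    ∃ C, LipschitzWith C (fderiv ℝ g) :=
  (hg.fderiv_right (m := 1) (by norm_num)).lipschitzWith_of_hasCompactSupport (hc.fderiv ℝ)
    one_ne_zero

section convolution

variable [MeasurableSpace E] [BorelSpace E] {F : Type*} [NormedAddCommGroup F] [NormedSpace ℝ F]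
  {μ : Measure E} [μ.IsAddHaarMeasure]

open scoped Convolution

/-- The mollification of `g` by a normed bump function. -/
noncomputable def mollify (μ : Measure E) (φ : ContDiffBump (0 : E)) (g : E → F) : E → F :=
  φ.normed μ ⋆[ContinuousLinearMap.lsmul ℝ ℝ, μ] g

theorem hasFDerivAt_mollify [CompleteSpace F] (φ : ContDiffBump (0 : E)) {g : E → F}
    (hg : ContDiff ℝ 1 g) (hc : HasCompactSupport g) (x : E) :
    HasFDerivAt (mollify μ φ g) (mollify μ φ (fderiv ℝ g) x) x := by
  have h := hc.hasFDerivAt_convolution_right (μ := μ) (ContinuousLinearMap.lsmul ℝ ℝ)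
    (f := φ.normed μ) φ.continuous_normed.locallyIntegrable hg x
  exact h

theorem norm_mollify_sub_le {φ : ContDiffBump (0 : E)} [CompleteSpace F] {g : E → F} {ε : ℝ}
    (hg : Continuous g) (hc : HasCompactSupport g) {x : E}
    (h : ∀ z, dist z x < φ.rOut → dist (g z) (g x) ≤ ε) : ‖mollify μ φ g x - g x‖ ≤ ε := by
  rw [← dist_eq_norm]
  refine φ.dist_normed_convolution_le ?_ fun z hz => h z hz
  borelize F
  exact (hg.stronglyMeasurable_of_hasCompactSupport hc).aestronglyMeasurable

theorem norm_mollify_fderiv_sub_le {φ : ContDiffBump (0 : E)} [CompleteSpace F] {g : E → F} {ε : ℝ}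
    (hg : ContDiff ℝ 1 g) (hc : HasCompactSupport g) {x : E}
    (h : ∀ z, dist z x < φ.rOut → dist (fderiv ℝ g z) (fderiv ℝ g x) ≤ ε) :
    ‖mollify μ φ (fderiv ℝ g) x - fderiv ℝ g x‖ ≤ ε :=
  norm_mollify_sub_le (hg.continuous_fderiv one_ne_zero) (hc.fderiv ℝ) h

/-- Averaging against a nonnegative weight of integral one cannot increase a uniform bound on
translated differences. Mollification therefore preserves Hölder bounds, with the same constant. -/
theorem norm_mollify_sub_mollify_le [CompleteSpace F] (φ : ContDiffBump (0 : E)) {g : E → F}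
    (hg : Continuous g) {B : ℝ} {x y : E}
    (h : ∀ t, ‖g (x - t) - g (y - t)‖ ≤ B) : ‖mollify μ φ g x - mollify μ φ g y‖ ≤ B := by
  have hint : ∀ z, Integrable (fun t => φ.normed μ t • g (z - t)) μ := fun z =>
    (φ.continuous_normed.smul (hg.comp (continuous_const.sub continuous_id))).integrable_of_hasCompactSupport
      φ.hasCompactSupport_normed.smul_right
  have e : mollify μ φ g x - mollify μ φ g y =
      ∫ t, φ.normed μ t • (g (x - t) - g (y - t)) ∂μ := by
    simp only [smul_sub]
    rw [integral_sub (hint x) (hint y)]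
    rfl
  rw [e]
  calc _ ≤ ∫ t, φ.normed μ t * B ∂μ := by
        refine norm_integral_le_of_norm_le ((φ.integrable_normed (μ := μ)).mul_const B)
          (Eventually.of_forall fun t => ?_)
        rw [norm_smul, Real.norm_of_nonneg (φ.nonneg_normed t)]
        exact mul_le_mul_of_nonneg_left (h t) (φ.nonneg_normed t)
    _ = B := by rw [integral_mul_const, φ.integral_normed, one_mul]

end convolution

/-- A compactly supported `C²` function with locally vanishing Hölder quotients of the second
derivative is of class `buc^{2+α}`. -/
theorem memLittleHolder_of_compactSupport (hα₀ : 0 < α) {g : E → ℝ}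
    (hc : HasCompactSupport g) (hg : ∀ x, IsLittleHolderAtTwo α g x) (O : Set E) :
    MemLittleHolder 2 α O g := by
  borelize E
  let μ : Measure E := Measure.addHaar
  have hg2 : ContDiff ℝ 2 g := contDiff_iff_contDiffAt.2 fun x => (hg x).1
  have hg1 : ContDiff ℝ 1 (fderiv ℝ g) := hg2.fderiv_right (by norm_num)
  have hg0 : Continuous (fderiv ℝ (fderiv ℝ g)) := hg1.continuous_fderiv one_ne_zero
  have hc1 := hc.fderiv ℝ
  have unif := fun {ε : ℝ} (hε : 0 < ε) =>
    uniform_of_isLittleHolderAt_fderiv (F := E →L[ℝ] ℝ) hc1 (fun x => (hg x).2) hε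
  have hbuc : MemBUC 2 α O g := by
    obtain ⟨δ, hδ, h⟩ := unif one_pos
    exact memBUC_two_of_compactSupport hα₀ hg2 hc O hδ zero_le_one h
  refine ⟨hbuc, fun β hαβ hβ ε hε => ?_⟩
  have hβ₀ : 0 < β := hα₀.trans hαβ
  obtain ⟨e, he, heε⟩ : ∃ e : ℝ, 0 < e ∧ ENNReal.ofReal (2 * e) < ε := by
    obtain ⟨a, ha0, ha⟩ := ENNReal.lt_iff_exists_nnreal_btwn.1 hε
    have ha0' : (0 : ℝ) < a := by
      have : (0 : NNReal) < a := by exact_mod_cast ha0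
      exact_mod_cast this
    refine ⟨a / 2, by positivity, ?_⟩
    rw [mul_div_cancel₀ _ two_ne_zero, ENNReal.ofReal_coe_nnreal]
    exact ha
  obtain ⟨δ, hδ, hU⟩ := unif (half_pos he)
  -- With second derivatives `κ`-close, points at distance at least `δ` have Hölder quotient at most
  -- `2 κ / δ ^ α ≤ e`. For nearer points no closeness is needed: `g` and its mollification each
  -- have quotient at most `e / 2`.
  obtain ⟨κ, hκ⟩ : ∃ κ, κ = min e (e * δ ^ α / 2) := ⟨_, rfl⟩
  have hδα : 0 < δ ^ α := Real.rpow_pos_of_pos hδ _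
  have hκ0 : 0 < κ := hκ ▸ lt_min he (by positivity)
  obtain ⟨δ0, hδ0, u0⟩ := Metric.uniformContinuous_iff.1
    (hc.uniformContinuous_of_continuous hg2.continuous) κ hκ0
  obtain ⟨δ1, hδ1, u1⟩ := Metric.uniformContinuous_iff.1
    (HasCompactSupport.uniformContinuous_of_continuous (β := E →L[ℝ] ℝ) hc1 hg1.continuous) κ hκ0
  obtain ⟨δ2, hδ2, u2⟩ := Metric.uniformContinuous_iff.1
    (uniformContinuous_fderiv_of_compactSupport (F := E →L[ℝ] ℝ) hc1 hg1) κ hκ0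
  obtain ⟨ρ, hρ, hρ0, hρ1, hρ2⟩ : ∃ ρ, 0 < ρ ∧ ρ ≤ δ0 ∧ ρ ≤ δ1 ∧ ρ ≤ δ2 :=
    ⟨min δ0 (min δ1 δ2), lt_min hδ0 (lt_min hδ1 hδ2), min_le_left _ _,
      (min_le_right _ _).trans (min_le_left _ _), (min_le_right _ _).trans (min_le_right _ _)⟩
  let φ : ContDiffBump (0 : E) := ⟨ρ / 2, ρ, half_pos hρ, half_lt_self hρ⟩
  have hφr : φ.rOut = ρ := rfl
  obtain ⟨u, hu⟩ : ∃ u, u = mollify μ φ g := ⟨_, rfl⟩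
  have du : fderiv ℝ u = mollify μ φ (fderiv ℝ g) := by
    rw [hu]; funext x; exact (hasFDerivAt_mollify φ (hg2.of_le (by norm_num)) hc x).fderiv
  have ddu : fderiv ℝ (fderiv ℝ u) = mollify μ φ (fderiv ℝ (fderiv ℝ g)) := by
    rw [du]; funext x; exact (hasFDerivAt_mollify (F := E →L[ℝ] ℝ) φ hg1 hc1 x).fderiv
  have husm : ContDiff ℝ 3 u := by
    have := φ.hasCompactSupport_normed.contDiff_convolution_left (μ := μ) (n := 3)
      (ContinuousLinearMap.lsmul ℝ ℝ) (φ.contDiff_normed (μ := μ)) (g := g)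
      hg2.continuous.locallyIntegrable
    rw [hu]; exact this
  have huc : HasCompactSupport u := hu ▸
    φ.hasCompactSupport_normed.convolution (μ := μ) (ContinuousLinearMap.lsmul ℝ ℝ) hc
  refine ⟨u, ?_, ?_⟩
  · obtain ⟨C, hC⟩ := exists_lipschitzWith_fderiv_of_compactSupport (F := E →L[ℝ] ℝ) (huc.fderiv ℝ)
      (husm.fderiv_right (by norm_num))
    refine memBUC_two_of_compactSupport hβ₀ (husm.of_le (by norm_num)) huc O one_pos C.2
      fun x y hxy => ?_
    refine (hC.norm_sub_le x y).trans (mul_le_mul_of_nonneg_left ?_ C.2)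
    rcases (norm_nonneg (x - y)).eq_or_lt with h | h
    · rw [← h, Real.zero_rpow hβ₀.ne']
    · calc ‖x - y‖ = ‖x - y‖ ^ (1 : ℝ) := (Real.rpow_one _).symm
        _ ≤ _ := Real.rpow_le_rpow_of_exponent_ge h hxy.le hβ.le
  · have n0 : ∀ x, ‖g x - u x‖ ≤ κ := fun x => by
      rw [norm_sub_rev, hu]
      exact norm_mollify_sub_le hg2.continuous hc fun z hz =>
        (u0 (hz.trans_le hρ0)).le
    have n1 : ∀ x, ‖fderiv ℝ g x - fderiv ℝ u x‖ ≤ κ := fun x => by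
      rw [norm_sub_rev, du]
      exact norm_mollify_sub_le (F := E →L[ℝ] ℝ) hg1.continuous hc1 fun z hz =>
        (u1 (hz.trans_le hρ1)).le
    have n2 : ∀ x, ‖fderiv ℝ (fderiv ℝ g) x - fderiv ℝ (fderiv ℝ u) x‖ ≤ κ := fun x => by
      refine (norm_sub_rev (E := E →L[ℝ] E →L[ℝ] ℝ) _ _).trans_le ?_
      rw [ddu]
      exact norm_mollify_fderiv_sub_le (F := E →L[ℝ] ℝ) hg1 hc1 fun z hz =>
        (u2 (hz.trans_le hρ2)).le
    have d1 : fderiv ℝ (g - u) = fderiv ℝ g - fderiv ℝ u := by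
      funext x
      exact fderiv_sub (hg2.differentiable (by norm_num) x) (husm.differentiable (by norm_num) x)
    have d2 : fderiv ℝ (fderiv ℝ (g - u)) =
        fderiv ℝ (fderiv ℝ g) - fderiv ℝ (fderiv ℝ u) := by
      funext x
      rw [d1]
      exact fderiv_sub (hg1.differentiable one_ne_zero x)
        ((husm.fderiv_right (m := 1) (by norm_num)).differentiable one_ne_zero x)
    have loc : ∀ x y, ‖x - y‖ < δ →
        ‖(fderiv ℝ (fderiv ℝ g) - fderiv ℝ (fderiv ℝ u)) x -
          (fderiv ℝ (fderiv ℝ g) - fderiv ℝ (fderiv ℝ u)) y‖ ≤ e * ‖x - y‖ ^ α := by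
      intro x y hxy
      have m1 := hU x y hxy
      have m2 : ‖fderiv ℝ (fderiv ℝ u) x - fderiv ℝ (fderiv ℝ u) y‖ ≤ e / 2 * ‖x - y‖ ^ α := by
        rw [ddu]
        refine norm_mollify_sub_mollify_le (F := E →L[ℝ] E →L[ℝ] ℝ) φ hg0 fun t => ?_
        have := hU (x - t) (y - t) (by rwa [sub_sub_sub_cancel_right])
        rwa [sub_sub_sub_cancel_right] at this
      simp only [Pi.sub_apply]
      calc _ = ‖(fderiv ℝ (fderiv ℝ g) x - fderiv ℝ (fderiv ℝ g) y) -
            (fderiv ℝ (fderiv ℝ u) x - fderiv ℝ (fderiv ℝ u) y)‖ := by congr 1; abel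
        _ ≤ e / 2 * ‖x - y‖ ^ α + e / 2 * ‖x - y‖ ^ α :=
          (norm_sub_le (E := E →L[ℝ] E →L[ℝ] ℝ) _ _).trans (add_le_add m1 m2)
        _ = _ := by ring
    have glob := norm_sub_le_of_local_bound (F := E →L[ℝ] E →L[ℝ] ℝ) hα₀ hδ he.le n2 loc
    have hmax : max e (2 * κ / δ ^ α) ≤ e := by
      refine max_le le_rfl ?_
      rw [div_le_iff₀ hδα]
      have : κ ≤ e * δ ^ α / 2 := hκ ▸ min_le_right _ _
      linarith
    have hκe : κ ≤ e := hκ ▸ min_le_left _ _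
    refine (holderNorm_two_le (f := g - u) he.le hα₀ (fun x _ => (n0 x).trans hκe) (fun x _ => ?_)
      (fun x _ => ?_) fun x _ y _ => ?_).trans_lt heε
    · rw [d1]; exact (n1 x).trans hκe
    · rw [d2]; exact (n2 x).trans hκe
    · rw [d2]; exact (glob x y).trans (by gcongr)

/-- A cut-off equal to one on the smaller ball reduces this to the compactly supported case. -/
theorem exists_memLittleHolder_ball (hα₀ : 0 < α) (hα₁ : α < 1) {f : E → ℝ} {y : E}
    (hf : ∀ᶠ x in 𝓝 y, IsLittleHolderAtTwo α f x) :
    ∃ r > 0, MemLittleHolder 2 α (ball y r) f := by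
  obtain ⟨r, hr, h⟩ := Metric.eventually_nhds_iff_ball.1 hf
  let χ : ContDiffBump y := ⟨r / 4, r / 2, by positivity, by linarith⟩
  have hg : ∀ x, IsLittleHolderAtTwo α (fun x => χ x * f x) x := by
    intro x
    by_cases hx : x ∈ ball y r
    · exact ((χ.contDiff (n := 3)).contDiffAt.isLittleHolderAtTwo hα₀ hα₁).mul hα₀ hα₁ (h x hx)
    · have hx' : x ∉ tsupport χ := by
        rw [χ.tsupport_eq]
        intro hm
        exact hx (closedBall_subset_ball (half_lt_self hr) hm)
      have e : (fun x => χ x * f x) =ᶠ[𝓝 x] fun _ => 0 := by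
        filter_upwards [(isClosed_tsupport χ).isOpen_compl.mem_nhds hx'] with z hz
        rw [image_eq_zero_of_notMem_tsupport hz, zero_mul]
      exact (contDiffAt_const.isLittleHolderAtTwo hα₀ hα₁).congr_of_eventuallyEq e
  have hc : HasCompactSupport fun x => χ x * f x := χ.hasCompactSupport.mul_right
  refine ⟨r / 4, by positivity, MemLittleHolder.congr isOpen_ball (fun x hx => ?_)
    (memLittleHolder_of_compactSupport hα₀ hc hg (ball y (r / 4)))⟩
  have : χ x = 1 := χ.one_of_mem_closedBall (ball_subset_closedBall hx)
  simp [this]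

end mollification

/-! ### Coordinates along a family of curves issuing from a compact level set -/

section coordinates

variable {E : Type*} [NormedAddCommGroup E] [NormedSpace ℝ E]

/-- The map `X` restricted to `Γ × ℝ` has a local inverse of class `C¹` near `(y, 0)`. -/
def HasLocalCoordinates (Γ : Set E) (X : E × ℝ → E) (y : E) : Prop :=
  ∃ ε : ℝ, 0 < ε ∧ ∃ G : E → E × ℝ, ∀ q : E × ℝ, q.1 ∈ Γ → q.1 ∈ ball y ε → |q.2| < ε →
    G (X q) = q ∧ ContDiffAt ℝ 1 G (X q) ∧ ∀ᶠ z in 𝓝 (X q), (G z).1 ∈ Γ ∧ X (G z) = z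

/-- The differential of `(x, r) ↦ (X(x, r), F(x))` at a point where `X` is transversal to the level
set of `F`. -/
noncomputable def transversalEquiv (L : E →L[ℝ] ℝ) (w : E) (hw : L w ≠ 0) : (E × ℝ) ≃L[ℝ] (E × ℝ) :=
  ContinuousLinearEquiv.equivOfInverse
    ((ContinuousLinearMap.fst ℝ E ℝ + (ContinuousLinearMap.snd ℝ E ℝ).smulRight w).prod
      (L.comp (ContinuousLinearMap.fst ℝ E ℝ)))
    (((ContinuousLinearMap.fst ℝ E ℝ) -
      ((L w)⁻¹ • (L.comp (ContinuousLinearMap.fst ℝ E ℝ) - ContinuousLinearMap.snd ℝ E ℝ)).smulRight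
        w).prod ((L w)⁻¹ • (L.comp (ContinuousLinearMap.fst ℝ E ℝ) - ContinuousLinearMap.snd ℝ E ℝ)))
    (fun q => by
      have h : (L w)⁻¹ * (q.2 * L w) = q.2 := by field_simp
      ext <;> simp [h])
    (fun q => by
      have h : (L w)⁻¹ * (L q.1 - q.2) * L w = L q.1 - q.2 := by field_simp
      ext <;> simp [h])

/-- The inverse function theorem needs a map on an open set, so `F` is added as a second component:
`Ψ(x, r) = (X'(x, r), F(x))`. Transversality makes `Ψ'(y, 0)` invertible, and `z ↦ Ψ⁻¹(z, 0)` lands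
on `Γ × ℝ`. The auxiliary `X'` need only agree with `X` over `Γ`, which allows for a normal field
that is regular along `Γ` only. -/
theorem hasLocalCoordinates_of_transversal [CompleteSpace E] {Γ : Set E} {X X' : E × ℝ → E}
    {y w : E} {F : E → ℝ} {r : ℝ} (hy : y ∈ Γ) (hr : 0 < r)
    (hF : ContDiffAt ℝ 1 F y) (hΓ : Γ ∩ ball y r = {x ∈ ball y r | F x = 0})
    (hX : ContDiffAt ℝ 1 X' (y, 0)) (hX0 : ∀ x, X' (x, 0) = x)
    (hXd : HasDerivAt (fun s : ℝ => X' (y, s)) w 0) (hw : fderiv ℝ F y w ≠ 0)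
    (hXX' : ∀ q : E × ℝ, q.1 ∈ Γ → q.1 ∈ ball y r → X q = X' q) :
    HasLocalCoordinates Γ X y := by
  have hFΓ : ∀ x ∈ ball y r, x ∈ Γ ↔ F x = 0 := fun x hx =>
    ⟨fun h => (hΓ.le ⟨h, hx⟩).2, fun h => (hΓ.ge ⟨hx, h⟩).1⟩
  have hy0 : F y = 0 := (hFΓ y (mem_ball_self hr)).1 hy
  let Ψ : E × ℝ → E × ℝ := fun q => (X' q, F q.1)
  have hF' : ContDiffAt ℝ 1 (fun q : E × ℝ => F q.1) (y, 0) :=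
    ContDiffAt.comp (y, (0 : ℝ)) hF contDiffAt_fst
  have hΨ : ContDiffAt ℝ 1 Ψ (y, 0) := hX.prodMk hF'
  have hΨ0 : Ψ (y, 0) = (y, 0) := by simp [Ψ, hX0, hy0]
  have dX : HasFDerivAt X' (ContinuousLinearMap.fst ℝ E ℝ +
      (ContinuousLinearMap.snd ℝ E ℝ).smulRight w) (y, 0) := by
    have h := (hX.differentiableAt one_ne_zero).hasFDerivAt
    have h1 : (fderiv ℝ X' (y, 0)).comp (.inl ℝ E ℝ) = .id ℝ E := by
      have h0 : HasFDerivAt (fun x : E => (x, (0 : ℝ))) (.inl ℝ E ℝ) y :=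
        hasFDerivAt_prodMk_left y 0
      have h2 := HasFDerivAt.comp y h h0
      have h3 : (X' ∘ fun x => (x, (0 : ℝ))) = id := funext hX0
      rw [h3] at h2
      exact h2.unique (hasFDerivAt_id y)
    have h4 : fderiv ℝ X' (y, 0) (0, 1) = w := by
      have h5 : HasDerivAt (fun s : ℝ => (y, s)) ((0 : E), (1 : ℝ)) 0 :=
        (hasDerivAt_const _ _).prodMk (hasDerivAt_id _)
      exact (h.comp_hasDerivAt (0 : ℝ) h5).unique hXd
    have e : fderiv ℝ X' (y, 0) = ContinuousLinearMap.fst ℝ E ℝ +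
        (ContinuousLinearMap.snd ℝ E ℝ).smulRight w := by
      refine ContinuousLinearMap.ext fun q => ?_
      have h6 : q = (q.1, 0) + q.2 • ((0 : E), (1 : ℝ)) := by ext <;> simp
      have h7 : fderiv ℝ X' (y, 0) (q.1, 0) = q.1 := DFunLike.congr_fun h1 q.1
      conv_lhs => rw [h6, map_add, map_smul, h7, h4]
      simp
    rwa [e] at h
  have dΨ : HasFDerivAt Ψ (transversalEquiv (fderiv ℝ F y) w hw : E × ℝ →L[ℝ] E × ℝ) (y, 0) := by
    have h1 : HasFDerivAt (fun q : E × ℝ => F q.1)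
        ((fderiv ℝ F y).comp (ContinuousLinearMap.fst ℝ E ℝ)) (y, 0) :=
      HasFDerivAt.comp (y, (0 : ℝ)) (g := F) (hF.differentiableAt one_ne_zero).hasFDerivAt
        hasFDerivAt_fst
    exact dX.prodMk h1
  let e := hΨ.toOpenPartialHomeomorph Ψ dΨ one_ne_zero
  have hes : (y, (0 : ℝ)) ∈ e.source := hΨ.mem_toOpenPartialHomeomorph_source dΨ one_ne_zero
  have heΨ : ∀ q, e q = Ψ q := fun q => rfl
  have hsymm : ContDiffAt ℝ 1 e.symm (Ψ (y, 0)) := hΨ.to_localInverse dΨ one_ne_zero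
  have hev1 : ∀ᶠ q in 𝓝 (y, (0 : ℝ)), ContDiffAt ℝ 1 e.symm (Ψ q) :=
    hΨ.continuousAt.eventually (hsymm.eventually (by simp))
  have hev2 : ∀ᶠ q : E × ℝ in 𝓝 (y, (0 : ℝ)), q.1 ∈ ball y r :=
    continuousAt_fst.eventually (ball_mem_nhds y hr)
  have hev := (hev1.and hev2).and (e.open_source.mem_nhds hes)
  obtain ⟨ε, hε, H⟩ := Metric.eventually_nhds_iff.1 hev
  refine ⟨ε, hε, fun z => e.symm (z, 0), fun q hqΓ hqy hqε => ?_⟩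
  have hqd : dist q (y, 0) < ε := by
    rw [Prod.dist_eq, max_lt_iff]
    exact ⟨hqy, by simpa using hqε⟩
  obtain ⟨⟨h1, h2⟩, h3⟩ := H hqd
  have hΨq : Ψ q = (X q, 0) := by
    simp only [Ψ]
    rw [hXX' q hqΓ h2, (hFΓ _ h2).1 hqΓ]
  have hG : e.symm (X q, 0) = q := by rw [← hΨq, ← heΨ]; exact e.left_inv h3
  refine ⟨hG, ?_, ?_⟩
  · rw [hΨq] at h1
    exact ContDiffAt.comp (X q) h1 (contDiffAt_id.prodMk contDiffAt_const)
  · have ht : (X q, (0 : ℝ)) ∈ e.target := by rw [← hΨq, ← heΨ]; exact e.map_source h3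
    have c1 : ContinuousAt (fun z : E => (z, (0 : ℝ))) (X q) :=
      continuousAt_id.prodMk continuousAt_const
    have c2 : ContinuousAt (fun z : E => e.symm (z, 0)) (X q) :=
      ContinuousAt.comp (f := fun z : E => (z, (0 : ℝ))) (e.continuousAt_symm ht) c1
    have c3 : ContinuousAt (fun z : E => (e.symm (z, 0)).1) (X q) := c2.fst
    have h4 : ∀ᶠ z in 𝓝 (X q), (e.symm (z, 0)).1 ∈ ball y r := by
      refine c3.eventually (isOpen_ball.mem_nhds ?_)
      change (e.symm (X q, 0)).1 ∈ ball y r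
      rw [hG]; exact h2
    filter_upwards [h4, c1.eventually (e.open_target.mem_nhds ht)] with z hz hzt
    have h5 : Ψ (e.symm (z, 0)) = (z, 0) := e.right_inv hzt
    have h6 : (e.symm (z, 0)).1 ∈ Γ := (hFΓ _ hz).2 (congrArg Prod.snd h5)
    exact ⟨h6, (hXX' _ h6 hz).trans (congrArg Prod.fst h5)⟩

/-- Local coordinates along a compact set fit together to global ones. -/
theorem exists_global_coordinates {Γ : Set E} (hΓ : IsCompact Γ) {X : E × ℝ → E}
    (hX : ∀ y ∈ Γ, HasLocalCoordinates Γ X y) {M : ℝ}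
    (hM : ∀ y ∈ Γ, ∀ r : ℝ, dist (X (y, r)) y ≤ M * |r|) :
    ∃ r₀ : ℝ, 0 < r₀ ∧ InjOn X (Γ ×ˢ Ioo (-r₀) r₀) ∧ IsOpen (X '' (Γ ×ˢ Ioo (-r₀) r₀)) ∧
      ∃ P : E → E × ℝ, (∀ q ∈ Γ ×ˢ Ioo (-r₀) r₀, P (X q) = q) ∧
        ContDiffOn ℝ 1 P (X '' (Γ ×ˢ Ioo (-r₀) r₀)) := by
  choose! ε hε G hG using hX
  obtain ⟨t, ht, hcov⟩ := hΓ.elim_nhds_subcover (fun y => ball y (ε y / 2))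
    fun y hy => ball_mem_nhds y (half_pos (hε y hy))
  -- If two points of the strip have the same image, their base points are at most `2 * M * r₀`
  -- apart. The condition below half the radius puts both base points into one ball, where the local
  -- inverse separates them.
  have hlim : ∀ᶠ r : ℝ in 𝓝[>] 0, ∀ y ∈ t, r < ε y ∧ 2 * M * r < ε y / 2 := by
    refine (Filter.eventually_all_finset t).2 fun y hy => ?_
    have h1 : ∀ᶠ r : ℝ in 𝓝 0, r < ε y := gt_mem_nhds (hε y (ht y hy))
    have h2 : ∀ᶠ r : ℝ in 𝓝 0, 2 * M * r < ε y / 2 := by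
      have : Tendsto (fun r : ℝ => 2 * M * r) (𝓝 0) (𝓝 0) := by
        simpa using (continuous_const.mul continuous_id).tendsto (0 : ℝ) (f := fun r : ℝ => 2 * M * r)
      exact this.eventually (gt_mem_nhds (half_pos (hε y (ht y hy))))
    exact (h1.and h2).filter_mono nhdsWithin_le_nhds
  obtain ⟨r₀, hr, hr₀⟩ := (hlim.and self_mem_nhdsWithin).exists
  have hr₀ : 0 < r₀ := hr₀
  have hS : ∀ q ∈ Γ ×ˢ Ioo (-r₀) r₀, ∃ y ∈ t, q.1 ∈ ball y (ε y / 2) ∧ q.1 ∈ ball y (ε y) ∧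
      |q.2| < ε y := by
    intro q hq
    obtain ⟨y, hy, hqy⟩ := mem_iUnion₂.1 (hcov hq.1)
    exact ⟨y, hy, hqy, ball_subset_ball (by linarith [hε y (ht y hy)]) hqy,
      (abs_lt.2 hq.2).trans (hr y hy).1⟩
  have hinj : InjOn X (Γ ×ˢ Ioo (-r₀) r₀) := by
    intro q hq q' hq' hqq'
    obtain ⟨y, hy, h1, h2, h3⟩ := hS q hq
    have hM0 : 0 ≤ M * r₀ := by
      have := (dist_nonneg).trans (hM q.1 hq.1 r₀)
      rwa [abs_of_pos hr₀] at this
    have hM' : 0 ≤ M := nonneg_of_mul_nonneg_left hM0 hr₀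
    have hb : ∀ p ∈ Γ ×ˢ Ioo (-r₀) r₀, dist (X p) p.1 ≤ M * r₀ := fun p hp =>
      (hM p.1 hp.1 p.2).trans (mul_le_mul_of_nonneg_left (abs_lt.2 hp.2).le hM')
    have hd : dist q'.1 q.1 ≤ 2 * M * r₀ := by
      have h4 := dist_triangle_left q'.1 q.1 (X q)
      have h5 := hb q hq
      have h6 := hb q' hq'
      rw [← hqq'] at h6
      linarith
    have h7 : q'.1 ∈ ball y (ε y) := by
      have h8 := dist_triangle q'.1 q.1 y
      have h9 : dist q.1 y < ε y / 2 := h1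
      have := (hr y hy).2
      rw [mem_ball]; linarith
    have e1 := (hG y (ht y hy) q hq.1 h2 h3).1
    have e2 := (hG y (ht y hy) q' hq'.1 h7 ((abs_lt.2 hq'.2).trans (hr y hy).1)).1
    rw [← e1, ← e2, hqq']
  -- By continuity the local inverse keeps the height in `(-r₀, r₀)`. This yields the open image,
  -- and injectivity then identifies the global inverse with `G` near `X q`.
  have hloc : ∀ q ∈ Γ ×ˢ Ioo (-r₀) r₀, ∃ G : E → E × ℝ, ContDiffAt ℝ 1 G (X q) ∧
      ∀ᶠ z in 𝓝 (X q), G z ∈ Γ ×ˢ Ioo (-r₀) r₀ ∧ X (G z) = z := by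
    intro q hq
    obtain ⟨y, hy, -, h2, h3⟩ := hS q hq
    obtain ⟨e1, e2, e3⟩ := hG y (ht y hy) q hq.1 h2 h3
    refine ⟨G y, e2, ?_⟩
    have h4 : ∀ᶠ z in 𝓝 (X q), (G y z).2 ∈ Ioo (-r₀) r₀ := by
      refine e2.continuousAt.snd.eventually (isOpen_Ioo.mem_nhds ?_)
      change (G y (X q)).2 ∈ Ioo (-r₀) r₀
      rw [e1]; exact hq.2
    filter_upwards [e3, h4] with z hz hz'
    exact ⟨⟨hz.1, hz'⟩, hz.2⟩
  refine ⟨r₀, hr₀, hinj, ?_, ?_⟩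
  · refine isOpen_iff_mem_nhds.2 ?_
    rintro _ ⟨q, hq, rfl⟩
    obtain ⟨G, -, h⟩ := hloc q hq
    filter_upwards [h] with z hz
    exact ⟨G z, hz.1, hz.2⟩
  · rcases isEmpty_or_nonempty (E × ℝ) with hE | hE
    · exact (hE.false (0, 0)).elim
    refine ⟨Function.invFunOn X (Γ ×ˢ Ioo (-r₀) r₀), fun q hq => hinj.leftInvOn_invFunOn hq, ?_⟩
    rintro _ ⟨q, hq, rfl⟩
    obtain ⟨G, hG, h⟩ := hloc q hq
    refine (hG.congr_of_eventuallyEq ?_).contDiffWithinAt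
    filter_upwards [h] with z hz
    conv_lhs => rw [← hz.2]
    exact hinj.leftInvOn_invFunOn hz.1

end coordinates

/-! ### Normal fields and tubular neighborhoods -/

section tubular

variable {n : ℕ} {Γ : Set (EuclideanSpace ℝ (Fin n))}
  {ν : EuclideanSpace ℝ (Fin n) → EuclideanSpace ℝ (Fin n)} {y : EuclideanSpace ℝ (Fin n)}
  {F : EuclideanSpace ℝ (Fin n) → ℝ} {r : ℝ}

theorem fderiv_apply_ne_zero_exists {E : Type*} [NormedAddCommGroup E] [NormedSpace ℝ E]
    {L : E →L[ℝ] ℝ} (hL : L ≠ 0) : ∃ w, L w ≠ 0 := by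
  by_contra! h
  exact hL (ContinuousLinearMap.ext h)

/-- The kernel of the differential of a defining function is contained in the tangent cone. -/
theorem mem_tangentConeAt_of_fderiv_eq_zero (hy : y ∈ Γ) (hr : 0 < r) (hF : ContDiffAt ℝ 1 F y)
    (hF0 : fderiv ℝ F y ≠ 0) (hΓ : Γ ∩ ball y r = {x ∈ ball y r | F x = 0})
    {ξ : EuclideanSpace ℝ (Fin n)} (hξ : fderiv ℝ F y ξ = 0) : ξ ∈ tangentConeAt ℝ Γ y := by
  obtain ⟨w, hw⟩ := fderiv_apply_ne_zero_exists hF0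
  let X : EuclideanSpace ℝ (Fin n) × ℝ → EuclideanSpace ℝ (Fin n) := fun q => q.1 + q.2 • w
  have hX : ContDiff ℝ 1 X := contDiff_fst.add (contDiff_snd.smul contDiff_const)
  have hXd : HasDerivAt (fun s : ℝ => X (y, s)) w 0 := by
    simpa [X] using ((hasDerivAt_id (0 : ℝ)).smul_const w).const_add y
  obtain ⟨ε, hε, G, hG⟩ := hasLocalCoordinates_of_transversal hy hr hF hΓ hX.contDiffAt
    (by simp [X]) hXd hw fun _ _ _ => rfl
  obtain ⟨e1, e2, e3⟩ := hG (y, 0) hy (mem_ball_self hε) (by simpa using hε)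
  have hXy : X (y, 0) = y := by simp [X]
  rw [hXy] at e1 e2 e3
  have hGy : (G y).1 = y := by rw [e1]
  have dG := (e2.differentiableAt one_ne_zero).hasFDerivAt
  set D := fderiv ℝ G y with hD
  have d1 : HasFDerivAt (fun z => (G z).1) ((ContinuousLinearMap.fst ℝ _ ℝ).comp D) y := dG.fst
  have d2 : HasFDerivAt (fun z => (G z).2) ((ContinuousLinearMap.snd ℝ _ ℝ).comp D) y := dG.snd
  have r1 : (D ξ).1 + (D ξ).2 • w = ξ := by
    have h1 : HasFDerivAt (fun z => (G z).1 + (G z).2 • w) _ y := d1.add (d2.smul_const w)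
    have h2 : (fun z => (G z).1 + (G z).2 • w) =ᶠ[𝓝 y] id := by
      filter_upwards [e3] with z hz using hz.2
    have h3 := (h1.congr_of_eventuallyEq h2.symm).unique (hasFDerivAt_id y)
    simpa using DFunLike.congr_fun h3 ξ
  have r2 : fderiv ℝ F y (D ξ).1 = 0 := by
    have h0 : HasFDerivAt F (fderiv ℝ F y) ((G y).1) := by
      rw [hGy]; exact (hF.differentiableAt one_ne_zero).hasFDerivAt
    have h1 : HasFDerivAt (fun z => F (G z).1) _ y := h0.comp y d1
    have h2 : (fun z => F (G z).1) =ᶠ[𝓝 y] fun _ => 0 := by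
      have h4 : ∀ᶠ z in 𝓝 y, (G z).1 ∈ ball y r := by
        refine d1.continuousAt.eventually (isOpen_ball.mem_nhds ?_)
        change (G y).1 ∈ ball y r
        rw [hGy]; exact mem_ball_self hr
      filter_upwards [e3, h4] with z hz hz'
      exact (hΓ.le ⟨hz.1, hz'⟩).2
    have h3 := (h1.congr_of_eventuallyEq h2.symm).unique (hasFDerivAt_const _ y)
    simpa using DFunLike.congr_fun h3 ξ
  have r3 : (D ξ).2 = 0 := by
    have := congrArg (fderiv ℝ F y) r1
    rw [map_add, map_smul, r2, hξ, zero_add, smul_eq_mul, mul_eq_zero] at this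
    exact this.resolve_right hw
  rw [r3, zero_smul, add_zero] at r1
  -- The map `z ↦ (G z).1` sends `U` into `Γ` and its derivative at `y` now fixes `ξ`. Every vector
  -- is tangent to the neighborhood `U` at `y`, so pushing `ξ` forward gives a tangent vector of
  -- `Γ`.
  let U : Set (EuclideanSpace ℝ (Fin n)) := {z | (G z).1 ∈ Γ ∧ X (G z) = z}
  have hU : U ∈ 𝓝 y := e3
  have h5 := (d1.hasFDerivWithinAt (s := U)).mapsTo_tangent_cone
    (show ξ ∈ tangentConeAt ℝ U y by rw [tangentConeAt_of_mem_nhds hU]; trivial)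
  have h6 : (fun z => (G z).1) '' U ⊆ Γ := by
    rintro _ ⟨z, hz, rfl⟩; exact hz.1
  have h7 := tangentConeAt_mono (𝕜 := ℝ) h6 h5
  simpa [r1, hGy] using h7

/-- Otherwise `ν y` would lie in the kernel of `F'(y)`, hence be tangent to `Γ`, hence be orthogonal
to itself. -/
theorem IsUnitNormalField.fderiv_normal_ne_zero (hν : IsUnitNormalField Γ ν) (hy : y ∈ Γ)
    (hr : 0 < r) (hF : ContDiffAt ℝ 1 F y) (hF0 : fderiv ℝ F y ≠ 0)
    (hΓ : Γ ∩ ball y r = {x ∈ ball y r | F x = 0}) : fderiv ℝ F y (ν y) ≠ 0 := by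
  intro h
  have h1 := (hν.2 y hy).2 _ (Submodule.subset_span
    (mem_tangentConeAt_of_fderiv_eq_zero hy hr hF hF0 hΓ h))
  rw [real_inner_self_eq_norm_sq, (hν.2 y hy).1] at h1
  norm_num at h1

/-- The differential of a defining function is a multiple of the normal. -/
theorem IsUnitNormalField.fderiv_apply_eq (hν : IsUnitNormalField Γ ν) (hy : y ∈ Γ)
    (hr : 0 < r) (hF : ContDiffAt ℝ 1 F y) (hF0 : fderiv ℝ F y ≠ 0)
    (hΓ : Γ ∩ ball y r = {x ∈ ball y r | F x = 0}) (u : EuclideanSpace ℝ (Fin n)) :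
    fderiv ℝ F y u = fderiv ℝ F y (ν y) * inner ℝ (ν y) u := by
  have h0 := hν.fderiv_normal_ne_zero hy hr hF hF0 hΓ
  set c := fderiv ℝ F y u / fderiv ℝ F y (ν y) with hc
  have h1 : fderiv ℝ F y (u - c • ν y) = 0 := by
    rw [map_sub, map_smul, smul_eq_mul, hc, div_mul_cancel₀ _ h0, sub_self]
  have h2 := (hν.2 y hy).2 _ (Submodule.subset_span
    (mem_tangentConeAt_of_fderiv_eq_zero hy hr hF hF0 hΓ h1))
  rw [inner_sub_right, inner_smul_right, real_inner_self_eq_norm_sq, (hν.2 y hy).1, one_pow,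
    mul_one, sub_eq_zero] at h2
  rw [h2, hc, mul_div_cancel₀ _ h0]

theorem exists_smaller_ball {E : Type*} [SeminormedAddCommGroup E] {y x : E} {r : ℝ}
    (hx : x ∈ ball y r) : ∃ s > 0, ball x s ⊆ ball y r := by
  exact Metric.isOpen_iff.1 isOpen_ball x hx

theorem inter_ball_eq_of_subset {E : Type*} [SeminormedAddCommGroup E] {Γ : Set E} {F : E → ℝ}
    {y x : E} {r s : ℝ} (hs : ball x s ⊆ ball y r)
    (hΓ : Γ ∩ ball y r = {x ∈ ball y r | F x = 0}) :
    Γ ∩ ball x s = {z ∈ ball x s | F z = 0} := by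
  ext z
  exact ⟨fun h => ⟨h.2, (hΓ.le ⟨h.1, hs h.2⟩).2⟩, fun h => ⟨(hΓ.ge ⟨hs h.1, h.2⟩).1, h.1⟩⟩

/-- A unit normal field of a hypersurface of class `C²` is locally the restriction of a vector field
of class `C¹`. -/
theorem IsUnitNormalField.exists_contDiffOn_extension (hν : IsUnitNormalField Γ ν) (hy : y ∈ Γ)
    (hr : 0 < r) (hF : ContDiffOn ℝ 2 F (ball y r)) (hF0 : ∀ x ∈ ball y r, fderiv ℝ F x ≠ 0)
    (hΓ : Γ ∩ ball y r = {x ∈ ball y r | F x = 0}) :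
    ∃ s, 0 < s ∧ s ≤ r ∧ ∃ N : EuclideanSpace ℝ (Fin n) → EuclideanSpace ℝ (Fin n),
      ContDiffOn ℝ 1 N (ball y s) ∧ ∀ x ∈ Γ, x ∈ ball y s → ν x = N x := by
  have hF1 : ∀ x ∈ ball y r, ContDiffAt ℝ 1 F x := fun x hx =>
    (hF.contDiffAt (isOpen_ball.mem_nhds hx)).of_le (by norm_num)
  let g : EuclideanSpace ℝ (Fin n) → EuclideanSpace ℝ (Fin n) := fun x =>
    (InnerProductSpace.toDual ℝ (EuclideanSpace ℝ (Fin n))).symm (fderiv ℝ F x)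
  have hg : ∀ x u, inner ℝ (g x) u = fderiv ℝ F x u := fun x u =>
    InnerProductSpace.toDual_symm_apply
  have hgc : ContDiffOn ℝ 1 g (ball y r) := by
    have h1 : ContDiffOn ℝ 1 (fderiv ℝ F) (ball y r) :=
      hF.fderiv_of_isOpen isOpen_ball (by norm_num)
    exact ((InnerProductSpace.toDual ℝ
      (EuclideanSpace ℝ (Fin n))).symm.toContinuousLinearEquiv.contDiff.comp_contDiffOn h1)
  have hgn : ∀ x ∈ ball y r, g x ≠ 0 := fun x hx h => by
    apply hF0 x hx
    ext u
    rw [← hg, h, inner_zero_left]; rfl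
  have hgν : ∀ x ∈ Γ, x ∈ ball y r → g x = fderiv ℝ F x (ν x) • ν x := by
    intro x hx hxr
    obtain ⟨s, hs, hsr⟩ := exists_smaller_ball hxr
    refine ext_inner_right ℝ fun u => ?_
    rw [hg, inner_smul_left, hν.fderiv_apply_eq hx hs (hF1 x hxr) (hF0 x hxr)
      (inter_ball_eq_of_subset hsr hΓ) u]
    rfl
  have hyr := mem_ball_self (x := y) hr
  have hcy : fderiv ℝ F y (ν y) ≠ 0 := fun h => hgn y hyr (by rw [hgν y hy hyr, h, zero_smul])
  -- The normalized gradient is `ν` or `-ν`. Continuity of `ν` along `Γ` keeps the sign constant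
  -- near `y`, so the sign at `y` selects the right one.
  let σ : ℝ := SignType.sign (fderiv ℝ F y (ν y))
  have hcont : ContinuousWithinAt (fun x => fderiv ℝ F x (ν x) * fderiv ℝ F y (ν y)) (Γ ∩ ball y r)
      y := by
    have h1 : ContinuousAt (fderiv ℝ F) y := (hF1 y hyr).continuousAt_fderiv one_ne_zero
    exact (h1.continuousWithinAt.clm_apply ((hν.1 y hy).mono inter_subset_left)).mul_const _
  have hpos : ∀ᶠ x in 𝓝[Γ ∩ ball y r] y, 0 < fderiv ℝ F x (ν x) * fderiv ℝ F y (ν y) := by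
    refine hcont.eventually (lt_mem_nhds ?_)
    exact mul_self_pos.2 hcy
  obtain ⟨s, hs, hsub⟩ := Metric.mem_nhdsWithin_iff.1 hpos
  refine ⟨min s r, lt_min hs hr, min_le_right _ _, fun x => (σ * ‖g x‖⁻¹) • g x, ?_, ?_⟩
  · have hsr : ball y (min s r) ⊆ ball y r := ball_subset_ball (min_le_right _ _)
    have hg' := hgc.mono hsr
    have h1 : ContDiffOn ℝ 1 (fun x => σ * ‖g x‖⁻¹) (ball y (min s r)) := by
      refine contDiffOn_const.mul ?_
      exact (hg'.norm ℝ fun x hx => hgn x (hsr hx)).inv fun x hx =>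
        norm_ne_zero_iff.2 (hgn x (hsr hx))
    exact h1.smul hg'
  · intro x hx hxs
    have hxr : x ∈ ball y r := ball_subset_ball (min_le_right _ _) hxs
    have h1 : 0 < fderiv ℝ F x (ν x) * fderiv ℝ F y (ν y) :=
      hsub ⟨ball_subset_ball (min_le_left _ _) hxs, hx, hxr⟩
    have hcx : fderiv ℝ F x (ν x) ≠ 0 := fun h => by simp [h] at h1
    have hn : ‖g x‖ = |fderiv ℝ F x (ν x)| := by
      rw [hgν x hx hxr, norm_smul, (hν.2 x hx).1, mul_one, Real.norm_eq_abs]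
    have hσ : σ * |fderiv ℝ F x (ν x)| = fderiv ℝ F x (ν x) := by
      rcases lt_or_gt_of_ne hcy with h | h
      · have h2 : fderiv ℝ F x (ν x) < 0 := by nlinarith
        have : σ = -1 := by simp [σ, sign_neg h]
        rw [this, abs_of_neg h2]; ring
      · have h2 : 0 < fderiv ℝ F x (ν x) := by nlinarith
        have : σ = 1 := by simp [σ, sign_pos h]
        rw [this, abs_of_pos h2]; ring
    have hσ2 : σ * |fderiv ℝ F x (ν x)|⁻¹ * fderiv ℝ F x (ν x) = 1 := by
      have h3 : |fderiv ℝ F x (ν x)| ≠ 0 := abs_ne_zero.2 hcx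
      have hσσ : σ * σ = 1 := by
        rcases lt_or_gt_of_ne hcy with h | h
        · simp [σ, sign_neg h]
        · simp [σ, sign_pos h]
      conv_lhs => rw [← hσ]
      rw [abs_mul, abs_abs]
      have hσa : |σ| = 1 := by
        have := congrArg abs hσσ
        rw [abs_mul, abs_one] at this
        nlinarith [abs_nonneg σ]
      rw [hσa, one_mul]
      field_simp
      nlinarith
    change ν x = (σ * ‖g x‖⁻¹) • g x
    rw [hn]
    conv_rhs => rw [hgν x hx hxr]
    rw [smul_smul, hσ2, one_smul]

variable {α : ℝ}

/-- The normal field has local coordinates. -/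
theorem hasLocalCoordinates_normal (hΓ : Γ ∈ hypersurfaces n 2 α) (hν : IsUnitNormalField Γ ν)
    (hy : y ∈ Γ) :
    HasLocalCoordinates Γ (fun q => q.1 + q.2 • ν q.1) y := by
  obtain ⟨r, hr, F, hF, hF0, hFΓ⟩ := hΓ.2.2.2 y hy
  obtain ⟨s, hs, hsr, N, hN, hνN⟩ := hν.exists_contDiffOn_extension hy hr hF.1.1 hF0 hFΓ
  have hys := mem_ball_self (x := y) hs
  have hyr := mem_ball_self (x := y) hr
  have hF1 : ContDiffAt ℝ 1 F y :=
    (hF.1.1.contDiffAt (isOpen_ball.mem_nhds hyr)).of_le (by norm_num)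
  refine hasLocalCoordinates_of_transversal (X' := fun q => q.1 + q.2 • N q.1) (w := ν y) hy hs hF1
    (inter_ball_eq_of_subset (ball_subset_ball hsr) hFΓ) ?_ (by simp) ?_
    (hν.fderiv_normal_ne_zero hy hr hF1 (hF0 y hyr) hFΓ) ?_
  · have h1 : ContDiffAt ℝ 1 N y := hN.contDiffAt (isOpen_ball.mem_nhds hys)
    exact contDiffAt_fst.add (contDiffAt_snd.smul
      (ContDiffAt.comp (y, (0 : ℝ)) h1 contDiffAt_fst))
  · rw [hνN y hy hys]
    simpa using ((hasDerivAt_id (0 : ℝ)).smul_const (N y)).const_add y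
  · intro q hq hqs
    simp only [hνN q.1 hq hqs]

/-- The vector from a nearest point of a hypersurface is normal. -/
theorem sub_eq_smul_normal_of_nearest (hΓ : Γ ∈ hypersurfaces n 2 α) (hν : IsUnitNormalField Γ ν)
    (hy : y ∈ Γ) {x : EuclideanSpace ℝ (Fin n)} (hmin : ∀ z ∈ Γ, dist x y ≤ dist x z) :
    ∃ c : ℝ, x - y = c • ν y ∧ |c| = dist x y := by
  obtain ⟨r, hr, F, hF, hF0, hFΓ⟩ := hΓ.2.2.2 y hy
  have hyr := mem_ball_self (x := y) hr
  have hF1 : ContDiffAt ℝ 1 F y :=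
    (hF.1.1.contDiffAt (isOpen_ball.mem_nhds hyr)).of_le (by norm_num)
  have hFy : F y = 0 := (hFΓ.le ⟨hy, hyr⟩).2
  let φ : EuclideanSpace ℝ (Fin n) → ℝ := fun z => ‖z - x‖ ^ 2
  have hφ : HasStrictFDerivAt φ (2 • (innerSL ℝ (y - x))) y := by
    have h1 := (hasStrictFDerivAt_norm_sq (y - x)).comp y ((hasStrictFDerivAt_id y).sub_const x)
    simpa using h1
  have hext : IsLocalExtrOn φ {z | F z = F y} y := by
    left
    have h1 : ∀ᶠ z in 𝓝[{z | F z = F y}] y, z ∈ ball y r :=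
      mem_nhdsWithin_of_mem_nhds (isOpen_ball.mem_nhds hyr)
    filter_upwards [h1, self_mem_nhdsWithin] with z hz hz0
    have hzΓ : z ∈ Γ := (hFΓ.ge ⟨hz, (show F z = F y from hz0).trans hFy⟩).1
    have := hmin z hzΓ
    rw [dist_comm, dist_comm x, dist_eq_norm, dist_eq_norm] at this
    exact pow_le_pow_left₀ (norm_nonneg _) this 2
  -- Lagrange multipliers for the squared distance on the level set of `F`. The multiplier `b` is
  -- nonzero because `F'(y) ≠ 0`, so `x - y` is a multiple of the gradient.
  obtain ⟨a, b, hab, h⟩ := hext.exists_multipliers_of_hasStrictFDerivAt_1d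
    (hF1.hasStrictFDerivAt one_ne_zero) hφ
  have h' : ∀ u, a * fderiv ℝ F y u + b * (2 * inner ℝ (y - x) u) = 0 := fun u => by
    have := DFunLike.congr_fun h u
    simpa only [add_apply, smul_apply, innerSL_apply_apply,
      smul_eq_mul, nsmul_eq_mul, Nat.cast_ofNat, zero_apply] using this
  have hb : b ≠ 0 := by
    rintro rfl
    have ha : a ≠ 0 := fun ha => hab (by rw [ha]; rfl)
    apply hF0 y hyr
    ext u
    have := h' u
    simpa [ha] using this
  set c : ℝ := a * fderiv ℝ F y (ν y) / (2 * b) with hc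
  have e : x - y = c • ν y := by
    refine ext_inner_right ℝ fun u => ?_
    have h1 := h' u
    rw [hν.fderiv_apply_eq hy hr hF1 (hF0 y hyr) hFΓ u] at h1
    have h2 : inner ℝ (x - y) u = -inner ℝ (y - x) u := by rw [← inner_neg_left, neg_sub]
    rw [inner_smul_left, h2, hc]
    simp only [conj_trivial]
    field_simp
    linarith
  refine ⟨c, e, ?_⟩
  rw [dist_eq_norm, e, norm_smul, (hν.2 y hy).1, mul_one, Real.norm_eq_abs]

/-- The global coordinates along the normals have an inverse on the image of the strip. The image
contains the whole `R`-neighborhood because each `x` there has a nearest point on the compact `Γ`,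
from which it is reached along the normal at height `±dist(x, Γ)`. -/
theorem exists_tubularRadius (hΓ : Γ ∈ hypersurfaces n 2 α) (hν : IsUnitNormalField Γ ν) :
    ∃ R : ℝ, IsTubularRadius Γ ν R := by
  obtain ⟨R, hR, -, -, P, hP, hPc⟩ := exists_global_coordinates hΓ.1
    (X := fun q : EuclideanSpace ℝ (Fin n) × ℝ => q.1 + q.2 • ν q.1) (M := 1)
    (fun y hy => hasLocalCoordinates_normal hΓ hν hy) (fun y hy r => by
      rw [dist_eq_norm, add_sub_cancel_left, norm_smul, (hν.2 y hy).1]; simp)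
  have himg : ∀ x ∈ thickening R Γ, ∃ q ∈ Γ ×ˢ Ioo (-R) R, q.1 + q.2 • ν q.1 = x := by
    intro x hx
    obtain ⟨y, hy, hmin⟩ := hΓ.1.exists_infDist_eq_dist hΓ.2.1 x
    have hd : infDist x Γ < R := (mem_thickening_iff_infDist_lt hΓ.2.1).1 hx
    obtain ⟨c, hc, hc'⟩ := sub_eq_smul_normal_of_nearest hΓ hν hy (x := x) fun z hz => by
      rw [← hmin]; exact infDist_le_dist_of_mem hz
    refine ⟨(y, c), ⟨hy, abs_lt.1 (by rw [hc', ← hmin]; exact hd)⟩, ?_⟩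
    simp only [← hc]; abel
  have hsub : thickening R Γ ⊆
      (fun q : EuclideanSpace ℝ (Fin n) × ℝ => q.1 + q.2 • ν q.1) '' (Γ ×ˢ Ioo (-R) R) :=
    fun x hx => himg x hx
  refine ⟨R, hR, fun x => (P x).1, fun x => (P x).2, (hPc.mono hsub).fst, (hPc.mono hsub).snd,
    ?_, ?_⟩
  · intro x hx
    obtain ⟨q, hq, rfl⟩ := himg x hx
    have h : P (q.1 + q.2 • ν q.1) = q := hP q hq
    simp only [h]
    exact ⟨hq.1, abs_lt.2 hq.2, trivial⟩
  · intro y hy r hr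
    have h : P (y + r • ν y) = (y, r) := hP (y, r) ⟨hy, abs_lt.1 hr⟩
    simp only [h, and_true]
    refine mem_thickening_iff.2 ⟨y, hy, ?_⟩
    rw [dist_eq_norm, add_sub_cancel_left, norm_smul, (hν.2 y hy).1, mul_one]
    exact hr

end tubular

/-! ### The regularized normal field -/

section mollified

variable {n : ℕ} {Γ : Set (EuclideanSpace ℝ (Fin n))}
  {ν : EuclideanSpace ℝ (Fin n) → EuclideanSpace ℝ (Fin n)} {R : ℝ} {η : ℝ → ℝ}
  {ψ : EuclideanSpace ℝ (Fin n) → ℝ}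

/-- The point chosen in `extendedNormal` is unique: the inverse maps `p` and `t` recover foot point
and height from `x`. -/
theorem extendedNormal_add_smul (hR : IsTubularRadius Γ ν R) {y : EuclideanSpace ℝ (Fin n)}
    (hy : y ∈ Γ) {r : ℝ} (hr : |r| < R) :
    extendedNormal Γ ν R η (y + r • ν y) = η r • ν y := by
  obtain ⟨-, p, t, -, -, -, hpt⟩ := hR
  have h : ∃ q : EuclideanSpace ℝ (Fin n) × ℝ, q.1 ∈ Γ ∧ |q.2| < R ∧
      y + r • ν y = q.1 + q.2 • ν q.1 := ⟨(y, r), hy, hr, rfl⟩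
  rw [extendedNormal, dif_pos h]
  obtain ⟨h1, h2, h3⟩ := h.choose_spec
  have e1 := hpt _ h1 _ h2
  rw [← h3] at e1
  have e2 := hpt y hy r hr
  rw [← e1.2.1, ← e1.2.2, e2.2.1, e2.2.2]

theorem extendedNormal_eq_zero (hR : IsTubularRadius Γ ν R) (hη : IsCutoff R η)
    (hν : IsUnitNormalField Γ ν) {x : EuclideanSpace ℝ (Fin n)} (hx : 3 * R / 4 < infDist x Γ) :
    extendedNormal Γ ν R η x = 0 := by
  by_cases h : ∃ q : EuclideanSpace ℝ (Fin n) × ℝ, q.1 ∈ Γ ∧ |q.2| < R ∧ x = q.1 + q.2 • ν q.1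
  · obtain ⟨⟨y, r⟩, hy, hr, rfl⟩ := h
    rw [extendedNormal_add_smul hR hy hr]
    have h1 : infDist (y + r • ν y) Γ ≤ |r| := by
      refine (infDist_le_dist_of_mem hy).trans ?_
      rw [dist_eq_norm, add_sub_cancel_left, norm_smul, (hν.2 y hy).1, mul_one, Real.norm_eq_abs]
    rw [hη.2.2.2 r (hx.le.trans h1), zero_smul]
  · rw [extendedNormal, dif_neg h]

/-- Inside the tube the field is `η(t) ν(p)`. At points outside it, the cut-off at `3R/4 < R` makes
the field vanish on a whole neighborhood, so there is no jump at the boundary of the tube. -/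
theorem continuous_extendedNormal (hΓ : Γ.Nonempty) (hR : IsTubularRadius Γ ν R)
    (hη : IsCutoff R η) (hν : IsUnitNormalField Γ ν) : Continuous (extendedNormal Γ ν R η) := by
  rw [continuous_iff_continuousAt]
  intro x
  by_cases hx : x ∈ thickening R Γ
  · obtain ⟨-, p, t, hp, ht, hpt, -⟩ := id hR
    have h1 : ContinuousOn (fun x => η (t x) • ν (p x)) (thickening R Γ) :=
      (hη.1.continuous.comp_continuousOn ht.continuousOn).smul
        (hν.1.comp hp.continuousOn fun x hx => (hpt x hx).1)
    refine (h1.continuousAt (isOpen_thickening.mem_nhds hx)).congr ?_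
    filter_upwards [isOpen_thickening.mem_nhds hx] with z hz
    obtain ⟨e1, e2, e3⟩ := hpt z hz
    conv_rhs => rw [e3]
    exact (extendedNormal_add_smul hR e1 e2).symm
  · have h1 : R ≤ infDist x Γ := not_lt.1 fun h => hx ((mem_thickening_iff_infDist_lt hΓ).2 h)
    have h2 : ∀ᶠ z in 𝓝 x, 3 * R / 4 < infDist z Γ :=
      (continuous_infDist_pt Γ).continuousAt.eventually (lt_mem_nhds (by linarith [hR.1]))
    exact continuousAt_const.congr (f := fun _ => (0 : EuclideanSpace ℝ (Fin n)))
      (h2.mono fun z hz => (extendedNormal_eq_zero hR hη hν hz).symm)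

theorem hasCompactSupport_extendedNormal (hΓ : IsCompact Γ) (hΓ' : Γ.Nonempty)
    (hR : IsTubularRadius Γ ν R) (hη : IsCutoff R η) (hν : IsUnitNormalField Γ ν) :
    HasCompactSupport (extendedNormal Γ ν R η) := by
  refine HasCompactSupport.intro (K := cthickening R Γ) hΓ.cthickening fun x hx => ?_
  refine extendedNormal_eq_zero hR hη hν ?_
  have h1 : R ≤ infDist x Γ := not_lt.1 fun h =>
    hx (thickening_subset_cthickening _ _ ((mem_thickening_iff_infDist_lt hΓ').2 h))
  linarith [hR.1]

/-- The mollifier of radius `δ`. -/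
noncomputable def scaledMollifier (ψ : EuclideanSpace ℝ (Fin n) → ℝ) (δ : ℝ)
    (x : EuclideanSpace ℝ (Fin n)) : ℝ :=
  (δ ^ n)⁻¹ * ψ (δ⁻¹ • x)

theorem regularizedNormal_eq_convolution (δ : ℝ) :
    regularizedNormal Γ ν R η ψ δ =
      convolution (scaledMollifier ψ δ) (extendedNormal Γ ν R η)
        (ContinuousLinearMap.lsmul ℝ ℝ) volume := by
  funext x
  rw [convolution_lsmul_swap]
  rfl

theorem contDiff_scaledMollifier (hψ : IsMollifier ψ) (δ : ℝ) :
    ContDiff ℝ ∞ (scaledMollifier ψ δ) :=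
  contDiff_const.mul (hψ.1.comp (contDiff_const_smul _))

theorem hasCompactSupport_scaledMollifier (hψ : IsMollifier ψ) {δ : ℝ} (hδ : 0 < δ) :
    HasCompactSupport (scaledMollifier ψ δ) :=
  (hψ.2.1.comp_smul (inv_ne_zero hδ.ne')).mul_left

theorem integral_scaledMollifier (hψ : IsMollifier ψ) {δ : ℝ} (hδ : 0 < δ) :
    ∫ x, scaledMollifier ψ δ x = 1 := by
  simp only [scaledMollifier]
  rw [integral_const_mul, Measure.integral_comp_inv_smul_of_nonneg volume ψ hδ.le, hψ.2.2.2]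
  simp [(pow_pos hδ n).ne']

theorem contDiff_regularizedNormal (hΓ' : Γ.Nonempty) (hR : IsTubularRadius Γ ν R)
    (hη : IsCutoff R η) (hν : IsUnitNormalField Γ ν) (hψ : IsMollifier ψ) {δ : ℝ} (hδ : 0 < δ) :
    ContDiff ℝ ∞ (regularizedNormal Γ ν R η ψ δ) := by
  rw [regularizedNormal_eq_convolution]
  exact (hasCompactSupport_scaledMollifier hψ hδ).contDiff_convolution_left _
    (contDiff_scaledMollifier hψ δ) (continuous_extendedNormal hΓ' hR hη hν).locallyIntegrable

theorem hasCompactSupport_regularizedNormal (hΓ : IsCompact Γ) (hΓ' : Γ.Nonempty)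
    (hR : IsTubularRadius Γ ν R) (hη : IsCutoff R η) (hν : IsUnitNormalField Γ ν)
    (hψ : IsMollifier ψ) {δ : ℝ} (hδ : 0 < δ) :
    HasCompactSupport (regularizedNormal Γ ν R η ψ δ) := by
  rw [regularizedNormal_eq_convolution]
  exact (hasCompactSupport_scaledMollifier hψ hδ).convolution _
    (hasCompactSupport_extendedNormal hΓ hΓ' hR hη hν)

/-- For small `δ`, the regularized normal field is transversal. -/
theorem exists_inner_regularizedNormal_pos (hΓ : IsCompact Γ) (hΓ' : Γ.Nonempty)
    (hR : IsTubularRadius Γ ν R) (hη : IsCutoff R η) (hν : IsUnitNormalField Γ ν)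
    (hψ : IsMollifier ψ) :
    ∃ δ₀ : ℝ, 0 < δ₀ ∧ ∀ δ : ℝ, 0 < δ → δ < δ₀ → ∀ y ∈ Γ,
      0 < inner ℝ (ν y) (regularizedNormal Γ ν R η ψ δ y) := by
  have hc := continuous_extendedNormal hΓ' hR hη hν
  obtain ⟨ε, hε, hεu⟩ := Metric.uniformContinuous_iff.1
    ((hasCompactSupport_extendedNormal hΓ hΓ' hR hη hν).uniformContinuous_of_continuous hc) (1 / 2) (by norm_num)
  obtain ⟨M, hM⟩ := hψ.2.1.isCompact.isBounded.subset_ball (0 : EuclideanSpace ℝ (Fin n))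
  -- For such `δ` the support of `ψ_δ` lies in the ball of radius `ε`, on which the extended normal
  -- varies by less than `1/2`. The denominator `|M| + 1` is positive whatever the sign of `M`.
  refine ⟨ε / (|M| + 1), by positivity, fun δ hδ hδ' y hy => ?_⟩
  have hδM : δ * (|M| + 1) < ε := (lt_div_iff₀ (by positivity)).1 hδ'
  have hsupp : Function.support (scaledMollifier ψ δ) ⊆ ball 0 ε := by
    intro x hx
    have h1 : ψ (δ⁻¹ • x) ≠ 0 := right_ne_zero_of_mul hx
    have h2 := hM (subset_tsupport _ h1)
    rw [mem_ball_zero_iff, norm_smul, norm_inv, Real.norm_of_nonneg hδ.le, inv_mul_lt_iff₀ hδ] at h2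
    rw [mem_ball_zero_iff]
    nlinarith [le_abs_self M]
  have hyν : extendedNormal Γ ν R η y = ν y := by
    have h := extendedNormal_add_smul (η := η) hR hy (r := 0) (by simpa using hR.1)
    rwa [zero_smul, add_zero, hη.2.2.1 0 (by rw [abs_zero]; linarith [hR.1]), one_smul] at h
  have h1 : dist (regularizedNormal Γ ν R η ψ δ y) (ν y) ≤ 1 / 2 := by
    rw [regularizedNormal_eq_convolution]
    refine dist_convolution_le (by norm_num) hsupp (fun x => ?_) (integral_scaledMollifier hψ hδ)
      hc.aestronglyMeasurable fun x hx => ?_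
    · exact mul_nonneg (inv_nonneg.2 (pow_nonneg hδ.le _)) (hψ.2.2.1 _)
    · rw [← hyν]
      exact (hεu hx).le
  have h2 : inner ℝ (ν y) (regularizedNormal Γ ν R η ψ δ y) =
      1 + inner ℝ (ν y) (regularizedNormal Γ ν R η ψ δ y - ν y) := by
    rw [inner_sub_right, real_inner_self_eq_norm_sq, (hν.2 y hy).1]; norm_num
  have h3 : |inner ℝ (ν y) (regularizedNormal Γ ν R η ψ δ y - ν y)| ≤ 1 / 2 := by
    refine (abs_real_inner_le_norm _ _).trans ?_
    rw [(hν.2 y hy).1, one_mul, ← dist_eq_norm]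
    exact h1
  rw [h2]
  linarith [(abs_le.1 h3).1]

end mollified

/-! ### Extensions of functions on a compact set -/

section extension

variable {E : Type} [NormedAddCommGroup E] [NormedSpace ℝ E]

theorem contDiff_mul_of_tsupport_subset {m : WithTop ℕ∞} {χ F : E → ℝ} {O : Set E} (hO : IsOpen O)
    (hχ : ContDiff ℝ m χ) (hs : tsupport χ ⊆ O) (hF : ContDiffOn ℝ m F O) :
    ContDiff ℝ m fun x => χ x * F x := by
  rw [contDiff_iff_contDiffAt]
  intro x
  by_cases hx : x ∈ tsupport χ
  · exact hχ.contDiffAt.mul (hF.contDiffAt (hO.mem_nhds (hs hx)))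
  · refine (contDiffAt_const (c := (0 : ℝ))).congr_of_eventuallyEq ?_
    filter_upwards [notMem_tsupport_iff_eventuallyEq.1 hx] with z hz
    simp [hz]

theorem IsLittleHolderAtTwo.mul_of_tsupport_subset {α : ℝ} (hα₀ : 0 < α) (hα₁ : α < 1)
    {χ F : E → ℝ} {O : Set E} (hχ : ContDiff ℝ 3 χ) (hs : tsupport χ ⊆ O)
    (hF : ∀ x ∈ O, IsLittleHolderAtTwo α F x) (x : E) :
    IsLittleHolderAtTwo α (fun x => χ x * F x) x := by
  by_cases hx : x ∈ tsupport χ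
  · exact (hχ.contDiffAt.isLittleHolderAtTwo hα₀ hα₁).mul hα₀ hα₁ (hF x (hs hx))
  · refine ((contDiffAt_const (c := (0 : ℝ))).isLittleHolderAtTwo hα₀ hα₁).congr_of_eventuallyEq ?_
    filter_upwards [notMem_tsupport_iff_eventuallyEq.1 hx] with z hz
    simp [hz]

theorem norm_mul_le_of_tsupport_subset {E : Type} [NormedAddCommGroup E] {χ F : E → ℝ} {O : Set E} (hs : tsupport χ ⊆ O) {B A : ℝ}
    (hA : 0 ≤ A) (hB : ∀ x, |χ x| ≤ B) (hF : ∀ x ∈ O, |F x| ≤ A) (x : E) :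
    |χ x * F x| ≤ B * A := by
  have hB0 : 0 ≤ B := (abs_nonneg _).trans (hB x)
  by_cases hx : x ∈ tsupport χ
  · rw [abs_mul]
    exact mul_le_mul (hB x) (hF x (hs hx)) (abs_nonneg _) hB0
  · rw [image_eq_zero_of_notMem_tsupport hx, zero_mul, abs_zero]
    positivity

theorem norm_mul_sub_mul_le_of_tsupport_subset {χ F : E → ℝ} {O : Set E} (hO : IsOpen O)
    (hχ : ContDiff ℝ 1 χ) (hs : tsupport χ ⊆ O) (hF : ContDiffOn ℝ 1 F O) {B B' A : ℝ} (hA : 0 ≤ A)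
    (hB : ∀ x, |χ x| ≤ B) (hB' : ∀ x, ‖fderiv ℝ χ x‖ ≤ B') (hFA : ∀ x ∈ O, |F x| ≤ A)
    (hFA' : ∀ x ∈ O, ‖fderiv ℝ F x‖ ≤ A) (x y : E) :
    |χ x * F x - χ y * F y| ≤ (B + B') * A * ‖x - y‖ := by
  have hB0 : 0 ≤ B := (abs_nonneg _).trans (hB x)
  have hB0' : 0 ≤ B' := (norm_nonneg _).trans (hB' x)
  have hd := contDiff_mul_of_tsupport_subset hO hχ hs hF
  refine convex_univ.norm_image_sub_le_of_norm_fderiv_le (𝕜 := ℝ) (f := fun x => χ x * F x)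
    (fun z _ => (hd.differentiable one_ne_zero) z) (fun z _ => ?_) (mem_univ y) (mem_univ x)
  by_cases hz : z ∈ tsupport χ
  · have h1 : HasFDerivAt (fun x => χ x * F x) _ z :=
      ((hχ.differentiable one_ne_zero) z).hasFDerivAt.mul
        ((hF.contDiffAt (hO.mem_nhds (hs hz))).differentiableAt one_ne_zero).hasFDerivAt
    rw [h1.fderiv]
    calc _ ≤ ‖χ z • fderiv ℝ F z‖ + ‖F z • fderiv ℝ χ z‖ := norm_add_le _ _
      _ = |χ z| * ‖fderiv ℝ F z‖ + |F z| * ‖fderiv ℝ χ z‖ := by rw [norm_smul, norm_smul]; rfl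
      _ ≤ B * A + A * B' := add_le_add
          (mul_le_mul (hB z) (hFA' z (hs hz)) (norm_nonneg _) hB0)
          (mul_le_mul (hFA z (hs hz)) (hB' z) (norm_nonneg _) hA)
      _ = (B + B') * A := by ring
  · have h0 : (fun x => χ x * F x) =ᶠ[𝓝 z] fun _ => 0 := by
      filter_upwards [notMem_tsupport_iff_eventuallyEq.1 hz] with w hw
      simp [hw]
    rw [h0.fderiv_eq, fderiv_fun_const, Pi.zero_apply, norm_zero]
    positivity

variable {α : ℝ} {Γ : Set E}

/-- For small `s ≠ 0` the error `ρ(s)/s - h` has local norm below one, hence an extension `G` of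
norm at most one; with a local extension `H` of `h`, take `F = s (G + H)`. The punctured limit says
nothing at `s = 0`, where `ρ(0) = 0` is extended by zero. -/
theorem HasHolderDerivAtZero.exists_local_extension {ρ : ℝ → littleHolder 2 α Γ}
    {h : littleHolder 2 α Γ} (hρ : HasHolderDerivAtZero 2 α Γ ρ h) (h0 : ρ 0 = 0) {y : E}
    (hy : y ∈ Γ) :
    ∃ r > 0, ∃ A : ℝ, 0 ≤ A ∧ ∀ᶠ s in 𝓝 (0 : ℝ), ∃ F : E → ℝ, ContDiffOn ℝ 2 F (ball y r) ∧
      (∀ x ∈ ball y r, |F x| ≤ A * |s|) ∧ (∀ x ∈ ball y r, ‖fderiv ℝ F x‖ ≤ A * |s|) ∧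
      ∀ x : Γ, (x : E) ∈ ball y r → (ρ s : Γ → ℝ) x = F x := by
  obtain ⟨r₁, hr₁, hlim⟩ := hρ y hy
  obtain ⟨r₂, hr₂, H, hH, hhH⟩ := h.2 y hy
  set a : ℝ := (holderNorm 2 α (ball y r₂) H).toReal with ha
  have ha0 : 0 ≤ a := ENNReal.toReal_nonneg
  have haH : holderNorm 2 α (ball y r₂) H ≤ ENNReal.ofReal a := by
    rw [ha, ENNReal.ofReal_toReal hH.1.2.2.ne]
  have hev := hlim.eventually (gt_mem_nhds (one_pos : (0 : ℝ≥0∞) < 1))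
  rw [eventually_nhdsWithin_iff] at hev
  refine ⟨min r₁ r₂, lt_min hr₁ hr₂, 1 + a, by positivity, ?_⟩
  filter_upwards [hev] with s hs
  by_cases hs0 : s = 0
  · subst hs0
    refine ⟨0, contDiffOn_const, fun x _ => by simp, fun x _ => by simp, fun x _ => by simp [h0]⟩
  have h1 := hs hs0
  simp only [localHolderNorm, iInf_lt_iff] at h1
  obtain ⟨G, hG, hρG, hG1⟩ := h1
  have hG1' : holderNorm 2 α (ball y r₁) G ≤ ENNReal.ofReal 1 := by simpa using hG1.le
  have s1 : ball y (min r₁ r₂) ⊆ ball y r₁ := ball_subset_ball (min_le_left _ _)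
  have s2 : ball y (min r₁ r₂) ⊆ ball y r₂ := ball_subset_ball (min_le_right _ _)
  have d1 := hG.1.1.mono s1
  have d2 := hH.1.1.mono s2
  refine ⟨fun x => s * (G x + H x), contDiffOn_const.mul (d1.add d2), fun x hx => ?_,
    fun x hx => ?_, fun x hx => ?_⟩
  · have e1 := norm_le_of_holderNorm_le one_pos.le hG1' (s1 hx)
    have e2 := norm_le_of_holderNorm_le ha0 haH (s2 hx)
    rw [abs_mul, mul_comm]
    exact mul_le_mul_of_nonneg_right ((abs_add_le _ _).trans (add_le_add e1 e2)) (abs_nonneg s)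
  · have e1 := norm_fderiv_le_of_holderNorm_le (by norm_num) one_pos.le hG1' (s1 hx)
    have e2 := norm_fderiv_le_of_holderNorm_le (by norm_num) ha0 haH (s2 hx)
    have f1 := ((d1.contDiffAt (isOpen_ball.mem_nhds hx)).differentiableAt two_ne_zero).hasFDerivAt
    have f2 := ((d2.contDiffAt (isOpen_ball.mem_nhds hx)).differentiableAt two_ne_zero).hasFDerivAt
    have f3 : HasFDerivAt (fun x => s * (G x + H x)) _ x := (f1.add f2).const_mul s
    rw [f3.fderiv, norm_smul, Real.norm_eq_abs, mul_comm]
    exact mul_le_mul_of_nonneg_right ((norm_add_le _ _).trans (add_le_add e1 e2)) (abs_nonneg s)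
  · have e1 := hρG x (s1 hx)
    have e2 := hhH x (s2 hx)
    rw [h0, sub_zero] at e1
    have e3 : s⁻¹ * (ρ s : Γ → ℝ) x - (h : Γ → ℝ) x = G x := by simpa using e1
    change (ρ s : Γ → ℝ) x = s * (G x + H x)
    rw [← e3, ← e2, sub_add_cancel, mul_inv_cancel_left₀ hs0]

variable [FiniteDimensional ℝ E]

theorem exists_smooth_partition (hΓ : IsCompact Γ) {r : E → ℝ}
    (hr : ∀ y ∈ Γ, 0 < r y) :
    ∃ (T : Finset E) (χ : E → E → ℝ), (∀ i ∈ T, i ∈ Γ) ∧ (∀ i ∈ T, ContDiff ℝ ∞ (χ i)) ∧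
      (∀ i ∈ T, HasCompactSupport (χ i)) ∧ (∀ i ∈ T, tsupport (χ i) ⊆ ball i (r i)) ∧
      ∀ x ∈ Γ, ∑ i ∈ T, χ i x = 1 := by
  classical
  obtain ⟨T, hT, hcov⟩ := hΓ.elim_nhds_subcover (fun y => ball y (r y))
    fun y hy => ball_mem_nhds y (hr y hy)
  obtain ⟨f, hf⟩ := SmoothPartitionOfUnity.exists_isSubordinate (ι := T) (modelWithCornersSelf ℝ E) hΓ.isClosed
    (fun i => ball (i : E) (r i)) (fun _ => isOpen_ball) (fun x hx => by
      simpa using hcov hx)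
  have hs : ∀ i : T, tsupport (f i) ⊆ ball (i : E) (r i) := hf
  refine ⟨T, fun i => if h : i ∈ T then f ⟨i, h⟩ else 0, hT, fun i hi => ?_, fun i hi => ?_,
    fun i hi => ?_, fun x hx => ?_⟩
  · beta_reduce
    rw [dif_pos hi]
    exact (f ⟨i, hi⟩).contMDiff.contDiff
  · beta_reduce
    rw [dif_pos hi]
    exact HasCompactSupport.of_support_subset_isCompact (isCompact_closedBall i (r i))
      ((subset_tsupport _).trans ((hs ⟨i, hi⟩).trans ball_subset_closedBall))
  · beta_reduce
    rw [dif_pos hi]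
    exact hs ⟨i, hi⟩
  · have h1 := f.sum_eq_one hx
    rw [finsum_eq_sum_of_fintype] at h1
    rw [← h1, ← Finset.sum_coe_sort T]
    refine Finset.sum_congr rfl fun i _ => ?_
    simp

theorem exists_isLittleHolderAtTwo_extension (hα₀ : 0 < α) (hα₁ : α < 1) (hΓ : IsCompact Γ)
    (h : littleHolder 2 α Γ) :
    ∃ H : E → ℝ, HasCompactSupport H ∧ (∀ x, IsLittleHolderAtTwo α H x) ∧
      ∀ y : Γ, H y = (h : Γ → ℝ) y := by
  have hloc := h.2
  choose! r hr F hF hhF using hloc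
  obtain ⟨T, χ, hT, hχ, hc, hs, hsum⟩ := exists_smooth_partition hΓ hr
  refine ⟨fun x => ∑ i ∈ T, χ i x * F i x, ?_, fun x => ?_, fun y => ?_⟩
  · have : (fun x => ∑ i ∈ T, χ i x * F i x) = ∑ i ∈ T, fun x => χ i x * F i x := by
      ext x; simp
    rw [this]
    exact HasCompactSupport.intro (K := ⋃ i ∈ T, tsupport (χ i))
      (T.isCompact_biUnion fun i hi => hc i hi) fun x hx => by
        rw [Finset.sum_apply]
        refine Finset.sum_eq_zero fun i hi => ?_
        rw [image_eq_zero_of_notMem_tsupport fun h => hx (mem_biUnion hi h), zero_mul]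
  · exact IsLittleHolderAtTwo.sum hα₀ hα₁ T (f := fun i x => χ i x * F i x) fun i hi =>
      IsLittleHolderAtTwo.mul_of_tsupport_subset hα₀ hα₁
        (contDiff_infty.1 (hχ i hi) 3) (hs i hi)
        (fun z hz => (hF i (hT i hi)).isLittleHolderAtTwo hα₀ hα₁ isOpen_ball hz) x
  · calc ∑ i ∈ T, χ i y * F i y = ∑ i ∈ T, χ i y * (h : Γ → ℝ) y := by
          refine Finset.sum_congr rfl fun i hi => ?_
          by_cases hy : (y : E) ∈ tsupport (χ i)
          · rw [hhF i (hT i hi) y (hs i hi hy)]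
          · rw [image_eq_zero_of_notMem_tsupport hy, zero_mul, zero_mul]
      _ = (h : Γ → ℝ) y := by rw [← Finset.sum_mul, hsum y y.2, one_mul]

/-- A differentiable curve of functions on a compact set extends to a curve of compactly supported
functions of class `C²` whose `C¹` norms are of order `s`. -/
theorem HasHolderDerivAtZero.exists_extension (hΓ : IsCompact Γ) {ρ : ℝ → littleHolder 2 α Γ}
    {h : littleHolder 2 α Γ} (hρ : HasHolderDerivAtZero 2 α Γ ρ h) (h0 : ρ 0 = 0) :
    ∃ K : Set E, IsCompact K ∧ ∃ C : ℝ, 0 ≤ C ∧ ∀ᶠ s in 𝓝 (0 : ℝ), ∃ F : E → ℝ,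
      ContDiff ℝ 2 F ∧ (∀ x ∉ K, F x = 0) ∧ (∀ x, |F x| ≤ C * |s|) ∧
      (∀ x y, |F x - F y| ≤ C * |s| * ‖x - y‖) ∧ ∀ y : Γ, F y = (ρ s : Γ → ℝ) y := by
  have hloc := fun y (hy : y ∈ Γ) => hρ.exists_local_extension h0 hy
  choose! r hr A hA hF using hloc
  obtain ⟨T, χ, hT, hχ, hc, hs, hsum⟩ := exists_smooth_partition hΓ hr
  have hB : ∀ i ∈ T, ∃ B : ℝ, ∀ x, |χ i x| ≤ B := fun i hi =>
    (hχ i hi).continuous.bounded_above_of_compact_support (hc i hi)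
  have hB' : ∀ i ∈ T, ∃ B : ℝ, ∀ x, ‖fderiv ℝ (χ i) x‖ ≤ B := fun i hi =>
    ((hχ i hi).continuous_fderiv (by simp)).bounded_above_of_compact_support ((hc i hi).fderiv ℝ)
  choose! B hB using hB
  choose! B' hB' using hB'
  have hBp : ∀ i ∈ T, 0 ≤ B i := fun i hi => (abs_nonneg _).trans (hB i hi 0)
  have hBp' : ∀ i ∈ T, 0 ≤ B' i := fun i hi => (norm_nonneg _).trans (hB' i hi 0)
  refine ⟨⋃ i ∈ T, tsupport (χ i), T.isCompact_biUnion fun i hi => hc i hi,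
    ∑ i ∈ T, (B i + B' i) * A i, Finset.sum_nonneg fun i hi =>
      mul_nonneg (add_nonneg (hBp i hi) (hBp' i hi)) (hA i (hT i hi)), ?_⟩
  have hev : ∀ᶠ s in 𝓝 (0 : ℝ), ∀ i ∈ T, ∃ F : E → ℝ, ContDiffOn ℝ 2 F (ball i (r i)) ∧
      (∀ x ∈ ball i (r i), |F x| ≤ A i * |s|) ∧ (∀ x ∈ ball i (r i), ‖fderiv ℝ F x‖ ≤ A i * |s|) ∧
      ∀ x : Γ, (x : E) ∈ ball i (r i) → (ρ s : Γ → ℝ) x = F x :=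
    (Filter.eventually_all_finset T).2 fun i hi => hF i (hT i hi)
  filter_upwards [hev] with s hs'
  choose! F hF2 hFA hFA' hρF using hs'
  have hAs : ∀ i ∈ T, 0 ≤ A i * |s| := fun i hi => mul_nonneg (hA i (hT i hi)) (abs_nonneg s)
  refine ⟨fun x => ∑ i ∈ T, χ i x * F i x, ?_, fun x hx => ?_, fun x => ?_, fun x y => ?_,
    fun y => ?_⟩
  · exact ContDiff.sum fun i hi => contDiff_mul_of_tsupport_subset isOpen_ball
      (contDiff_infty.1 (hχ i hi) 2) (hs i hi) (hF2 i hi)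
  · refine Finset.sum_eq_zero fun i hi => ?_
    rw [image_eq_zero_of_notMem_tsupport fun h => hx (mem_biUnion hi h), zero_mul]
  · refine (Finset.abs_sum_le_sum_abs _ _).trans ?_
    rw [Finset.sum_mul]
    refine Finset.sum_le_sum fun i hi => ?_
    refine (norm_mul_le_of_tsupport_subset (hs i hi) (hAs i hi) (hB i hi) (hFA i hi) x).trans ?_
    have := mul_nonneg (hBp' i hi) (hAs i hi)
    linarith
  · rw [← Finset.sum_sub_distrib]
    refine (Finset.abs_sum_le_sum_abs _ _).trans ?_
    rw [Finset.sum_mul, Finset.sum_mul]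
    refine Finset.sum_le_sum fun i hi => ?_
    refine (norm_mul_sub_mul_le_of_tsupport_subset isOpen_ball
      ((hχ i hi).of_le (by simp)) (hs i hi) ((hF2 i hi).of_le (by norm_num))
      (hAs i hi) (hB i hi) (hB' i hi) (hFA i hi) (hFA' i hi) x y).trans_eq ?_
    ring
  · calc ∑ i ∈ T, χ i y * F i y = ∑ i ∈ T, χ i y * (ρ s : Γ → ℝ) y := by
          refine Finset.sum_congr rfl fun i hi => ?_
          by_cases hy : (y : E) ∈ tsupport (χ i)
          · rw [hρF i hi y (hs i hi hy)]
          · rw [image_eq_zero_of_notMem_tsupport hy, zero_mul, zero_mul]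
      _ = (ρ s : Γ → ℝ) y := by rw [← Finset.sum_mul, hsum y y.2, one_mul]

end extension

/-! ### Diffeomorphisms defined by the flow -/

section diffeo

variable {E : Type} [NormedAddCommGroup E] [NormedSpace ℝ E] [FiniteDimensional ℝ E] {v : E → E}
  {K : NNReal} {M : ℝ}

/-- A `C²` map that is close to the identity is a diffeomorphism. -/
theorem exists_contDiff_inverse {Φ : E → E} (hΦ : ContDiff ℝ 2 Φ)
    (h : ∀ x y, ‖(Φ x - x) - (Φ y - y)‖ ≤ 1 / 2 * ‖x - y‖) :
    ∃ Ψ : E → E, ContDiff ℝ 2 Ψ ∧ Function.LeftInverse Ψ Φ ∧ Function.RightInverse Ψ Φ := by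
  have : CompleteSpace E := FiniteDimensional.complete ℝ E
  have ha : ApproximatesLinearOn Φ ((ContinuousLinearEquiv.refl ℝ E : E ≃L[ℝ] E) : E →L[ℝ] E) univ
      (1 / 2 : NNReal) := by
    intro x _ y _
    have e : Φ x - Φ y - (x - y) = (Φ x - x) - (Φ y - y) := by abel
    simpa [e] using h x y
  have hc : Subsingleton E ∨ (1 / 2 : NNReal) <
      ‖((ContinuousLinearEquiv.refl ℝ E).symm : E →L[ℝ] E)‖₊⁻¹ := by
    rcases subsingleton_or_nontrivial E with hE | hE
    · exact Or.inl hE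
    · right
      have : ‖((ContinuousLinearEquiv.refl ℝ E).symm : E →L[ℝ] E)‖₊ = 1 := by
        apply NNReal.eq
        exact ContinuousLinearMap.norm_id
      rw [this, inv_one]
      exact NNReal.half_lt_self one_ne_zero
  let f := ha.toHomeomorph Φ hc
  -- The derivative differs from the identity by at most `1/2` in norm, so it is injective, and in
  -- finite dimension invertible. This makes the inverse homeomorphism of class `C²`.
  have hinj : ∀ x, Function.Injective (fderiv ℝ Φ x) := by
    intro x
    have h1 : HasFDerivAt (fun z => Φ z - z) (fderiv ℝ Φ x - ContinuousLinearMap.id ℝ E) x :=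
      ((hΦ.differentiable two_ne_zero) x).hasFDerivAt.sub (hasFDerivAt_id x)
    have h2 : ‖fderiv ℝ Φ x - ContinuousLinearMap.id ℝ E‖ ≤ 1 / 2 := by
      have hL : LipschitzWith (1 / 2 : NNReal) fun z => Φ z - z :=
        LipschitzWith.of_dist_le_mul fun a b => by
          simpa [dist_eq_norm] using h a b
      simpa using h1.le_of_lipschitz hL
    refine (injective_iff_map_eq_zero _).2 fun u hu => ?_
    have h3 := (fderiv ℝ Φ x - ContinuousLinearMap.id ℝ E).le_of_opNorm_le h2 u
    have h4 : (fderiv ℝ Φ x - ContinuousLinearMap.id ℝ E) u = -u := by simp [hu]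
    rw [h4, norm_neg] at h3
    exact norm_le_zero_iff.1 (by linarith [norm_nonneg u])
  let D : E → E ≃L[ℝ] E := fun x =>
    (LinearEquiv.ofInjectiveEndo (fderiv ℝ Φ x : E →ₗ[ℝ] E) (hinj x)).toContinuousLinearEquiv
  refine ⟨f.symm, f.contDiff_symm (f₀' := D) (fun x => ?_) hΦ, f.symm_apply_apply,
    f.apply_symm_apply⟩
  have h1 := ((hΦ.differentiable two_ne_zero) x).hasFDerivAt
  have h2 : (D x : E →L[ℝ] E) = fderiv ℝ Φ x := by ext u; rfl
  rw [h2]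
  exact h1

/-- Regularity at `(x, 0)` is an open condition, and compactness of `S` gives a common time
interval. -/
theorem exists_contDiffAt_flowMap (hv : ContDiff ℝ 3 v) (hK : LipschitzWith K v)
    (hM : ∀ x, ‖v x‖ ≤ M) {S : Set E} (hS : IsCompact S) :
    ∃ ε > 0, ∀ r : ℝ, |r| < ε → ∀ x ∈ S,
      ContDiffAt ℝ 3 (fun q : E × ℝ => flowMap v q.2 q.1) (x, r) := by
  have : CompleteSpace E := FiniteDimensional.complete ℝ E
  have h := hS.eventually_forall_of_forall_eventually (x₀ := (0 : ℝ))
    (P := fun r x => ContDiffAt ℝ 3 (fun q : E × ℝ => flowMap v q.2 q.1) (x, r)) fun x _ => by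
      have h1 := (contDiffAt_flowMap (m := 3) three_ne_zero hv hK hM x).eventually (by simp)
      exact (continuous_swap.tendsto ((0 : ℝ), x)).eventually h1
  obtain ⟨ε, hε, hεs⟩ := Metric.eventually_nhds_iff.1 h
  exact ⟨ε, hε, fun r hr => hεs (by simpa using hr)⟩

/-- Moving each point along the flow, for a short time that depends on the point, is a
diffeomorphism. -/
theorem exists_flowMap_diffeo (hv : ContDiff ℝ 3 v) (hK : LipschitzWith K v)
    (hM : ∀ x, ‖v x‖ ≤ M) {S : Set E} (hS : IsCompact S) :
    ∃ a₀ : ℝ, 0 < a₀ ∧ ∀ (a : ℝ) (F : E → ℝ), a < a₀ → ContDiff ℝ 2 F → (∀ x ∉ S, F x = 0) →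
      (∀ x, |F x| ≤ a) → (∀ x y, |F x - F y| ≤ a * ‖x - y‖) →
      ContDiff ℝ 2 (fun x => flowMap v (F x) x) ∧
      (∃ Ψ : E → E, ContDiff ℝ 2 Ψ ∧ Function.LeftInverse Ψ (fun x => flowMap v (F x) x) ∧
        Function.RightInverse Ψ (fun x => flowMap v (F x) x)) ∧
      ∀ α : ℝ, 0 < α → α < 1 → (∀ x, IsLittleHolderAtTwo α F x) →
        ∀ x, IsLittleHolderAtTwo α (fun x => flowMap v (F x) x) x := by
  have : CompleteSpace E := FiniteDimensional.complete ℝ E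
  obtain ⟨ε, hε, hflow⟩ := exists_contDiffAt_flowMap hv hK hM hS
  have hM0 : 0 ≤ M := (norm_nonneg _).trans (hM 0)
  -- By `norm_displacement_sub_le`, the map minus the identity has Lipschitz constant at most `(K
  -- e^K + M) a`. The bound on `a` makes this at most `1/2`; the added `1` keeps `L` positive.
  set L : ℝ := K * Real.exp K + M + 1 with hL
  have hL0 : 0 < L := by positivity
  refine ⟨min (min ε 1) (1 / (2 * L)), by positivity, fun a F ha hF hFS hFa hFl => ?_⟩
  have ha1 : a < ε := ha.trans_le ((min_le_left _ _).trans (min_le_left _ _))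
  have ha2 : a < 1 := ha.trans_le ((min_le_left _ _).trans (min_le_right _ _))
  have ha3 : L * a ≤ 1 / 2 := by
    have h1 : a < 1 / (2 * L) := ha.trans_le (min_le_right _ _)
    rw [lt_div_iff₀ (by positivity)] at h1
    linarith
  have ha0 : 0 ≤ a := (abs_nonneg _).trans (hFa 0)
  have hid : ∀ x ∉ S, (fun x => flowMap v (F x) x) =ᶠ[𝓝 x] id := by
    intro x hx
    filter_upwards [hS.isClosed.isOpen_compl.mem_nhds hx] with z hz
    rw [hFS z hz, flowMap_zero_time hK hM]
    rfl
  have hΦ : ContDiff ℝ 2 fun x => flowMap v (F x) x := by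
    rw [contDiff_iff_contDiffAt]
    intro x
    by_cases hx : x ∈ S
    · exact ContDiffAt.comp x (g := fun q : E × ℝ => flowMap v q.2 q.1) (f := fun x => (x, F x))
        ((hflow (F x) ((hFa x).trans_lt ha1) x hx).of_le (by norm_num))
        (contDiffAt_id.prodMk hF.contDiffAt)
    · exact contDiffAt_id.congr_of_eventuallyEq (hid x hx)
  refine ⟨hΦ, exists_contDiff_inverse hΦ fun x y => ?_, fun α hα₀ hα₁ hFα x => ?_⟩
  · refine (norm_displacement_sub_le hK hM x y ((hFa x).trans ha2.le)).trans ?_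
    have h1 : K * Real.exp K * |F x| * ‖x - y‖ ≤ K * Real.exp K * a * ‖x - y‖ := by
      gcongr; exact hFa x
    have h2 : M * |F x - F y| ≤ M * (a * ‖x - y‖) := by
      gcongr; exact hFl x y
    calc _ ≤ K * Real.exp K * a * ‖x - y‖ + M * (a * ‖x - y‖) := add_le_add h1 h2
      _ = (K * Real.exp K + M) * a * ‖x - y‖ := by ring
      _ ≤ L * a * ‖x - y‖ := by gcongr; rw [hL]; linarith
      _ ≤ 1 / 2 * ‖x - y‖ := by gcongr
  · by_cases hx : x ∈ S
    · exact IsLittleHolderAtTwo.comp hα₀ hα₁ (g := fun q : E × ℝ => flowMap v q.2 q.1)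
        (f := fun x => (x, F x))
        ((hflow (F x) ((hFa x).trans_lt ha1) x hx).isLittleHolderAtTwo hα₀ hα₁)
        ((contDiffAt_id.isLittleHolderAtTwo hα₀ hα₁).prodMk hα₀ hα₁ (hFα x))
    · exact (contDiffAt_id.isLittleHolderAtTwo hα₀ hα₁).congr_of_eventuallyEq (hid x hx)

end diffeo

/-! ### Images of hypersurfaces under diffeomorphisms -/

section image

variable {n : ℕ} {α : ℝ} {Γ : Set (EuclideanSpace ℝ (Fin n))}
  {ν Φ Ψ : EuclideanSpace ℝ (Fin n) → EuclideanSpace ℝ (Fin n)}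

theorem fderiv_leftInverse_apply {E : Type*} [NormedAddCommGroup E] [NormedSpace ℝ E]
    {Φ Ψ : E → E} (hΦ : Differentiable ℝ Φ) (hΨ : Differentiable ℝ Ψ)
    (hl : Function.LeftInverse Ψ Φ) (y u : E) : fderiv ℝ Ψ (Φ y) (fderiv ℝ Φ y u) = u := by
  have h1 : HasFDerivAt (Ψ ∘ Φ) _ y := (hΨ (Φ y)).hasFDerivAt.comp y (hΦ y).hasFDerivAt
  rw [hl.comp_eq_id] at h1
  exact DFunLike.congr_fun (h1.unique (hasFDerivAt_id y)) u

/-- The image of an oriented set under a diffeomorphism is oriented. -/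
theorem IsUnitNormalField.exists_image (hν : IsUnitNormalField Γ ν) (hΦ : ContDiff ℝ 1 Φ)
    (hΨ : ContDiff ℝ 1 Ψ) (hl : Function.LeftInverse Ψ Φ) :
    ∃ ν', IsUnitNormalField (Φ '' Γ) ν' := by
  have dΦ := hΦ.differentiable one_ne_zero
  have dΨ := hΨ.differentiable one_ne_zero
  -- Normals are covectors: they are transported by the adjoint of the derivative of the inverse
  -- map, and normalized afterwards.
  let N : EuclideanSpace ℝ (Fin n) → EuclideanSpace ℝ (Fin n) := fun z =>
    ContinuousLinearMap.adjoint (fderiv ℝ Ψ z) (ν (Ψ z))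
  have hN : ∀ z u, inner ℝ (N z) u = inner ℝ (ν (Ψ z)) (fderiv ℝ Ψ z u) := fun z u =>
    ContinuousLinearMap.adjoint_inner_left _ _ _
  have hN0 : ∀ z ∈ Φ '' Γ, N z ≠ 0 := by
    rintro _ ⟨y, hy, rfl⟩ h
    have h1 := hN (Φ y) (fderiv ℝ Φ y (ν y))
    rw [h, inner_zero_left, fderiv_leftInverse_apply dΦ dΨ hl, hl y, real_inner_self_eq_norm_sq,
      (hν.2 y hy).1] at h1
    norm_num at h1
  have hNc : ContinuousOn N (Φ '' Γ) := by
    have h1 : Continuous fun z => ContinuousLinearMap.adjoint (fderiv ℝ Ψ z) :=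
      (LinearIsometryEquiv.continuous _).comp (hΨ.continuous_fderiv one_ne_zero)
    refine h1.continuousOn.clm_apply (hν.1.comp hΨ.continuous.continuousOn ?_)
    rintro _ ⟨y, hy, rfl⟩
    rwa [hl y]
  refine ⟨fun z => ‖N z‖⁻¹ • N z, (hNc.norm.inv₀ fun z hz => norm_ne_zero_iff.2 (hN0 z hz)).smul hNc,
    fun z hz => ⟨norm_smul_inv_norm (hN0 z hz), fun ξ hξ => ?_⟩⟩
  rw [inner_smul_left, hN]
  have h1 : fderiv ℝ Ψ z ξ ∈ tangentSpaceAt Γ (Ψ z) := by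
    have h2 := ((dΨ z).hasFDerivAt.hasFDerivWithinAt (s := Φ '' Γ)).mapsTo_tangent_cone
    rw [hl.image_image] at h2
    have h3 : Submodule.map (fderiv ℝ Ψ z : EuclideanSpace ℝ (Fin n) →ₗ[ℝ] EuclideanSpace ℝ (Fin n))
        (tangentSpaceAt (Φ '' Γ) z) ≤ tangentSpaceAt Γ (Ψ z) := by
      rw [tangentSpaceAt, Submodule.map_span]
      exact Submodule.span_mono (image_subset_iff.2 h2)
    exact h3 (Submodule.mem_map_of_mem hξ)
  have hzΓ : Ψ z ∈ Γ := by
    obtain ⟨y, hy, rfl⟩ := hz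
    rwa [hl y]
  rw [(hν.2 _ hzΓ).2 _ h1, mul_zero]

/-- The class of hypersurfaces is invariant under diffeomorphisms of the same regularity. -/
theorem image_mem_hypersurfaces (hα₀ : 0 < α) (hα₁ : α < 1) (hΓ : Γ ∈ hypersurfaces n 2 α)
    (hΦ : ∀ x, IsLittleHolderAtTwo α Φ x) (hΨ : ContDiff ℝ 2 Ψ) (hl : Function.LeftInverse Ψ Φ)
    (hr : Function.RightInverse Ψ Φ) : Φ '' Γ ∈ hypersurfaces n 2 α := by
  have hΦ2 : ContDiff ℝ 2 Φ := contDiff_iff_contDiffAt.2 fun x => (hΦ x).1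
  have hΨα : ∀ x, IsLittleHolderAtTwo α Ψ x := fun x =>
    IsLittleHolderAtTwo.inverse hα₀ hα₁ hΦ hΨ hl hr x
  obtain ⟨hc, hne, ⟨ν, hν⟩, hF⟩ := hΓ
  refine ⟨hc.image hΦ2.continuous, hne.image _,
    hν.exists_image (hΦ2.of_le (by norm_num)) (hΨ.of_le (by norm_num)) hl, ?_⟩
  rintro _ ⟨y, hy, rfl⟩
  obtain ⟨r, hr0, F, hFr, hF0, hFΓ⟩ := hF y hy
  have hopen : IsOpen (Ψ ⁻¹' ball y r) := isOpen_ball.preimage hΨ.continuous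
  have hmem : Φ y ∈ Ψ ⁻¹' ball y r := by
    rw [mem_preimage, hl y]
    exact mem_ball_self hr0
  have hFα : ∀ x ∈ Ψ ⁻¹' ball y r, IsLittleHolderAtTwo α (F ∘ Ψ) x := fun x hx =>
    (hFr.isLittleHolderAtTwo hα₀ hα₁ isOpen_ball hx).comp hα₀ hα₁ (hΨα x)
  obtain ⟨r₁, hr₁, hm⟩ := exists_memLittleHolder_ball hα₀ hα₁
    (Filter.mem_of_superset (hopen.mem_nhds hmem) hFα)
  obtain ⟨r₂, hr₂, hs⟩ := Metric.isOpen_iff.1 hopen _ hmem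
  have s1 : ball (Φ y) (min r₁ r₂) ⊆ ball (Φ y) r₁ := ball_subset_ball (min_le_left _ _)
  have s2 : ball (Φ y) (min r₁ r₂) ⊆ Ψ ⁻¹' ball y r :=
    (ball_subset_ball (min_le_right _ _)).trans hs
  -- The defining function is transported by `Ψ`. One radius makes it of class `buc^{2+α}`, the
  -- other keeps `Ψ` inside the ball where `F` defines `Γ`.
  refine ⟨min r₁ r₂, lt_min hr₁ hr₂, F ∘ Ψ, hm.mono s1, fun x hx h => ?_, ?_⟩
  · obtain ⟨u, hu⟩ := fderiv_apply_ne_zero_exists (hF0 _ (s2 hx))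
    have d1 := (hFr.1.1.contDiffAt (isOpen_ball.mem_nhds (s2 hx))).differentiableAt
      (x := Ψ x) two_ne_zero
    have d2 := (hΨ.differentiable two_ne_zero) x
    rw [fderiv_comp x d1 d2] at h
    have h1 := DFunLike.congr_fun h (fderiv ℝ Φ (Ψ x) u)
    have h2 := fderiv_leftInverse_apply (hΦ2.differentiable two_ne_zero)
      (hΨ.differentiable two_ne_zero) hl (Ψ x) u
    rw [hr x] at h2
    rw [ContinuousLinearMap.comp_apply, h2] at h1
    exact hu h1
  · ext z
    constructor
    · rintro ⟨⟨q, hq, rfl⟩, hz⟩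
      have h1 := s2 hz
      rw [mem_preimage, hl q] at h1
      refine ⟨hz, ?_⟩
      rw [Function.comp_apply, hl q]
      exact (hFΓ.le ⟨hq, h1⟩).2
    · rintro ⟨hz, hz0⟩
      exact ⟨⟨Ψ z, (hFΓ.ge ⟨s2 hz, hz0⟩).1, hr z⟩, hz⟩

end image

/-! ### Curves of hypersurfaces and their velocity fields -/

section pointwise

variable {E : Type} [NormedAddCommGroup E] [NormedSpace ℝ E] {α : ℝ} {Γ : Set E}

theorem abs_le_of_localHolderNorm_lt {k : ℕ} {y : E} (hy : y ∈ Γ) {r ε : ℝ} (hr : 0 < r)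
    (hε : 0 ≤ ε) {f : Γ → ℝ} (h : localHolderNorm k α Γ y r f < ENNReal.ofReal ε) :
    |f ⟨y, hy⟩| ≤ ε := by
  simp only [localHolderNorm, iInf_lt_iff] at h
  obtain ⟨F, -, hfF, hF⟩ := h
  rw [hfF ⟨y, hy⟩ (mem_ball_self hr)]
  exact norm_le_of_holderNorm_le hε hF.le (mem_ball_self hr)

theorem localHolderNorm_zero (k : ℕ) (y : E) (r : ℝ) : localHolderNorm k α Γ y r 0 = 0 := by
  refine le_antisymm ?_ bot_le
  exact iInf_le_of_le 0 (iInf_le_of_le (MemLittleHolder.zero k α _)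
    (iInf_le_of_le (fun _ _ => rfl) (holderNorm_zero k α _).le))

theorem HasHolderDerivAtZero.hasDerivAt {k : ℕ} {ρ : ℝ → littleHolder k α Γ}
    {h : littleHolder k α Γ} (hρ : HasHolderDerivAtZero k α Γ ρ h) (h0 : ρ 0 = 0) (y : Γ) :
    HasDerivAt (fun s => (ρ s : Γ → ℝ) y) ((h : Γ → ℝ) y) 0 := by
  obtain ⟨r, hr, hlim⟩ := hρ y y.2
  rw [hasDerivAt_iff_tendsto_slope_zero, Metric.tendsto_nhds]
  intro ε hε
  filter_upwards [hlim.eventually (gt_mem_nhds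
    (ENNReal.ofReal_pos.2 (half_pos hε)))] with s hs
  have h1 := abs_le_of_localHolderNorm_lt y.2 hr (half_pos hε).le hs
  have e : (ρ 0 : Γ → ℝ) y = 0 := by rw [h0]; rfl
  have h2 : |s⁻¹ * (ρ s : Γ → ℝ) y - (h : Γ → ℝ) y| ≤ ε / 2 := by simpa [h0] using h1
  rw [zero_add, Real.dist_eq, e, sub_zero, smul_eq_mul]
  linarith

theorem hasHolderDerivAtZero_smul (k : ℕ) (h : littleHolder k α Γ) :
    HasHolderDerivAtZero k α Γ (fun s => s • h) h := by
  intro y _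
  refine ⟨1, one_pos, tendsto_const_nhds.congr' ?_⟩
  filter_upwards [self_mem_nhdsWithin] with s hs
  have e : s⁻¹ • (s • h - (0 : ℝ) • h) - h = 0 := by
    rw [zero_smul, sub_zero, smul_smul, inv_mul_cancel₀ hs, one_smul, sub_self]
  rw [e]
  exact (localHolderNorm_zero k y 1).symm

end pointwise

/-! ### Velocity fields of curves given in flow coordinates -/

section velocity

variable {n : ℕ} {α : ℝ} {Γ : Set (EuclideanSpace ℝ (Fin n))}
  {ν v : EuclideanSpace ℝ (Fin n) → EuclideanSpace ℝ (Fin n)} {K : NNReal} {M : ℝ}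

theorem flowGraph_zero (hK : LipschitzWith K v) (hM : ∀ x, ‖v x‖ ≤ M) :
    flowGraph Γ v 0 = Γ := by
  simp [flowGraph, flowMap_zero_time hK hM]

theorem image_flowMap_eq_flowGraph {F : EuclideanSpace ℝ (Fin n) → ℝ} {ρ : Γ → ℝ}
    (h : ∀ y : Γ, F y = ρ y) : (fun x => flowMap v (F x) x) '' Γ = flowGraph Γ v ρ := by
  rw [flowGraph, image_eq_range]
  simp only [h]

/-- Transversality to the level set holds because `F'(y) v = F'(y) ν * ⟨ν, v⟩` and both factors are
nonzero. -/
theorem hasLocalCoordinates_flowMap (hΓ : Γ ∈ hypersurfaces n 2 α) (hν : IsUnitNormalField Γ ν)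
    (hv : ContDiff ℝ 3 v) (hK : LipschitzWith K v) (hM : ∀ x, ‖v x‖ ≤ M)
    {y : EuclideanSpace ℝ (Fin n)} (hy : y ∈ Γ) (hνv : 0 < inner ℝ (ν y) (v y)) :
    HasLocalCoordinates Γ (fun q => flowMap v q.2 q.1) y := by
  obtain ⟨r, hr, F, hF, hF0, hFΓ⟩ := hΓ.2.2.2 y hy
  have hyr := mem_ball_self (x := y) hr
  have hF1 : ContDiffAt ℝ 1 F y :=
    (hF.1.1.contDiffAt (isOpen_ball.mem_nhds hyr)).of_le (by norm_num)
  refine hasLocalCoordinates_of_transversal (X' := fun q => flowMap v q.2 q.1) (w := v y) hy hr hF1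
    hFΓ ((contDiffAt_flowMap (m := 3) three_ne_zero hv hK hM y).of_le (by norm_num))
    (flowMap_zero_time hK hM) ?_ ?_ fun _ _ _ => rfl
  · have h := hasDerivAt_flowMap hK hM y 0
    rwa [flowMap_zero_time hK hM] at h
  · rw [hν.fderiv_apply_eq hy hr hF1 (hF0 y hyr) hFΓ]
    exact mul_ne_zero (hν.fderiv_normal_ne_zero hy hr hF1 (hF0 y hyr) hFΓ) hνv.ne'

theorem hasDerivAt_flowMap_comp (hK : LipschitzWith K v) (hM : ∀ x, ‖v x‖ ≤ M) {f : ℝ → ℝ} {c : ℝ}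
    (hf : HasDerivAt f c 0) (h0 : f 0 = 0) (y : EuclideanSpace ℝ (Fin n)) :
    HasDerivAt (fun s => flowMap v (f s) y) (c • v y) 0 := by
  have h1 := hasDerivAt_flowMap hK hM y (f 0)
  have h2 := h1.scomp (0 : ℝ) hf
  rwa [h0, flowMap_zero_time hK hM] at h2

/-- A differentiable curve of hypersurfaces has a velocity field. -/
theorem IsCurveWithCoordinate.isVelocityField (hΓ : IsCompact Γ) (hv : ContDiff ℝ 3 v)
    (hK : LipschitzWith K v) (hM : ∀ x, ‖v x‖ ≤ M) {γ : ℝ → Set (EuclideanSpace ℝ (Fin n))}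
    {ρ : ℝ → littleHolder 2 α Γ} {h : littleHolder 2 α Γ}
    (hγ : IsCurveWithCoordinate 2 α Γ v γ ρ h) :
    IsVelocityField Γ γ fun y => (h : Γ → ℝ) y • v y := by
  obtain ⟨-, -, h0, hγρ, hρ⟩ := hγ
  obtain ⟨S, hS, C, hC, hev⟩ := hρ.exists_extension hΓ h0
  obtain ⟨F, hF⟩ := hev.choice
  obtain ⟨a₀, ha₀, hdiff⟩ := exists_flowMap_diffeo hv hK hM hS
  have hsmall : ∀ᶠ s in 𝓝 (0 : ℝ), C * |s| < a₀ := by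
    have : Tendsto (fun s : ℝ => C * |s|) (𝓝 0) (𝓝 (C * |0|)) :=
      (continuous_const.mul continuous_abs).tendsto 0
    rw [abs_zero, mul_zero] at this
    exact this.eventually (gt_mem_nhds ha₀)
  refine ⟨fun s x => flowMap v (F s x) x, ?_, ?_, fun y => ?_⟩
  -- A property that holds eventually near `0` also holds at `s = 0`, where the bound `C * |s|`
  -- forces `F 0 = 0`; hence the identity exactly.
  · funext x
    have h1 := hF.self_of_nhds.2.2.1 x
    rw [abs_zero, mul_zero] at h1
    simp only [abs_nonpos_iff.1 h1, flowMap_zero_time hK hM, id]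
  · filter_upwards [hF, hsmall, hγρ] with s hs hs' hsγ
    obtain ⟨d1, d2, -⟩ := hdiff _ (F s) hs' hs.1 hs.2.1 hs.2.2.1 hs.2.2.2.1
    exact ⟨d1, d2, by rw [hsγ]; exact image_flowMap_eq_flowGraph hs.2.2.2.2⟩
  · refine (hasDerivAt_flowMap_comp hK hM (hρ.hasDerivAt h0 y) (by rw [h0]; rfl)
      y).congr_of_eventuallyEq ?_
    filter_upwards [hF] with s hs
    rw [hs.2.2.2.2 y]

/-- Every velocity field of a differentiable curve of hypersurfaces is determined, up to tangential
fields, by the derivative of the coordinate. -/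
theorem IsCurveWithCoordinate.sub_mem_tangentSpaceAt (hΓ : IsCompact Γ)
    (hK : LipschitzWith K v) (hM : ∀ x, ‖v x‖ ≤ M) {γ : ℝ → Set (EuclideanSpace ℝ (Fin n))}
    {ρ : ℝ → littleHolder 2 α Γ} {h : littleHolder 2 α Γ}
    (hγ : IsCurveWithCoordinate 2 α Γ v γ ρ h) {V : Γ → EuclideanSpace ℝ (Fin n)}
    (hV : IsVelocityField Γ γ V) (y : Γ) :
    V y - (h : Γ → ℝ) y • v y ∈ tangentSpaceAt Γ (y : EuclideanSpace ℝ (Fin n)) := by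
  obtain ⟨-, -, h0, hγρ, hρ⟩ := hγ
  obtain ⟨Φ, hΦ0, hΦ, hΦV⟩ := hV
  obtain ⟨S, -, C, hC, hext⟩ := hρ.exists_extension hΓ h0
  have hM0 : 0 ≤ M := (norm_nonneg _).trans (hM 0)
  -- The point `Φ s y` lies on `Γ_{ρ(s)}`, so it is reached along the flow from some `q s ∈ Γ`. No
  -- regularity of `s ↦ q s` is needed beyond `q s → y`, which follows from the displacement bound.
  have hq : ∀ᶠ s in 𝓝 (0 : ℝ), ∃ q : Γ, flowMap v ((ρ s : Γ → ℝ) q) q = Φ s y := by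
    filter_upwards [hΦ, hγρ] with s h1 h2
    have h3 : Φ s y ∈ flowGraph Γ v (ρ s) := by
      rw [← h2, ← h1.2.2]
      exact mem_image_of_mem _ y.2
    exact h3
  have : Nonempty Γ := ⟨y⟩
  obtain ⟨q, hq⟩ := hq.choice
  have hρb : ∀ᶠ s in 𝓝 (0 : ℝ), (∀ x : Γ, |(ρ s : Γ → ℝ) x| ≤ C * |s|) ∧
      ∀ x z : Γ, |(ρ s : Γ → ℝ) x - (ρ s : Γ → ℝ) z| ≤
        C * |s| * ‖(x : EuclideanSpace ℝ (Fin n)) - z‖ := by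
    filter_upwards [hext] with s hs
    obtain ⟨F, -, -, h1, h2, h3⟩ := hs
    exact ⟨fun x => by rw [← h3]; exact h1 x, fun x z => by rw [← h3, ← h3]; exact h2 x z⟩
  have hy0 : Φ 0 y = y := by rw [hΦ0]; rfl
  have hρ0 : (ρ 0 : Γ → ℝ) y = 0 := by rw [h0]; rfl
  have d1 : Tendsto (fun s : ℝ => s⁻¹ • (Φ s y - y)) (𝓝[≠] 0) (𝓝 (V y)) := by
    have := hasDerivAt_iff_tendsto_slope_zero.1 (hΦV y)
    simpa only [zero_add, hy0] using this
  have d2 : Tendsto (fun s : ℝ => s⁻¹ • (flowMap v ((ρ s : Γ → ℝ) y) y - y)) (𝓝[≠] 0)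
      (𝓝 ((h : Γ → ℝ) y • v y)) := by
    have := hasDerivAt_iff_tendsto_slope_zero.1
      (hasDerivAt_flowMap_comp hK hM (hρ.hasDerivAt h0 y) hρ0 y)
    simpa only [zero_add, hρ0, flowMap_zero_time hK hM] using this
  have hqy : Tendsto (fun s => ((q s : EuclideanSpace ℝ (Fin n)) - y)) (𝓝 0) (𝓝 0) := by
    have hb : ∀ᶠ s in 𝓝 (0 : ℝ),
        ‖((q s : EuclideanSpace ℝ (Fin n)) - y)‖ ≤ M * (C * |s|) + ‖Φ s y - y‖ := by
      filter_upwards [hq, hρb] with s h1 h2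
      have h3 := norm_flowMap_sub_le hK hM (q s : EuclideanSpace ℝ (Fin n)) ((ρ s : Γ → ℝ) (q s))
      rw [h1, norm_sub_rev] at h3
      have h4 : ((q s : EuclideanSpace ℝ (Fin n)) - y) = (q s - Φ s y) + (Φ s y - y) := by abel
      rw [h4]
      refine (norm_add_le _ _).trans (add_le_add (h3.trans ?_) le_rfl)
      exact mul_le_mul_of_nonneg_left (h2.1 _) hM0
    refine squeeze_zero_norm' hb ?_
    have c1 : Tendsto (fun s : ℝ => M * (C * |s|)) (𝓝 0) (𝓝 (M * (C * |0|))) :=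
      (continuous_const.mul (continuous_const.mul continuous_abs)).tendsto 0
    have c2 : Tendsto (fun s : ℝ => ‖Φ s y - y‖) (𝓝 0) (𝓝 ‖Φ 0 y - y‖) :=
      ((hΦV y).continuousAt.sub continuousAt_const).norm
    simpa [hy0] using c1.add c2
  -- The displacements at `q s` and `y` differ by `O(|s| ‖q s - y‖)`. Division by `s` leaves a
  -- multiple of `‖q s - y‖`, which tends to zero.
  have d3 : Tendsto (fun s : ℝ => s⁻¹ • ((flowMap v ((ρ s : Γ → ℝ) (q s)) (q s) - q s) -
      (flowMap v ((ρ s : Γ → ℝ) y) y - y))) (𝓝[≠] 0) (𝓝 0) := by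
    have hs1 : ∀ᶠ s in 𝓝 (0 : ℝ), C * |s| < 1 := by
      have : Tendsto (fun s : ℝ => C * |s|) (𝓝 0) (𝓝 (C * |0|)) :=
        (continuous_const.mul continuous_abs).tendsto 0
      rw [abs_zero, mul_zero] at this
      exact this.eventually (gt_mem_nhds one_pos)
    have hb : ∀ᶠ s in 𝓝[≠] (0 : ℝ),
        ‖s⁻¹ • ((flowMap v ((ρ s : Γ → ℝ) (q s)) (q s) - q s) -
          (flowMap v ((ρ s : Γ → ℝ) y) y - y))‖ ≤
        (K * Real.exp K + M) * C * ‖((q s : EuclideanSpace ℝ (Fin n)) - y)‖ := by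
      filter_upwards [mem_nhdsWithin_of_mem_nhds hρb, mem_nhdsWithin_of_mem_nhds hs1,
        self_mem_nhdsWithin] with s h1 h2 hs
      have h3 := norm_displacement_sub_le hK hM (q s : EuclideanSpace ℝ (Fin n)) y
        (s := (ρ s : Γ → ℝ) y) ((h1.1 (q s)).trans h2.le)
      rw [norm_smul, norm_inv, Real.norm_eq_abs, inv_mul_le_iff₀ (abs_pos.2 hs)]
      refine h3.trans ?_
      have e1 : K * Real.exp K * |(ρ s : Γ → ℝ) (q s)| *
          ‖((q s : EuclideanSpace ℝ (Fin n)) - y)‖ ≤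
          K * Real.exp K * (C * |s|) * ‖((q s : EuclideanSpace ℝ (Fin n)) - y)‖ := by
        gcongr
        exact h1.1 _
      have e2 := mul_le_mul_of_nonneg_left (h1.2 (q s) y) hM0
      refine (add_le_add e1 e2).trans_eq ?_
      ring
    refine squeeze_zero_norm' hb ?_
    have := hqy.norm.const_mul ((K * Real.exp K + M) * C)
    rw [norm_zero, mul_zero] at this
    exact this.mono_left nhdsWithin_le_nhds
  -- The limit of `(q s - y) / s` along points of `Γ` is by definition a vector of the tangent cone.
  refine Submodule.subset_span (mem_tangentConeAt_of_seq (𝓝[≠] (0 : ℝ)) (fun s => s⁻¹)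
    (fun s => ((q s : EuclideanSpace ℝ (Fin n)) - y)) (hqy.mono_left nhdsWithin_le_nhds)
    (Eventually.of_forall fun s => ?_) ?_)
  · rw [add_sub_cancel]
    exact (q s).2
  · have := (d1.sub d2).sub d3
    rw [sub_zero] at this
    refine this.congr' ?_
    filter_upwards [mem_nhdsWithin_of_mem_nhds hq] with s hs
    rw [← smul_sub, ← smul_sub, hs]
    congr 1
    abel

/-- In the direction of each function of class `buc^{2+α}` there is a curve of hypersurfaces. -/
theorem isCurveWithCoordinate_smul (hα₀ : 0 < α) (hα₁ : α < 1) (hΓ : Γ ∈ hypersurfaces n 2 α)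
    (hv : ContDiff ℝ 3 v) (hK : LipschitzWith K v) (hM : ∀ x, ‖v x‖ ≤ M)
    (h : littleHolder 2 α Γ) :
    IsCurveWithCoordinate 2 α Γ v (fun s => flowGraph Γ v (s • h : littleHolder 2 α Γ))
      (fun s => s • h) h := by
  refine ⟨?_, ?_, zero_smul ℝ h, Eventually.of_forall fun _ => rfl, hasHolderDerivAtZero_smul 2 h⟩
  · simp only [zero_smul]
    exact flowGraph_zero hK hM
  · obtain ⟨H, hHc, hHα, hHh⟩ := exists_isLittleHolderAtTwo_extension hα₀ hα₁ hΓ.1 h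
    have hH2 : ContDiff ℝ 2 H := contDiff_iff_contDiffAt.2 fun x => (hHα x).1
    obtain ⟨a₀, ha₀, hdiff⟩ := exists_flowMap_diffeo hv hK hM hHc
    obtain ⟨B, hB⟩ := hH2.continuous.bounded_above_of_compact_support hHc
    obtain ⟨L, hL⟩ := hH2.lipschitzWith_of_hasCompactSupport hHc two_ne_zero
    -- A single constant has to bound both the size and the Lipschitz constant of `s * H`.
    have hsmall : ∀ᶠ s in 𝓝 (0 : ℝ), (|B| + L) * |s| < a₀ := by
      have : Tendsto (fun s : ℝ => (|B| + L) * |s|) (𝓝 0) (𝓝 ((|B| + L) * |0|)) :=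
        (continuous_const.mul continuous_abs).tendsto 0
      rw [abs_zero, mul_zero] at this
      exact this.eventually (gt_mem_nhds ha₀)
    filter_upwards [hsmall] with s hs
    obtain ⟨-, ⟨Ψ, hΨ, hl, hr⟩, hΦ⟩ := hdiff _ (fun x => s * H x) hs (contDiff_const.mul hH2)
      (fun x hx => by rw [image_eq_zero_of_notMem_tsupport hx, mul_zero]) (fun x => by
        rw [abs_mul, mul_comm]
        refine mul_le_mul_of_nonneg_right ?_ (abs_nonneg s)
        have h1 : |H x| ≤ B := hB x
        linarith [le_abs_self B, L.coe_nonneg]) (fun x y => by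
        rw [← mul_sub, abs_mul]
        have h1 : |H x - H y| ≤ L * ‖x - y‖ := hL.norm_sub_le x y
        have h2 : 0 ≤ |B| * |s| * ‖x - y‖ := by positivity
        nlinarith [mul_le_mul_of_nonneg_left h1 (abs_nonneg s)])
    have h1 := image_mem_hypersurfaces hα₀ hα₁ hΓ (hΦ α hα₀ hα₁ fun x =>
      (contDiffAt_const.isLittleHolderAtTwo hα₀ hα₁).mul hα₀ hα₁ (hHα x)) hΨ hl hr
    rwa [image_flowMap_eq_flowGraph (ρ := ((s • h : littleHolder 2 α Γ) : Γ → ℝ)) fun y => by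
      rw [hHh y]; rfl] at h1

/-- Pairing a tangential field `h v` with `ν` gives `h ⟨ν, v⟩ = 0`, and the second factor is
positive. -/
theorem transversalMap_injective (hν : IsUnitNormalField Γ ν)
    (hνv : ∀ y ∈ Γ, 0 < inner ℝ (ν y) (v y)) :
    Function.Injective (transversalMap 2 α Γ v) := by
  refine (injective_iff_map_eq_zero _).2 fun h hh => ?_
  have h1 : (fun y : Γ => (h : Γ → ℝ) y • v y) ∈ tangentialFields Γ :=
    (Submodule.Quotient.mk_eq_zero _).1 hh
  ext y
  have h2 := (hν.2 y y.2).2 _ (h1 y (mem_univ y))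
  rw [inner_smul_right] at h2
  exact (mul_eq_zero.1 h2).resolve_right (hνv y y.2).ne'

end velocity

theorem mainTheorem5 (n : ℕ) (α : ℝ) (hα₀ : 0 < α) (hα₁ : α < 1)
    (Γ : Set (EuclideanSpace ℝ (Fin n))) (hΓ : Γ ∈ hypersurfaces n 2 α)
    (ν : EuclideanSpace ℝ (Fin n) → EuclideanSpace ℝ (Fin n)) (hν : IsUnitNormalField Γ ν) :
    (∃ R : ℝ, IsTubularRadius Γ ν R) ∧
    ∀ (R : ℝ) (η : ℝ → ℝ) (ψ : EuclideanSpace ℝ (Fin n) → ℝ),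
      IsTubularRadius Γ ν R → IsCutoff R η → IsMollifier ψ →
      ∃ δ₀ : ℝ, 0 < δ₀ ∧ ∀ δ : ℝ, 0 < δ → δ < δ₀ →
        ∀ v : EuclideanSpace ℝ (Fin n) → EuclideanSpace ℝ (Fin n),
          v = regularizedNormal Γ ν R η ψ δ →
          -- the flow of the regularized field exists and gives coordinates near the hypersurface
          (∀ y, flowMap v 0 y = y ∧
            ∀ r, HasDerivAt (fun t => flowMap v t y) (v (flowMap v r y)) r) ∧
          (∃ r₀ : ℝ, 0 < r₀ ∧
            InjOn (fun q : EuclideanSpace ℝ (Fin n) × ℝ => flowMap v q.2 q.1)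
              (Γ ×ˢ Ioo (-r₀) r₀) ∧
            IsOpen ((fun q : EuclideanSpace ℝ (Fin n) × ℝ => flowMap v q.2 q.1) ''
              (Γ ×ˢ Ioo (-r₀) r₀))) ∧
          -- a curve whose coordinate has derivative `h` has the class of `h v` as tangent vector
          (∀ γ ρ h, IsCurveWithCoordinate 2 α Γ v γ ρ h →
            (∃ V, IsVelocityField Γ γ V) ∧
            ∀ V, IsVelocityField Γ γ V → (tangentialFields Γ).mkQ V = transversalMap 2 α Γ v h) ∧
          -- `h ↦ h v` is a linear isomorphism onto the tangent space
          Function.Injective (transversalMap 2 α Γ v) ∧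
          (LinearMap.range (transversalMap 2 α Γ v) :
            Set ((Γ → EuclideanSpace ℝ (Fin n)) ⧸ tangentialFields Γ)) =
              hypersurfaceTangentSpace 2 α Γ v := by
  refine ⟨exists_tubularRadius hΓ hν, fun R η ψ hR hη hψ => ?_⟩
  obtain ⟨δ₀, hδ₀, hpos⟩ := exists_inner_regularizedNormal_pos hΓ.1 hΓ.2.1 hR hη hν hψ
  refine ⟨δ₀, hδ₀, fun δ hδ hδ' v hv => ?_⟩
  have hνv : ∀ y ∈ Γ, 0 < inner ℝ (ν y) (v y) := by rw [hv]; exact hpos δ hδ hδ'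
  have hs : ContDiff ℝ ∞ v := by rw [hv]; exact contDiff_regularizedNormal hΓ.2.1 hR hη hν hψ hδ
  have hc : HasCompactSupport v := by
    rw [hv]; exact hasCompactSupport_regularizedNormal hΓ.1 hΓ.2.1 hR hη hν hψ hδ
  have hv3 : ContDiff ℝ 3 v := contDiff_infty.1 hs 3
  obtain ⟨K, hK⟩ := hs.lipschitzWith_of_hasCompactSupport hc (by simp)
  obtain ⟨M, hM⟩ := hs.continuous.bounded_above_of_compact_support hc
  have huniq : ∀ γ ρ h, IsCurveWithCoordinate 2 α Γ v γ ρ h → ∀ V, IsVelocityField Γ γ V →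
      (tangentialFields Γ).mkQ V = transversalMap 2 α Γ v h := fun γ ρ h hγ V hV =>
    (Submodule.Quotient.eq _).2 fun y _ => hγ.sub_mem_tangentSpaceAt hΓ.1 hK hM hV y
  refine ⟨flowMap_spec hK hM, ?_, fun γ ρ h hγ => ⟨⟨_, hγ.isVelocityField hΓ.1 hv3 hK hM⟩,
    huniq γ ρ h hγ⟩, transversalMap_injective hν hνv, ?_⟩
  · obtain ⟨r₀, hr₀, hinj, hopen, -⟩ := exists_global_coordinates hΓ.1
      (X := fun q : EuclideanSpace ℝ (Fin n) × ℝ => flowMap v q.2 q.1) (M := M)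
      (fun y hy => hasLocalCoordinates_flowMap hΓ hν hv3 hK hM hy (hνv y hy))
      (fun y _ r => by rw [dist_eq_norm]; exact norm_flowMap_sub_le hK hM y r)
    exact ⟨r₀, hr₀, hinj, hopen⟩
  -- Each `h` is realized by the curve with coordinate `s • h`; conversely `huniq` identifies the
  -- class of any velocity field with the image of the coordinate derivative.
  · ext ξ
    constructor
    · rintro ⟨h, rfl⟩
      have hγ := isCurveWithCoordinate_smul hα₀ hα₁ hΓ hv3 hK hM h
      exact ⟨_, _, h, hγ, _, hγ.isVelocityField hΓ.1 hv3 hK hM, rfl⟩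
    · rintro ⟨γ, ρ, h, hγ, V, hV, rfl⟩
      exact ⟨h, (huniq γ ρ h hγ V hV).symm⟩
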